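/- Notation. Let $\mathbb Q_{q,t}=\mathbb Q(q,t)$. For $n\ge 0$ let $\mathbb E_n$ be the set of integer sequences $\mathsf e=(\mathsf e(1),\dots,\mathsf e(n))$ with $0\le \mathsf e(i)<i$ and $\mathsf e(i)\le \mathsf e(i+1)$. The oriented unit interval graph $\Gamma=\Gamma_{\mathsf e}$ has vertices $1,\dots,n$ and an edge $j\to i$ exactly when $\mathsf e(i)<j<i$. Its chromatic quasisymmetric function is $X_\Gamma(t)=\sum_\kappa t^{\mathrm{asc}(\kappa)}\prod_{v}X_{\kappa(v)}$, summed over all proper colorings $\kappa$ of the vertices by positive integers, where $\mathrm{asc}(\kappa)$ is the number of edges $v\to w$ with $\kappa(v)<\kappa(w)$. For $m\ge 1$ put $X_{i+km}=q^{-k}X_i$ $(1\le i\le m,\ k\in\mathbb Z)$ in $\mathbb Q_{q,t}[X_1^{\pm1},\dots,X_m^{\pm1}]$. The affine Hecke algebra $\mathscr H_m$ of $GL_m$ is the $\mathbb Q_{q,t}$-algebra generated by $T_i$ $(i\in\mathbb Z/m\mathbb Z)$ and $\Pi^{\pm1}$ with relations $(T_i-t)(T_i+1)=0$; $T_iT_{i+1}T_i=T_{i+1}T_iT_{i+1}$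 if $m>2$; $T_iT_j=T_jT_i$ if $j\ne i\pm1$; $\Pi T_i=T_{i+1}\Pi$. It acts on Laurent polynomials (level one action) by $$T_i(F)=t\,s_i(F)+(t-1)\frac{F-s_i(F)}{1-X_iX_{i+1}^{-1}},\qquad \Pi(F)=X_1F(X_2,\dots,X_{m+1}),$$ where $s_i$ exchanges $X_i$ and $X_{i+1}$ for $1\le i<m$, and $s_0(F)=X_1X_0^{-1}F(X_0,X_2,\dots,X_{m-1},X_{m+1})$ (for $m=1$ one takes $s_0=\mathrm{id}$; this case is not used below). For integers $e<i$ let $$\mathsf S^{(m)}_{i,e}=1+T_i^{-1}+T_{i+1}^{-1}T_i^{-1}+\dots+T_{m+e-1}^{-1}\cdots T_i^{-1}\ \text{ if } e\ge i-m,\qquad \mathsf S^{(m)}_{i,e}=0\ \text{ if } e<i-m .$$ Let $\pi_{m,m'}$ $(0<m'<m)$ be the truncation $X_{m'+1}=\dots=X_m=0$ of polynomials, let $\Lambda_{q,t}$ be the ring of symmetric functions over $\mathbb Q_{q,t}$, that is, the graded projective limit over $m\ge1$, with respect to the maps $\pi_{m,m'}$, of the rings of symmetric polynomials in $m$ variables,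 and let $e_r$ be the elementary symmetric functions. Theorem A. There is a unique $\mathbb Q_{q,t}$-algebra automorphism $\mathsf N$ of $\Lambda_{q,t}$ with $\mathsf N(e_r)=t^{r(r-1)/2}e_r$ for all $r$. Let $n\ge0$, $\mathsf e\in\mathbb E_n$ and $\Gamma=\Gamma_{\mathsf e}$. (i) For every $m\ge1$, $$X_\Gamma^{(m)}(q,t):=t^{n(m-1)}\,\mathsf S^{(m)}_{1,\mathsf e(1)}\cdots \mathsf S^{(m)}_{n,\mathsf e(n)}(X_1X_2\cdots X_n)\in\mathbb Z[q^{-1},t^{\pm1}][X_1,\dots,X_m]^{\mathfrak S_m}.$$ (ii) For $0<m'<m$ we have $\pi_{m,m'}(X_\Gamma^{(m)}(q,t))=X_\Gamma^{(m')}(q,t)$. Hence these polynomials define a symmetric function $X_\Gamma(q,t)=\varprojlim_m X_\Gamma^{(m)}(q,t)\in\Lambda_{q,t}$. (iii) $X_\Gamma(t)$ lies in $\Lambda_{q,t}$, and the specialization of $X_\Gamma(q,t)$ at $q=1$ is $X_\Gamma(1,t)=\mathsf N(X_\Gamma(t))$. Moreover Kato's formula holds: for every $m\ge1$, with $\overline{\mathsf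 S}^{(m)}_{i,e}=1+s_i+s_{i+1}s_i+\dots+s_{m+e-1}\cdots s_i$ if $e\ge i-m$ and $\overline{\mathsf S}^{(m)}_{i,e}=0$ if $e<i-m$, $$\overline{\mathsf S}^{(m)}_{1,\mathsf e(1)}\cdots\overline{\mathsf S}^{(m)}_{n,\mathsf e(n)}(X_1X_2\cdots X_n)\big|_{q=1}=\sum_{\kappa}\prod_v X_{\kappa(v)},$$ where $\kappa$ runs over the proper colorings of $\Gamma$ with colors $1,\dots,m$. -/

import Mathlib

noncomputable section

namespace QTChrom

section LaurentRing

/-- The Laurent polynomial ring `K[X_1^{±1}, …, X_m^{±1}]`; a monomial is its exponent vector. -/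
abbrev Laurent (K : Type*) [Field K] (m : ℕ) : Type _ := AddMonoidAlgebra K (Fin m → ℤ)

/-- The invertible Laurent monomial `c X^a`. -/
def lmon {K : Type*} [Field K] {m : ℕ} (a : Fin m → ℤ) (c : Kˣ) : (Laurent K m)ˣ where
  val := AddMonoidAlgebra.single a (c : K)
  inv := AddMonoidAlgebra.single (-a) ((c⁻¹ : Kˣ) : K)
  val_inv := by
    rw [AddMonoidAlgebra.single_mul_single, AddMonoidAlgebra.one_def]; simp
  inv_val := by
    rw [AddMonoidAlgebra.single_mul_single, AddMonoidAlgebra.one_def]; simp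

/-- The position (counted from `0`) of the variable of which `X_j` is a multiple. -/
def varIdx (m : ℕ) [NeZero m] (j : ℤ) : Fin m :=
  ⟨((j - 1) % (m : ℤ)).toNat, by
    have hm : (0 : ℤ) < m := by exact_mod_cast Nat.pos_of_ne_zero (NeZero.ne m)
    have h1 := Int.emod_nonneg (j - 1) hm.ne'
    have h2 := Int.emod_lt_of_pos (j - 1) hm
    omega⟩

/-- The elements `X_j` for all `j : ℤ`: `X_1, …, X_m` are the variables and
`X_{i + k m} = q^{-k} X_i`. -/
def Xu {K : Type*} [Field K] (q : Kˣ) (m : ℕ) [NeZero m] (j : ℤ) : (Laurent K m)ˣ :=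
  lmon (Pi.single (varIdx m j) 1) (q ^ (-((j - 1) / (m : ℤ))))

/-- The substitution `F(X_1, …, X_m) ↦ F(y_1, …, y_m)` of invertible elements for the variables. -/
def subst {K : Type*} [Field K] {m : ℕ} {A : Type*} [CommRing A] [Algebra K A] (y : Fin m → Aˣ) :
    Laurent K m →ₐ[K] A :=
  AddMonoidAlgebra.lift K A (Fin m → ℤ)
    { toFun := fun a => ((∏ j, y j ^ (Multiplicative.toAdd a j) : Aˣ) : A)
      map_one' := by simp
      map_mul' := fun a b => by
        rw [← Units.val_mul, ← Finset.prod_mul_distrib]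
        simp [zpow_add] }

variable {K : Type*} [Field K] (q : Kˣ) {m : ℕ}

theorem lmon_mul (a b : Fin m → ℤ) (c d : Kˣ) : lmon a c * lmon b d = lmon (a + b) (c * d) := by
  ext1; simp [lmon, AddMonoidAlgebra.single_mul_single]

theorem lmon_inv (a : Fin m → ℤ) (c : Kˣ) : (lmon a c)⁻¹ = lmon (-a) c⁻¹ := by
  ext1; simp [lmon, Units.inv_mk]

theorem lmon_inj {a b : Fin m → ℤ} {c d : Kˣ} (h : lmon a c = lmon b d) : a = b := by
  have := congrArg (fun x : (Laurent K m)ˣ => (x : Laurent K m).coeff) h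
  simp only [lmon, AddMonoidAlgebra.coeff_single] at this
  rcases (Finsupp.single_eq_single_iff _ _ _ _).1 this with h | h
  · exact h.1
  · exact absurd h.1 c.ne_zero

theorem subst_single {A : Type*} [CommRing A] [Algebra K A] (y : Fin m → Aˣ) (a : Fin m → ℤ)
    (c : K) : subst y (AddMonoidAlgebra.single a c : Laurent K m) =
      c • ((∏ j, y j ^ a j : Aˣ) : A) := by
  simp [subst, AddMonoidAlgebra.lift_single]

variable [NeZero m]

theorem Xu_add (k : ℤ) : Xu q m (k + m) = lmon 0 q⁻¹ * Xu q m k := by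
  have hm : (m : ℤ) ≠ 0 := by exact_mod_cast NeZero.ne m
  have h : k + m - 1 = (k - 1) + m := by ring
  have h1 : varIdx m (k + m) = varIdx m k := by
    unfold varIdx; ext; simp [h]
  rw [Xu, Xu, lmon_mul, h1, h, Int.add_ediv_of_dvd_right (dvd_refl _), Int.ediv_self hm, zero_add,
    neg_add, zpow_add, mul_comm]
  simp

theorem Xu_add_mul (k n : ℤ) : Xu q m (k + n * m) = lmon 0 (q ^ (-n)) * Xu q m k := by
  have hm : (m : ℤ) ≠ 0 := by exact_mod_cast NeZero.ne m
  have h : k + n * m - 1 = (k - 1) + n * m := by ring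
  have h1 : varIdx m (k + n * m) = varIdx m k := by
    unfold varIdx; ext; simp [h]
  rw [Xu, Xu, lmon_mul, h1, h, Int.add_mul_ediv_right _ _ hm, zero_add,
    neg_add, zpow_add, mul_comm]

theorem varIdx_succ (j : Fin m) : varIdx m ((j : ℤ) + 1) = j := by
  ext
  simp only [varIdx, add_sub_cancel_right]
  rw [Int.emod_eq_of_lt (by positivity) (by exact_mod_cast j.2)]
  simp

theorem Xu_succ (j : Fin m) : Xu q m ((j : ℤ) + 1) = lmon (Pi.single j 1) 1 := by
  rw [Xu, varIdx_succ, add_sub_cancel_right,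
    Int.ediv_eq_zero_of_lt (by positivity) (by exact_mod_cast j.2)]
  simp

/-- Every index is one of `1, …, m` up to a multiple of `m`. -/
theorem idx_eq (k : ℤ) : ∃ (j : Fin m) (n : ℤ), k = ((j : ℤ) + 1) + n * m := by
  refine ⟨varIdx m k, (k - 1) / m, ?_⟩
  have hm : (m : ℤ) ≠ 0 := by exact_mod_cast NeZero.ne m
  simp only [varIdx]
  rw [Int.toNat_of_nonneg (Int.emod_nonneg _ hm)]
  have := Int.emod_add_mul_ediv (k - 1) m
  linarith [mul_comm (m : ℤ) ((k - 1) / m)]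

theorem single_one_eq (a : Fin m → ℤ) :
    (AddMonoidAlgebra.single a (1 : K) : Laurent K m) =
      ((∏ j : Fin m, Xu q m ((j : ℤ) + 1) ^ a j : (Laurent K m)ˣ) : Laurent K m) := by
  have hz : ∀ (b : Fin m → ℤ) (n : ℤ), (lmon b (1 : Kˣ)) ^ n = lmon (n • b) 1 := by
    intro b n
    let φ : Multiplicative (Fin m → ℤ) →* (Laurent K m)ˣ :=
      { toFun := fun x => lmon (Multiplicative.toAdd x) 1
        map_one' := by ext1; simp [lmon, AddMonoidAlgebra.one_def]
        map_mul' := fun x y => by rw [lmon_mul]; simp }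
    exact (map_zpow φ (Multiplicative.ofAdd b) n).symm
  have hp : ∀ s : Finset (Fin m), ∏ j ∈ s, Xu q m ((j : ℤ) + 1) ^ a j =
      lmon (∑ j ∈ s, a j • Pi.single j (1 : ℤ)) 1 := by
    intro s
    induction s using Finset.induction_on with
    | empty => ext1; simp [lmon, AddMonoidAlgebra.one_def]
    | insert j s hj ih => rw [Finset.prod_insert hj, Finset.sum_insert hj, ih, Xu_succ, hz, lmon_mul,
        mul_one]
  rw [hp]
  have : ∑ j, a j • (Pi.single j (1 : ℤ) : Fin m → ℤ) = a := by
    ext i; simp [Finset.sum_apply, Pi.single_apply]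
  rw [this]; simp [lmon]

theorem algHom_ext' {A : Type*} [CommRing A] [Algebra K A] {φ ψ : Laurent K m →ₐ[K] A}
    (h : ∀ k : ℤ, φ (Xu q m k) = ψ (Xu q m k)) : φ = ψ := by
  have hu : ∀ k : ℤ, Units.map (φ : Laurent K m →* A) (Xu q m k) =
      Units.map (ψ : Laurent K m →* A) (Xu q m k) := fun k => Units.ext (h k)
  refine AddMonoidAlgebra.algHom_ext (fun a => ?_) (by ext)
  rw [single_one_eq q]
  have h2 : Units.map (φ : Laurent K m →* A) (∏ j : Fin m, Xu q m ((j : ℤ) + 1) ^ a j) =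
      Units.map (ψ : Laurent K m →* A) (∏ j : Fin m, Xu q m ((j : ℤ) + 1) ^ a j) := by
    simp only [map_prod, map_zpow, hu]
  exact congrArg Units.val h2

/-- A substitution `X_k ↦ X_{w k}` with `w` commuting with the shift by `m`. -/
theorem subst_Xu (w : ℤ → ℤ) (hw : ∀ k, w (k + m) = w k + m) (k : ℤ) :
    subst (fun j : Fin m => Xu q m (w ((j : ℤ) + 1))) (Xu q m k : Laurent K m) =
      (Xu q m (w k) : Laurent K m) := by
  have hw' : ∀ (n k : ℤ), w (k + n * m) = w k + n * m := by
    intro n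
    induction n using Int.induction_on with
    | zero => simp
    | succ n ih =>
      intro k
      rw [show k + ((n : ℤ) + 1) * m = (k + n * m) + m by ring, hw, ih]; ring
    | pred n ih =>
      intro k
      have := hw (k + (-(n : ℤ) - 1) * m)
      rw [show k + (-(n : ℤ) - 1) * m + m = k + -(n : ℤ) * m by ring, ih] at this
      linarith
  obtain ⟨j, n, rfl⟩ := idx_eq (m := m) k
  rw [hw', Xu_add_mul, Xu_add_mul, Xu_succ, lmon_mul]
  simp only [lmon, zero_add, mul_one]
  rw [subst_single]
  rw [Finset.prod_eq_single j (fun i _ hi => by simp [hi]) (by simp)]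
  simp only [Pi.single_eq_same, zpow_one, Units.val_mul]
  rw [← mul_one (((q ^ (-n) : Kˣ) : K)), ← smul_eq_mul, ← AddMonoidAlgebra.smul_single,
    smul_mul_assoc, ← AddMonoidAlgebra.one_def, one_mul, smul_eq_mul, mul_one]

end LaurentRing

section LevelOne

/-- The quotient `a / b` in an integral domain, for `b ≠ 0` dividing `a` (and `0` otherwise). -/
def exactDiv {R : Type*} [CommRing R] (a b : R) : R :=
  open Classical in if h : b ≠ 0 ∧ b ∣ a then h.2.choose else 0

theorem exactDiv_spec {R : Type*} [CommRing R] {a b : R} (hb : b ≠ 0) (h : b ∣ a) :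
    b * exactDiv a b = a := by
  rw [exactDiv, dif_pos ⟨hb, h⟩]
  exact (Exists.choose_spec (⟨hb, h⟩ : b ≠ 0 ∧ b ∣ a).2).symm

/-- The affine simple transposition: it exchanges `k` and `k + 1` for all `k ≡ i` modulo `m`. -/
def swapIdx (m : ℕ) (i : ZMod m) (k : ℤ) : ℤ :=
  if (k : ZMod m) = i then k + 1 else if (k : ZMod m) = i + 1 then k - 1 else k

/-- The substitution that exchanges `X_i` and `X_{i+1}`; for `i = 0` it replaces `X_1` by
`X_0 = q X_m` and `X_m` by `X_{m+1} = q⁻¹ X_1`. -/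
def permX {K : Type*} [Field K] (q : Kˣ) {m : ℕ} [NeZero m] (i : ZMod m) :
    Laurent K m →ₐ[K] Laurent K m :=
  subst fun j : Fin m => Xu q m (swapIdx m i ((j : ℤ) + 1))

/-- The level one action of `s_i`. For `m = 1` there is no reflection, and `s_0` is the identity
(so that `T_0` acts by `t`); this case does not enter the products below. -/
def sOp {K : Type*} [Field K] (q : Kˣ) {m : ℕ} [NeZero m] (i : ZMod m) :
    Laurent K m →ₗ[K] Laurent K m :=
  if m = 1 then LinearMap.id
  else if i = 0 then
    LinearMap.mulLeft K ((Xu q m 1 * (Xu q m 0)⁻¹ : (Laurent K m)ˣ) : Laurent K m) ∘ₗ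
      (permX q i).toLinearMap
  else (permX q i).toLinearMap

/-- `X_i X_{i+1}⁻¹` for `i ∈ ℤ/mℤ`. -/
def ratio {K : Type*} [Field K] (q : Kˣ) {m : ℕ} [NeZero m] (i : ZMod m) : (Laurent K m)ˣ :=
  Xu q m (i.val : ℤ) * (Xu q m ((i.val : ℤ) + 1))⁻¹

/-- `T_i • F = t s_i(F) + (t - 1) (F - s_i(F)) / (1 - X_i X_{i+1}⁻¹)`. -/
def tFun {K : Type*} [Field K] (q t : Kˣ) {m : ℕ} [NeZero m] (i : ZMod m) (F : Laurent K m) :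
    Laurent K m :=
  (t : K) • sOp q i F +
    ((t : K) - 1) • exactDiv (F - sOp q i F) (1 - ((ratio q i : (Laurent K m)ˣ) : Laurent K m))

theorem swapIdx_shift {m : ℕ} (i : ZMod m) (k : ℤ) : swapIdx m i (k + m) = swapIdx m i k + m := by
  unfold swapIdx
  simp only [Int.cast_add, Int.cast_natCast, CharP.cast_eq_zero, add_zero]
  split_ifs <;> ring

theorem zmod_ne' {m : ℕ} (hm : 2 < m) (i : ZMod m) : i ≠ i + 1 + 1 := by
  intro h
  have h2 : ((2 : ℕ) : ZMod m) = 0 := by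
    have : i + (1 + 1) = i + 0 := by rw [← add_assoc, ← h, add_zero]
    have := add_left_cancel this
    rw [← this]; norm_num
  rw [ZMod.natCast_eq_zero_iff] at h2
  exact absurd (Nat.le_of_dvd (by norm_num) h2) (by omega)

theorem far_symm {m : ℕ} {i j : ZMod m} (h0 : j ≠ i) (h1 : j ≠ i + 1) (h2 : j ≠ i - 1) :
    i ≠ j ∧ i ≠ j + 1 ∧ i ≠ j - 1 :=
  ⟨h0.symm, fun h => h2 (by rw [h]; ring), fun h => h1 (by rw [h]; ring)⟩

/-- Equations in `Laurent K m` are equations in its field of fractions. -/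
theorem toFrac_spec {K : Type*} [Field K] {m : ℕ} {a b c d e A f g : Laurent K m} (h : a * A = d * f + e * g)
    (ha : a = 1 - b) (hd : d = c - 1) (he : e = 1 - c * b) :
    (1 - algebraMap (Laurent K m) (FractionRing (Laurent K m)) b) *
        algebraMap (Laurent K m) (FractionRing (Laurent K m)) A =
      (algebraMap (Laurent K m) (FractionRing (Laurent K m)) c - 1) *
          algebraMap (Laurent K m) (FractionRing (Laurent K m)) f +
        (1 - algebraMap (Laurent K m) (FractionRing (Laurent K m)) c *
          algebraMap (Laurent K m) (FractionRing (Laurent K m)) b) *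
          algebraMap (Laurent K m) (FractionRing (Laurent K m)) g := by
  subst ha hd he
  have := congrArg (algebraMap (Laurent K m) (FractionRing (Laurent K m))) h
  simpa only [map_add, map_sub, map_mul, map_one] using this

theorem frac_inj {K : Type*} [Field K] {m : ℕ} {x y : Laurent K m}
    (h : algebraMap (Laurent K m) (FractionRing (Laurent K m)) x =
      algebraMap (Laurent K m) (FractionRing (Laurent K m)) y) : x = y :=
  IsFractionRing.injective (Laurent K m) (FractionRing (Laurent K m)) h

theorem frac_ne {K : Type*} [Field K] {m : ℕ} {x : Laurent K m} (h : 1 - x ≠ 0) :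
    1 - algebraMap (Laurent K m) (FractionRing (Laurent K m)) x ≠ 0 := by
  intro h0
  apply h
  apply frac_inj
  rw [map_sub, map_one, map_zero, h0]

variable {K : Type*} [Field K] (q t : Kˣ) {m : ℕ} [NeZero m]

theorem permX_Xu (i : ZMod m) (k : ℤ) :
    permX q i (Xu q m k : Laurent K m) = (Xu q m (swapIdx m i k) : Laurent K m) :=
  subst_Xu q _ (swapIdx_shift i) k

/-- `permX` on units. -/
theorem permX_map (i : ZMod m) (k : ℤ) :
    Units.map (permX q i : Laurent K m →* Laurent K m) (Xu q m k) = Xu q m (swapIdx m i k) :=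
  Units.ext (permX_Xu q i k)

theorem Xu_ratio_congr {k l : ℤ} (h : (k : ZMod m) = (l : ZMod m)) (d : ℤ) :
    Xu q m k * (Xu q m (k + d))⁻¹ = Xu q m l * (Xu q m (l + d))⁻¹ := by
  rw [ZMod.intCast_eq_intCast_iff_dvd_sub] at h
  obtain ⟨n, hn⟩ := h
  obtain rfl : l = k + n * m := by linarith [mul_comm (m : ℤ) n]
  rw [show k + n * m + d = (k + d) + n * m by ring, Xu_add_mul, Xu_add_mul, mul_inv]
  rw [mul_mul_mul_comm, mul_inv_cancel, one_mul]

theorem ratio_eq {i : ZMod m} {k : ℤ} (h : (k : ZMod m) = i) :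
    ratio q i = Xu q m k * (Xu q m (k + 1))⁻¹ := by
  rw [ratio]
  exact Xu_ratio_congr q (by rw [h]; simp) 1

theorem Xu_ne (k l : ℤ) (h : (k : ZMod m) ≠ (l : ZMod m)) :
    (1 : Laurent K m) - ((Xu q m k * (Xu q m l)⁻¹ : (Laurent K m)ˣ) : Laurent K m) ≠ 0 := by
  intro h0
  have h1 : Xu q m k = Xu q m l := by
    rw [sub_eq_zero] at h0
    have : (1 : (Laurent K m)ˣ) = Xu q m k * (Xu q m l)⁻¹ := Units.ext h0
    exact (mul_inv_eq_one.1 this.symm)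
  have h2 := lmon_inj h1
  have h3 : varIdx m k = varIdx m l := by
    by_contra hne
    have := congrFun h2 (varIdx m k)
    simp [hne] at this
  apply h
  have hm : (m : ℤ) ≠ 0 := by exact_mod_cast NeZero.ne m
  have h4 := congrArg (fun x : Fin m => ((x : ℕ) : ℤ)) h3
  simp only [varIdx] at h4
  rw [Int.toNat_of_nonneg (Int.emod_nonneg _ hm), Int.toNat_of_nonneg (Int.emod_nonneg _ hm)] at h4
  rw [ZMod.intCast_eq_intCast_iff]
  have h5 : k - 1 ≡ l - 1 [ZMOD m] := h4
  simpa using h5.add_right 1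

theorem zmod_ne (hm : m ≠ 1) (i : ZMod m) : i ≠ i + 1 := by
  have : Fact (1 < m) := ⟨by have := NeZero.ne m; omega⟩
  simp

theorem exists_rep (i : ZMod m) : ∃ k : ℤ, (k : ZMod m) = i := ⟨i.val, by simp⟩

theorem ratio_ne (hm : m ≠ 1) (i : ZMod m) :
    (1 : Laurent K m) - ((ratio q i : (Laurent K m)ˣ) : Laurent K m) ≠ 0 := by
  obtain ⟨k, hk⟩ := exists_rep i
  rw [ratio_eq q hk]
  apply Xu_ne
  push_cast; rw [hk]; exact zmod_ne hm i

/-- The factor by which the level one action of `s_i` differs from the substitution `permX`. -/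
def twist {K : Type*} [Field K] (q : Kˣ) {m : ℕ} [NeZero m] (i : ZMod m) :
    (Laurent K m)ˣ := if i = 0 then (ratio q i)⁻¹ else 1

theorem sOp_apply (hm : m ≠ 1) (i : ZMod m) (F : Laurent K m) :
    sOp q i F = (twist q i : Laurent K m) * permX q i F := by
  unfold sOp twist
  rw [if_neg hm]
  split_ifs with h
  · rw [ratio_eq q (k := 0) (by simp [h])]
    simp [mul_assoc]
  · simp

theorem permX_ratio_self (hm : m ≠ 1) (i : ZMod m) :
    permX q i (ratio q i : Laurent K m) = (((ratio q i)⁻¹ : (Laurent K m)ˣ) : Laurent K m) := by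
  obtain ⟨k, hk⟩ := exists_rep i
  have : Units.map (permX q i : Laurent K m →* Laurent K m) (ratio q i) = (ratio q i)⁻¹ := by
    rw [ratio_eq q hk, map_mul, map_inv, permX_map, permX_map]
    have h1 : swapIdx m i k = k + 1 := by simp [swapIdx, hk]
    have h2 : swapIdx m i (k + 1) = k := by
      simp [swapIdx, hk, (zmod_ne hm i).symm]
    rw [h1, h2, mul_inv, inv_inv, mul_comm]
  exact congrArg Units.val this

theorem permX_invol (hm : m ≠ 1) (i : ZMod m) (F : Laurent K m) : permX q i (permX q i F) = F := by
  have : (permX q i).comp (permX q i) = AlgHom.id K (Laurent K m) := by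
    apply algHom_ext' q
    intro k
    simp only [AlgHom.comp_apply, permX_Xu, AlgHom.id_apply]
    congr 2
    have h1 := zmod_ne hm i
    unfold swapIdx
    split_ifs <;> simp_all
  exact congrArg (fun f => f F) this

theorem dvd_sub_permX (i : ZMod m) (F : Laurent K m) :
    (1 : Laurent K m) - ((ratio q i : (Laurent K m)ˣ) : Laurent K m) ∣ F - permX q i F := by
  set I : Ideal (Laurent K m) :=
    Ideal.span {(1 : Laurent K m) - ((ratio q i : (Laurent K m)ˣ) : Laurent K m)} with hI
  have key : (Ideal.Quotient.mkₐ K I).comp (permX q i) = Ideal.Quotient.mkₐ K I := by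
    apply algHom_ext' q
    intro k
    have hr : ∀ l : ℤ, (l : ZMod m) = i →
        (Ideal.Quotient.mk I (Xu q m l : Laurent K m)) = Ideal.Quotient.mk I (Xu q m (l + 1)) := by
      intro l hl
      rw [Ideal.Quotient.eq, hI, Ideal.mem_span_singleton, ratio_eq q hl]
      refine ⟨-(Xu q m (l + 1) : Laurent K m), ?_⟩
      have : (Xu q m l : Laurent K m) =
        ((Xu q m l * (Xu q m (l + 1))⁻¹ : (Laurent K m)ˣ) : Laurent K m) * Xu q m (l + 1) := by
        rw [← Units.val_mul, inv_mul_cancel_right]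
      linear_combination this
    simp only [AlgHom.comp_apply, permX_Xu, Ideal.Quotient.mkₐ_eq_mk]
    unfold swapIdx
    split_ifs with h1 h2
    · exact (hr k h1).symm
    · have := hr (k - 1) (by push_cast; rw [h2]; ring)
      simpa using this
    · rfl
  have h := congrArg (fun f => f F) key
  simp only [AlgHom.comp_apply, Ideal.Quotient.mkₐ_eq_mk] at h
  rw [← Ideal.mem_span_singleton, ← hI, ← Ideal.Quotient.eq]
  exact h.symm

theorem dvd_sub_sOp (hm : m ≠ 1) (i : ZMod m) (F : Laurent K m) :
    (1 : Laurent K m) - ((ratio q i : (Laurent K m)ˣ) : Laurent K m) ∣ F - sOp q i F := by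
  rw [sOp_apply q hm]
  unfold twist
  split_ifs with h
  · have h1 := dvd_sub_permX q i F
    have h2 : (1 : Laurent K m) - ((ratio q i : (Laurent K m)ˣ) : Laurent K m) ∣
        (1 - (((ratio q i)⁻¹ : (Laurent K m)ˣ) : Laurent K m)) * permX q i F := by
      refine ⟨-(((ratio q i)⁻¹ : (Laurent K m)ˣ) : Laurent K m) * permX q i F, ?_⟩
      have : (ratio q i : Laurent K m) * (((ratio q i)⁻¹ : (Laurent K m)ˣ) : Laurent K m) = 1 :=
        Units.mul_inv _
      linear_combination (- permX q i F) * this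
    have := dvd_add h1 h2
    convert this using 1; ring
  · simpa using dvd_sub_permX q i F

/-- The defining equation of `T_i`, cleared of denominators. -/
theorem tFun_spec (hm : m ≠ 1) (i : ZMod m) (F : Laurent K m) :
    (1 - (ratio q i : Laurent K m)) * tFun q t i F =
      ((t : K) - 1) • F + (1 - (t : K) • (ratio q i : Laurent K m)) * sOp q i F := by
  have h := exactDiv_spec (ratio_ne q hm i) (dvd_sub_sOp q hm i F)
  unfold tFun
  rw [mul_add, mul_smul_comm, mul_smul_comm, h]
  simp only [Algebra.smul_def, map_sub, map_one]
  ring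

theorem tFun_one (hm : m = 1) (i : ZMod m) (F : Laurent K m) : tFun q t i F = (t : K) • F := by
  have : sOp q i F = F := by simp [sOp, hm]
  unfold tFun
  rw [this]
  simp only [sub_self, add_eq_left]
  unfold exactDiv
  split_ifs with h
  · have h2 := Exists.choose_spec h.2
    rcases mul_eq_zero.1 h2.symm with h3 | h3
    · exact absurd h3 h.1
    · rw [h3, smul_zero]
  · simp

/-- The level one action of `T_i` as a linear operator. -/
def tOp {K : Type*} [Field K] (q t : Kˣ) {m : ℕ} [NeZero m] (i : ZMod m) :
    Laurent K m →ₗ[K] Laurent K m where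
  toFun := tFun q t i
  map_add' F G := by
    by_cases hm : m = 1
    · simp [tFun_one q t hm]
    · apply mul_left_cancel₀ (ratio_ne q hm i)
      rw [mul_add]
      simp only [tFun_spec q t hm, map_add, smul_add]
      ring
  map_smul' c F := by
    by_cases hm : m = 1
    · rw [tFun_one q t hm, tFun_one q t hm, smul_comm]; rfl
    · apply mul_left_cancel₀ (ratio_ne q hm i)
      rw [RingHom.id_apply, mul_smul_comm]
      rw [tFun_spec q t hm, tFun_spec q t hm, map_smul, smul_add, mul_smul_comm, smul_comm]

/-- The substitution `X_j ↦ X_{j+d}` for all `j`. -/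
def shiftX {K : Type*} [Field K] (q : Kˣ) {m : ℕ} [NeZero m] (d : ℤ) :
    Laurent K m →ₐ[K] Laurent K m :=
  subst fun j : Fin m => Xu q m ((j : ℤ) + 1 + d)

/-- `Π • F = X_1 F(X_2, …, X_{m+1})`. -/
def piOp {K : Type*} [Field K] (q : Kˣ) {m : ℕ} [NeZero m] :
    Laurent K m →ₗ[K] Laurent K m :=
  LinearMap.mulLeft K (Xu q m 1 : Laurent K m) ∘ₗ (shiftX q 1).toLinearMap

/-- `Π⁻¹ • F = X_0⁻¹ F(X_0, …, X_{m-1})`. -/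
def piInvOp {K : Type*} [Field K] (q : Kˣ) {m : ℕ} [NeZero m] :
    Laurent K m →ₗ[K] Laurent K m :=
  LinearMap.mulLeft K (((Xu q m 0)⁻¹ : (Laurent K m)ˣ) : Laurent K m) ∘ₗ
    (shiftX q (-1)).toLinearMap

theorem shiftX_Xu (d k : ℤ) :
    shiftX q d (Xu q m k : Laurent K m) = (Xu q m (k + d) : Laurent K m) :=
  subst_Xu q (fun k => k + d) (fun k => by ring) k

theorem shiftX_map (d k : ℤ) :
    Units.map ((shiftX q d : Laurent K m →ₐ[K] Laurent K m) : Laurent K m →* Laurent K m) (Xu q m k) = Xu q m (k + d) :=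
  Units.ext (shiftX_Xu q d k)

theorem shiftX_shiftX (d e : ℤ) (h : d + e = 0) (F : Laurent K m) :
    shiftX q d (shiftX q e F) = F := by
  have : (shiftX q d).comp (shiftX q e) = AlgHom.id K (Laurent K m) := by
    apply algHom_ext' q
    intro k
    simp only [AlgHom.comp_apply, shiftX_Xu, AlgHom.id_apply]
    congr 2; linarith
  exact congrArg (fun f => f F) this

theorem piOp_piInvOp (F : Laurent K m) : piOp q (piInvOp q F) = F := by
  have h : shiftX q 1 (((Xu q m 0)⁻¹ : (Laurent K m)ˣ) : Laurent K m) =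
      (((Xu q m 1)⁻¹ : (Laurent K m)ˣ) : Laurent K m) := by
    have := shiftX_map q (m := m) 1 0
    rw [← inv_inj, ← map_inv] at this
    exact congrArg Units.val this
  simp only [piOp, piInvOp, LinearMap.comp_apply, LinearMap.mulLeft_apply, AlgHom.toLinearMap_apply,
    map_mul, h, shiftX_shiftX q 1 (-1) (by norm_num), Units.mul_inv_cancel_left]

theorem piInvOp_piOp (F : Laurent K m) : piInvOp q (piOp q F) = F := by
  simp only [piOp, piInvOp, LinearMap.comp_apply, LinearMap.mulLeft_apply, AlgHom.toLinearMap_apply,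
    map_mul, shiftX_Xu, shiftX_shiftX q (-1) 1 (by norm_num)]
  norm_num

theorem permX_unit (i : ZMod m) {x y : (Laurent K m)ˣ}
    (h : permX q i (x : Laurent K m) = (y : Laurent K m)) :
    permX q i ((x⁻¹ : (Laurent K m)ˣ) : Laurent K m) = ((y⁻¹ : (Laurent K m)ˣ) : Laurent K m) := by
  have h1 : Units.map (permX q i : Laurent K m →* Laurent K m) x = y := Units.ext h
  rw [← inv_inj, ← map_inv] at h1
  exact congrArg Units.val h1

theorem permX_Xratio (i : ZMod m) (k l : ℤ) :
    permX q i ((Xu q m k * (Xu q m l)⁻¹ : (Laurent K m)ˣ) : Laurent K m) =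
      ((Xu q m (swapIdx m i k) * (Xu q m (swapIdx m i l))⁻¹ : (Laurent K m)ˣ) : Laurent K m) := by
  rw [Units.val_mul, map_mul, permX_Xu, permX_unit q i (permX_Xu q i l), Units.val_mul]

theorem ratio_mul_succ (i : ZMod m) {k : ℤ} (hk : (k : ZMod m) = i) :
    (ratio q i * ratio q (i + 1) : (Laurent K m)ˣ) = Xu q m k * (Xu q m (k + 2))⁻¹ := by
  rw [ratio_eq q hk, ratio_eq q (i := i + 1) (k := k + 1) (by push_cast; rw [hk]),
    show k + 1 + 1 = k + 2 by ring, ← mul_assoc, inv_mul_cancel_right]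

theorem permX_ratio_succ (hm : 2 < m) (i : ZMod m) :
    permX q i (ratio q (i + 1) : Laurent K m) =
      ((ratio q i * ratio q (i + 1) : (Laurent K m)ˣ) : Laurent K m) := by
  obtain ⟨k, hk⟩ := exists_rep i
  have h1 := zmod_ne (m := m) (by omega)
  rw [ratio_mul_succ q i hk, ratio_eq q (i := i + 1) (k := k + 1) (by push_cast; rw [hk]),
    permX_Xratio]
  have e1 : swapIdx m i (k + 1) = k := by
    simp [swapIdx, hk, (h1 i).symm]
  have e2 : swapIdx m i (k + 1 + 1) = k + 2 := by
    simp [swapIdx, hk, (zmod_ne' hm i).symm, (h1 (i + 1)).symm]; ring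
  rw [e1, e2]

theorem permX_succ_ratio (hm : 2 < m) (i : ZMod m) :
    permX q (i + 1) (ratio q i : Laurent K m) =
      ((ratio q i * ratio q (i + 1) : (Laurent K m)ˣ) : Laurent K m) := by
  obtain ⟨k, hk⟩ := exists_rep i
  have h1 := zmod_ne (m := m) (by omega)
  rw [ratio_mul_succ q i hk, ratio_eq q (i := i) (k := k) hk, permX_Xratio]
  have e1 : swapIdx m (i + 1) k = k := by
    simp [swapIdx, hk, h1 i, zmod_ne' hm i]
  have e2 : swapIdx m (i + 1) (k + 1) = k + 2 := by
    simp [swapIdx, hk]; ring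
  rw [e1, e2]

theorem permX_ratio_far {i j : ZMod m} (h0 : j ≠ i) (h1 : j ≠ i + 1) (h2 : j ≠ i - 1) :
    permX q i (ratio q j : Laurent K m) = (ratio q j : Laurent K m) := by
  obtain ⟨k, hk⟩ := exists_rep j
  rw [ratio_eq q hk, permX_Xratio]
  have e1 : swapIdx m i k = k := by simp [swapIdx, hk, h0, h1]
  have e2 : swapIdx m i (k + 1) = k + 1 := by
    have : j + 1 ≠ i := fun h => h2 (eq_sub_of_add_eq h)
    simp [swapIdx, hk, h0, this]
  rw [e1, e2]

theorem permX_braid (hm : 2 < m) (i : ZMod m) (F : Laurent K m) :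
    permX q i (permX q (i + 1) (permX q i F)) =
      permX q (i + 1) (permX q i (permX q (i + 1) F)) := by
  have : ((permX q i).comp ((permX q (i + 1)).comp (permX q i)) : Laurent K m →ₐ[K] _) =
      (permX q (i + 1)).comp ((permX q i).comp (permX q (i + 1))) := by
    apply algHom_ext' q
    intro k
    simp only [AlgHom.comp_apply, permX_Xu]
    congr 2
    have h1 := zmod_ne (m := m) (by omega)
    have h2 := zmod_ne' hm
    have h10 : (1 : ZMod m) ≠ 0 := by simpa using (h1 0).symm
    by_cases c0 : (k : ZMod m) = i
    · simp [swapIdx, c0, h10, h2, (h2 _).symm]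
    · by_cases c1 : (k : ZMod m) = i + 1
      · simp [swapIdx, c1, h10, h2, (h2 _).symm]
      · by_cases c2 : (k : ZMod m) = i + 1 + 1
        · simp [swapIdx, c2, h10, h2, (h2 _).symm]
        · simp [swapIdx, c0, c1, c2]
  exact congrArg (fun f => f F) this

theorem permX_comm {i j : ZMod m} (h0 : j ≠ i) (h1 : j ≠ i + 1) (h2 : j ≠ i - 1) (F : Laurent K m) :
    permX q i (permX q j F) = permX q j (permX q i F) := by
  have : ((permX q i).comp (permX q j) : Laurent K m →ₐ[K] _) =
      (permX q j).comp (permX q i) := by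
    apply algHom_ext' q
    intro k
    simp only [AlgHom.comp_apply, permX_Xu]
    congr 2
    have h3 : i ≠ j + 1 := fun h => h2 (by rw [h]; ring)
    have h10 : (1 : ZMod m) ≠ 0 := fun h => h0 (by rw [← mul_one j, ← mul_one i, h]; simp)
    have h4 : j + 1 ≠ i + 1 := fun h => h0 (add_right_cancel h)
    by_cases c0 : (k : ZMod m) = i
    · simp [swapIdx, c0, h0.symm, h1.symm, h3, h4.symm]
    · by_cases c1 : (k : ZMod m) = i + 1
      · simp [swapIdx, c1, h0.symm, h1.symm, h10, h3]
      · by_cases c2 : (k : ZMod m) = j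
        · simp [swapIdx, c2, h0, h1, h3.symm, h4]
        · by_cases c3 : (k : ZMod m) = j + 1
          · simp [swapIdx, c3, h0, h1, h3.symm, h4, h10]
          · simp [swapIdx, c0, c1, c2, c3]
  exact congrArg (fun f => f F) this

theorem twist_permX (hm : m ≠ 1) (i : ZMod m) :
    (twist q i : Laurent K m) * permX q i (twist q i : Laurent K m) = 1 := by
  unfold twist
  split_ifs with h
  · rw [permX_unit q i (permX_ratio_self q hm i), inv_inv, Units.inv_mul]
  · simp

theorem sOp_invol (hm : m ≠ 1) (i : ZMod m) (F : Laurent K m) : sOp q i (sOp q i F) = F := by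
  rw [sOp_apply q hm, sOp_apply q hm, map_mul, permX_invol q hm, ← mul_assoc, twist_permX q hm,
    one_mul]

theorem sOp_mul (hm : m ≠ 1) (i : ZMod m) (a F : Laurent K m) :
    sOp q i (a * F) = permX q i a * sOp q i F := by
  rw [sOp_apply q hm, sOp_apply q hm, map_mul]; ring

theorem twist_braid (hm : 2 < m) (i : ZMod m) :
    (twist q i : Laurent K m) * (permX q i (twist q (i + 1) : Laurent K m) *
        permX q i (permX q (i + 1) (twist q i : Laurent K m))) =
      (twist q (i + 1) : Laurent K m) * (permX q (i + 1) (twist q i : Laurent K m) *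
        permX q (i + 1) (permX q i (twist q (i + 1) : Laurent K m))) := by
  have hm1 : m ≠ 1 := by omega
  have h10 : (1 : ZMod m) ≠ 0 := by simpa using (zmod_ne hm1 (0 : ZMod m)).symm
  have e1 : permX q i ((ratio q i * ratio q (i + 1) : (Laurent K m)ˣ) : Laurent K m) =
      (ratio q (i + 1) : Laurent K m) := by
    rw [Units.val_mul, map_mul, permX_ratio_self q hm1, permX_ratio_succ q hm, Units.val_mul,
      Units.inv_mul_cancel_left]
  have e2 : permX q (i + 1) ((ratio q i * ratio q (i + 1) : (Laurent K m)ˣ) : Laurent K m) =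
      (ratio q i : Laurent K m) := by
    rw [Units.val_mul, map_mul, permX_ratio_self q hm1, permX_succ_ratio q hm, Units.val_mul,
      Units.mul_inv_cancel_right]
  unfold twist
  by_cases h : i = 0
  · have h' : i + 1 ≠ 0 := by rw [h, zero_add]; exact h10
    rw [if_pos h, if_neg h', permX_unit q (i + 1) (permX_succ_ratio q hm i), permX_unit q i e1]
    simp [mul_comm]
  · by_cases h' : i + 1 = 0
    · rw [if_pos h', if_neg h, permX_unit q i (permX_ratio_succ q hm i), permX_unit q (i + 1) e2]
      simp [mul_comm]
    · rw [if_neg h, if_neg h']; simp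

theorem sOp_braid (hm : 2 < m) (i : ZMod m) (F : Laurent K m) :
    sOp q i (sOp q (i + 1) (sOp q i F)) = sOp q (i + 1) (sOp q i (sOp q (i + 1) F)) := by
  have hm1 : m ≠ 1 := by omega
  simp only [sOp_apply q hm1, map_mul, permX_braid q hm]
  have := twist_braid q hm i
  linear_combination (permX q (i + 1) (permX q i (permX q (i + 1) F))) * this

theorem permX_twist_far {i j : ZMod m} (h0 : j ≠ i) (h1 : j ≠ i + 1) (h2 : j ≠ i - 1) :
    permX q i (twist q j : Laurent K m) = (twist q j : Laurent K m) := by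
  unfold twist
  split_ifs
  · exact permX_unit q i (permX_ratio_far q h0 h1 h2)
  · simp

theorem far_ne_one {i j : ZMod m} (h0 : j ≠ i) : m ≠ 1 := by
  rintro rfl; exact h0 (Subsingleton.elim _ _)

theorem sOp_comm {i j : ZMod m} (h0 : j ≠ i) (h1 : j ≠ i + 1) (h2 : j ≠ i - 1) (F : Laurent K m) :
    sOp q i (sOp q j F) = sOp q j (sOp q i F) := by
  obtain ⟨g0, g1, g2⟩ := far_symm h0 h1 h2
  have hm1 := far_ne_one h0
  simp only [sOp_apply q hm1, map_mul, permX_comm q h0 h1 h2, permX_twist_far q h0 h1 h2,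
    permX_twist_far q g0 g1 g2]
  ring

theorem tOp_spec (hm : m ≠ 1) (i : ZMod m) (F : Laurent K m) :
    (1 - (ratio q i : Laurent K m)) * tOp q t i F =
      (algebraMap K (Laurent K m) t - 1) * F +
        (1 - algebraMap K (Laurent K m) t * (ratio q i : Laurent K m)) * sOp q i F := by
  have := tFun_spec q t hm i F
  change (1 - (ratio q i : Laurent K m)) * tFun q t i F = _
  simpa only [Algebra.smul_def, map_sub, map_one] using this

/-- Applying a reflection to an equation of the kind that defines `T_i`. -/
theorem sOp_spec (hm : m ≠ 1) (i : ZMod m) {u A f g : Laurent K m}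
    (h : (1 - u) * A = (algebraMap K (Laurent K m) t - 1) * f +
      (1 - algebraMap K (Laurent K m) t * u) * g) :
    (1 - permX q i u) * sOp q i A = (algebraMap K (Laurent K m) t - 1) * sOp q i f +
      (1 - algebraMap K (Laurent K m) t * permX q i u) * sOp q i g := by
  have := congrArg (sOp q i) h
  simpa only [sOp_mul q hm, map_add, map_sub, map_one, map_mul, AlgHom.commutes] using this

theorem field_quad {E : Type*} [Field E] {t u v f g A B C : E} (hu : 1 - u ≠ 0) (huv : u * v = 1)
    (h1 : (1 - u) * A = (t - 1) * f + (1 - t * u) * g)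
    (h2 : (1 - v) * B = (t - 1) * g + (1 - t * v) * f)
    (h3 : (1 - u) * C = (t - 1) * A + (1 - t * u) * B) : C = (t - 1) * A + t * f := by
  have hu0 : u ≠ 0 := left_ne_zero_of_mul_eq_one huv
  obtain rfl : v = u⁻¹ := eq_inv_of_mul_eq_one_right huv
  have hu' : u - 1 ≠ 0 := by intro h; apply hu; linear_combination -h
  have hB : (u - 1) * B = (t - 1) * u * g + (u - t) * f := by
    field_simp at h2; linear_combination h2
  apply mul_left_cancel₀ hu
  apply mul_left_cancel₀ hu
  linear_combination (1 - u) * h3 + (-1 : E) * (1 - t * u) * hB + ((t-1) * u) * h1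

theorem field_braid {E : Type*} [Field E]
    {t u v f f1 f2 f12 f21 f121 A sA rA srA B sB C A' rA' sA' rsA' B' rB' C' : E}
    (hu : 1 - u ≠ 0) (hv : 1 - v ≠ 0) (huv : 1 - u * v ≠ 0) (hu0 : u ≠ 0) (hv0 : v ≠ 0)
    (h1 : (1 - u) * A = (t - 1) * f + (1 - t * u) * f1)
    (h2 : (1 - u⁻¹) * sA = (t - 1) * f1 + (1 - t * u⁻¹) * f)
    (h3 : (1 - u * v) * rA = (t - 1) * f2 + (1 - t * (u * v)) * f21)
    (h4 : (1 - v) * srA = (t - 1) * f12 + (1 - t * v) * f121)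
    (h5 : (1 - v) * B = (t - 1) * A + (1 - t * v) * rA)
    (h6 : (1 - u * v) * sB = (t - 1) * sA + (1 - t * (u * v)) * srA)
    (h7 : (1 - u) * C = (t - 1) * B + (1 - t * u) * sB)
    (k1 : (1 - v) * A' = (t - 1) * f + (1 - t * v) * f2)
    (k2 : (1 - v⁻¹) * rA' = (t - 1) * f2 + (1 - t * v⁻¹) * f)
    (k3 : (1 - u * v) * sA' = (t - 1) * f1 + (1 - t * (u * v)) * f12)
    (k4 : (1 - u) * rsA' = (t - 1) * f21 + (1 - t * u) * f121)
    (k5 : (1 - u) * B' = (t - 1) * A' + (1 - t * u) * sA')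
    (k6 : (1 - u * v) * rB' = (t - 1) * rA' + (1 - t * (u * v)) * rsA')
    (k7 : (1 - v) * C' = (t - 1) * B' + (1 - t * v) * rB') : C = C' := by
  have hu2 : 1 - u⁻¹ ≠ 0 := by
    intro h; apply hu; field_simp at h; linear_combination -h
  have hv2 : 1 - v⁻¹ ≠ 0 := by
    intro h; apply hv; field_simp at h; linear_combination -h
  have hu3 : u - 1 ≠ 0 := by intro h; apply hu; linear_combination -h
  have hv3 : v - 1 ≠ 0 := by intro h; apply hv; linear_combination -h
  rw [mul_comm, ← eq_div_iff hu] at h1 h7 k4 k5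
  rw [mul_comm, ← eq_div_iff hv] at h4 h5 k1 k7
  rw [mul_comm, ← eq_div_iff huv] at h3 h6 k3 k6
  rw [mul_comm, ← eq_div_iff hu2] at h2
  rw [mul_comm, ← eq_div_iff hv2] at k2
  rw [h7, k7, h6, h5, h4, h3, h2, h1, k6, k5, k4, k3, k2, k1]
  have e1 : 1 - u⁻¹ = (u - 1) / u := by field_simp
  have e2 : 1 - v⁻¹ = (v - 1) / v := by field_simp
  rw [e1, e2]
  field_simp
  ring

theorem field_comm {E : Type*} [Field E] {t u v f f1 f2 f12 A sA C A' rA' C' : E}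
    (hu : 1 - u ≠ 0) (hv : 1 - v ≠ 0)
    (h1 : (1 - v) * A = (t - 1) * f + (1 - t * v) * f2)
    (h2 : (1 - v) * sA = (t - 1) * f1 + (1 - t * v) * f12)
    (h3 : (1 - u) * C = (t - 1) * A + (1 - t * u) * sA)
    (k1 : (1 - u) * A' = (t - 1) * f + (1 - t * u) * f1)
    (k2 : (1 - u) * rA' = (t - 1) * f2 + (1 - t * u) * f12)
    (k3 : (1 - v) * C' = (t - 1) * A' + (1 - t * v) * rA') : C = C' := by
  apply mul_left_cancel₀ hu
  apply mul_left_cancel₀ hv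
  linear_combination (1 - v) * h3 - (1 - u) * k3 + (t - 1) * h1 + (1 - t * u) * h2
    - (t - 1) * k1 - (1 - t * v) * k2

theorem tOp_quad (i : ZMod m) (F : Laurent K m) :
    tOp q t i (tOp q t i F) = ((t : K) - 1) • tOp q t i F + (t : K) • F := by
  by_cases hm : m = 1
  · change tFun q t i (tFun q t i F) = ((t : K) - 1) • tFun q t i F + (t : K) • F
    rw [tFun_one q t hm, tFun_one q t hm, ← smul_assoc, ← smul_assoc, ← add_smul]
    congr 1; simp only [smul_eq_mul]; ring
  · have h1 := tOp_spec q t hm i F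
    have h2 := sOp_spec q t hm i h1
    have h3 := tOp_spec q t hm i (tOp q t i F)
    rw [sOp_invol q hm, permX_ratio_self q hm] at h2
    apply frac_inj
    simp only [Algebra.smul_def, map_sub, map_one, map_add, map_mul]
    refine field_quad (frac_ne (ratio_ne q hm i)) ?_ (toFrac_spec h1 rfl rfl rfl)
      (toFrac_spec h2 rfl rfl rfl) (toFrac_spec h3 rfl rfl rfl)
    rw [← map_mul, Units.mul_inv, map_one]

theorem tOp_comm {i j : ZMod m} (h0 : j ≠ i) (h1 : j ≠ i + 1) (h2 : j ≠ i - 1) (F : Laurent K m) :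
    tOp q t i (tOp q t j F) = tOp q t j (tOp q t i F) := by
  obtain ⟨g0, g1, g2⟩ := far_symm h0 h1 h2
  have hm := far_ne_one h0
  have a1 := tOp_spec q t hm j F
  have a2 := sOp_spec q t hm i a1
  have a3 := tOp_spec q t hm i (tOp q t j F)
  have b1 := tOp_spec q t hm i F
  have b2 := sOp_spec q t hm j b1
  have b3 := tOp_spec q t hm j (tOp q t i F)
  rw [permX_ratio_far q h0 h1 h2] at a2
  rw [permX_ratio_far q g0 g1 g2, ← sOp_comm q h0 h1 h2] at b2
  apply frac_inj
  exact field_comm (frac_ne (ratio_ne q hm i)) (frac_ne (ratio_ne q hm j))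
    (toFrac_spec a1 rfl rfl rfl) (toFrac_spec a2 rfl rfl rfl) (toFrac_spec a3 rfl rfl rfl)
    (toFrac_spec b1 rfl rfl rfl) (toFrac_spec b2 rfl rfl rfl) (toFrac_spec b3 rfl rfl rfl)

theorem permX_ratio_mul (hm : 2 < m) (i : ZMod m) :
    permX q i ((ratio q i : Laurent K m) * (ratio q (i + 1) : Laurent K m)) =
      (ratio q (i + 1) : Laurent K m) := by
  rw [map_mul, permX_ratio_self q (by omega), permX_ratio_succ q hm, Units.val_mul,
    Units.inv_mul_cancel_left]

theorem permX_succ_ratio_mul (hm : 2 < m) (i : ZMod m) :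
    permX q (i + 1) ((ratio q i : Laurent K m) * (ratio q (i + 1) : Laurent K m)) =
      (ratio q i : Laurent K m) := by
  rw [map_mul, permX_ratio_self q (by omega), permX_succ_ratio q hm, Units.val_mul,
    Units.mul_inv_cancel_right]

theorem tOp_braid (hm2 : 2 < m) (i : ZMod m) (F : Laurent K m) :
    tOp q t i (tOp q t (i + 1) (tOp q t i F)) =
      tOp q t (i + 1) (tOp q t i (tOp q t (i + 1) F)) := by
  have hm : m ≠ 1 := by omega
  have h1 := tOp_spec q t hm i F
  have h2 := sOp_spec q t hm i h1
  have h3 := sOp_spec q t hm (i + 1) h1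
  have h4 := sOp_spec q t hm i h3
  have h5 := tOp_spec q t hm (i + 1) (tOp q t i F)
  have h6 := sOp_spec q t hm i h5
  have h7 := tOp_spec q t hm i (tOp q t (i + 1) (tOp q t i F))
  have k1 := tOp_spec q t hm (i + 1) F
  have k2 := sOp_spec q t hm (i + 1) k1
  have k3 := sOp_spec q t hm i k1
  have k4 := sOp_spec q t hm (i + 1) k3
  have k5 := tOp_spec q t hm i (tOp q t (i + 1) F)
  have k6 := sOp_spec q t hm (i + 1) k5
  have k7 := tOp_spec q t hm (i + 1) (tOp q t i (tOp q t (i + 1) F))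
  rw [sOp_invol q hm, permX_ratio_self q hm] at h2 k2
  rw [permX_succ_ratio q hm2, Units.val_mul, permX_ratio_mul q hm2] at h4
  rw [permX_ratio_succ q hm2, Units.val_mul, permX_succ_ratio_mul q hm2, ← sOp_braid q hm2] at k4
  rw [permX_succ_ratio q hm2, Units.val_mul] at h3 k6
  rw [permX_ratio_succ q hm2, Units.val_mul] at h6 k3
  have hu := frac_ne (ratio_ne q hm i)
  have hv := frac_ne (ratio_ne q hm (i + 1))
  have huv : (1 : FractionRing (Laurent K m)) -
      algebraMap (Laurent K m) _ (ratio q i : Laurent K m) *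
        algebraMap (Laurent K m) _ (ratio q (i + 1) : Laurent K m) ≠ 0 := by
    rw [← map_mul]
    apply frac_ne
    obtain ⟨k, hk⟩ := exists_rep i
    rw [← Units.val_mul, ratio_mul_succ q i hk]
    apply Xu_ne
    push_cast
    rw [hk]
    have := zmod_ne' hm2 i
    rwa [add_assoc, one_add_one_eq_two] at this
  have hinv : ∀ x : (Laurent K m)ˣ,
      algebraMap (Laurent K m) (FractionRing (Laurent K m)) ((x⁻¹ : (Laurent K m)ˣ) : Laurent K m) =
        (algebraMap (Laurent K m) (FractionRing (Laurent K m)) (x : Laurent K m))⁻¹ := by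
    intro x
    apply eq_inv_of_mul_eq_one_left
    rw [← map_mul, Units.inv_mul, map_one]
  have hne : ∀ x : (Laurent K m)ˣ,
      algebraMap (Laurent K m) (FractionRing (Laurent K m)) (x : Laurent K m) ≠ 0 := by
    intro x
    exact (x.isUnit.map (algebraMap (Laurent K m) (FractionRing (Laurent K m)))).ne_zero
  apply frac_inj
  have H2 := toFrac_spec h2 rfl rfl rfl
  have H3 := toFrac_spec h3 rfl rfl rfl
  have H6 := toFrac_spec h6 rfl rfl rfl
  have L2 := toFrac_spec k2 rfl rfl rfl
  have L3 := toFrac_spec k3 rfl rfl rfl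
  have L6 := toFrac_spec k6 rfl rfl rfl
  rw [hinv] at H2 L2
  rw [map_mul] at H3 H6 L3 L6
  exact field_braid hu hv huv (hne _) (hne _) (toFrac_spec h1 rfl rfl rfl) H2 H3
    (toFrac_spec h4 rfl rfl rfl) (toFrac_spec h5 rfl rfl rfl) H6 (toFrac_spec h7 rfl rfl rfl)
    (toFrac_spec k1 rfl rfl rfl) L2 L3 (toFrac_spec k4 rfl rfl rfl)
    (toFrac_spec k5 rfl rfl rfl) L6 (toFrac_spec k7 rfl rfl rfl)

theorem piOp_mul (a F : Laurent K m) : piOp q (a * F) = shiftX q 1 a * piOp q F := by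
  simp only [piOp, LinearMap.comp_apply, LinearMap.mulLeft_apply, AlgHom.toLinearMap_apply, map_mul]
  ring

theorem shiftX_unit (d : ℤ) {x y : (Laurent K m)ˣ}
    (h : shiftX q d (x : Laurent K m) = (y : Laurent K m)) :
    shiftX q d ((x⁻¹ : (Laurent K m)ˣ) : Laurent K m) = ((y⁻¹ : (Laurent K m)ˣ) : Laurent K m) := by
  have h1 : Units.map ((shiftX q d : Laurent K m →ₐ[K] Laurent K m) : Laurent K m →* Laurent K m) x
      = y := Units.ext h
  rw [← inv_inj, ← map_inv] at h1
  exact congrArg Units.val h1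

theorem shiftX_ratio (i : ZMod m) :
    shiftX q 1 (ratio q i : Laurent K m) = (ratio q (i + 1) : Laurent K m) := by
  obtain ⟨k, hk⟩ := exists_rep i
  rw [ratio_eq q hk, ratio_eq q (i := i + 1) (k := k + 1) (by push_cast; rw [hk]), Units.val_mul,
    map_mul, shiftX_Xu, shiftX_unit q 1 (shiftX_Xu q 1 (k + 1)), Units.val_mul]

theorem shiftX_permX (i : ZMod m) (F : Laurent K m) :
    shiftX q 1 (permX q i F) = permX q (i + 1) (shiftX q 1 F) := by
  have : (shiftX q 1).comp (permX q i) = (permX q (i + 1)).comp (shiftX q 1) := by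
    apply algHom_ext' q
    intro k
    simp only [AlgHom.comp_apply, permX_Xu, shiftX_Xu]
    congr 2
    unfold swapIdx
    push_cast
    simp only [add_left_inj]
    split_ifs <;> ring
  exact congrArg (fun f => f F) this

theorem piOp_sOp (hm : m ≠ 1) (i : ZMod m) (F : Laurent K m) :
    piOp q (sOp q i F) = sOp q (i + 1) (piOp q F) := by
  rw [sOp_apply q hm, piOp_mul, sOp_apply q hm]
  simp only [piOp, LinearMap.comp_apply, LinearMap.mulLeft_apply, AlgHom.toLinearMap_apply, map_mul,
    shiftX_permX, permX_Xu]
  have h10 : (1 : ZMod m) ≠ 0 := by simpa using (zmod_ne hm (0 : ZMod m)).symm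
  have key : shiftX q 1 (twist q i : Laurent K m) * (Xu q m 1 : Laurent K m) =
      (twist q (i + 1) : Laurent K m) * (Xu q m (swapIdx m (i + 1) 1) : Laurent K m) := by
    unfold twist
    by_cases h : i = 0
    · subst h
      rw [if_pos rfl, if_neg (by simpa using h10), shiftX_unit q 1 (shiftX_ratio q 0),
        ratio_eq q (i := 0 + 1) (k := 1) (by simp)]
      simp [swapIdx]
    · rw [if_neg h]
      by_cases h' : i + 1 = 0
      · rw [if_pos h', h', ratio_eq q (i := 0) (k := 0) (by simp)]
        simp [swapIdx, h10]
      · rw [if_neg h']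
        have h1 : (1 : ZMod m) ≠ i + 1 := fun hh => h (by
          have := add_right_cancel ((zero_add (1 : ZMod m)).trans hh); exact this.symm)
        have h2 : (1 : ZMod m) ≠ i + 1 + 1 := fun hh => h' (by
          have := add_right_cancel ((zero_add (1 : ZMod m)).trans hh); exact this.symm)
        simp [swapIdx, h1, h2]
  linear_combination (permX q (i + 1) (shiftX q 1 F)) * key

theorem piOp_tOp (i : ZMod m) (F : Laurent K m) :
    piOp q (tOp q t i F) = tOp q t (i + 1) (piOp q F) := by
  by_cases hm : m = 1
  · change piOp q (tFun q t i F) = tFun q t (i + 1) (piOp q F)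
    rw [tFun_one q t hm, tFun_one q t hm, map_smul]
  · have h1 := congrArg (piOp q) (tOp_spec q t hm i F)
    simp only [piOp_mul, map_add, map_sub, map_mul, map_one, shiftX_ratio, AlgHom.commutes,
      piOp_sOp q hm] at h1
    apply mul_left_cancel₀ (ratio_ne q hm (i + 1))
    rw [h1, tOp_spec q t hm]

end LevelOne

section AffineHecke

/-- Generators of the affine Hecke algebra of `GL_m`. -/
inductive HGen (m : ℕ) : Type
  | T (i : ZMod m)
  | P
  | Pinv

/-- Defining relations of the affine Hecke algebra of `GL_m` with parameter `t`. -/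
inductive HRel (K : Type*) [Field K] (t : Kˣ) (m : ℕ) :
    FreeAlgebra K (HGen m) → FreeAlgebra K (HGen m) → Prop
  | quad (i : ZMod m) :
      HRel K t m
        ((FreeAlgebra.ι K (HGen.T i) - algebraMap K _ (t : K)) * (FreeAlgebra.ι K (HGen.T i) + 1)) 0
  | braid (hm : 2 < m) (i : ZMod m) :
      HRel K t m
        (FreeAlgebra.ι K (HGen.T i) * FreeAlgebra.ι K (HGen.T (i + 1)) *
          FreeAlgebra.ι K (HGen.T i))
        (FreeAlgebra.ι K (HGen.T (i + 1)) * FreeAlgebra.ι K (HGen.T i) *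
          FreeAlgebra.ι K (HGen.T (i + 1)))
  | comm (i j : ZMod m) (h1 : j ≠ i + 1) (h2 : j ≠ i - 1) :
      HRel K t m
        (FreeAlgebra.ι K (HGen.T i) * FreeAlgebra.ι K (HGen.T j))
        (FreeAlgebra.ι K (HGen.T j) * FreeAlgebra.ι K (HGen.T i))
  | pi (i : ZMod m) :
      HRel K t m
        (FreeAlgebra.ι K HGen.P * FreeAlgebra.ι K (HGen.T i))
        (FreeAlgebra.ι K (HGen.T (i + 1)) * FreeAlgebra.ι K HGen.P)
  | mul_inv : HRel K t m (FreeAlgebra.ι K HGen.P * FreeAlgebra.ι K HGen.Pinv) 1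
  | inv_mul : HRel K t m (FreeAlgebra.ι K HGen.Pinv * FreeAlgebra.ι K HGen.P) 1

/-- The affine Hecke algebra of `GL_m`. -/
abbrev AffineHecke (K : Type*) [Field K] (t : Kˣ) (m : ℕ) : Type _ := RingQuot (HRel K t m)

/-- The generator `T_i`. -/
def heckeT {K : Type*} [Field K] (t : Kˣ) {m : ℕ} (i : ZMod m) : AffineHecke K t m :=
  RingQuot.mkAlgHom K (HRel K t m) (FreeAlgebra.ι K (HGen.T i))

theorem heckeT_quad {K : Type*} [Field K] (t : Kˣ) {m : ℕ} (i : ZMod m) :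
    (heckeT t i - algebraMap K _ (t : K)) * (heckeT t i + 1) = 0 := by
  have := RingQuot.mkAlgHom_rel K (HRel.quad (K := K) (t := t) i)
  simp only [map_mul, map_sub, map_add, map_one, map_zero, AlgHom.commutes] at this
  exact this

/-- The generator `T_i` as an invertible element. -/
def heckeTu {K : Type*} [Field K] (t : Kˣ) {m : ℕ} (i : ZMod m) : (AffineHecke K t m)ˣ where
  val := heckeT t i
  inv := ((t⁻¹ : Kˣ) : K) • (heckeT t i - algebraMap K _ (t : K) + 1)
  val_inv := by
    have h := heckeT_quad t i
    have h2 : heckeT t i * (heckeT t i - algebraMap K _ (t : K) + 1) =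
        algebraMap K _ (t : K) := by
      have hc := Algebra.commutes (t : K) (heckeT t i)
      have e : (heckeT t i - algebraMap K _ (t : K)) * (heckeT t i + 1) =
        heckeT t i * (heckeT t i - algebraMap K _ (t : K) + 1) - algebraMap K _ (t : K) := by
        simp only [sub_mul, mul_add, mul_sub, mul_one, hc]; abel
      rw [e] at h
      exact sub_eq_zero.1 h
    rw [mul_smul_comm, h2, Algebra.smul_def, ← map_mul, Units.inv_mul, map_one]
  inv_val := by
    have h := heckeT_quad t i
    have h2 : (heckeT t i - algebraMap K _ (t : K) + 1) * heckeT t i =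
        algebraMap K _ (t : K) := by
      have e : (heckeT t i - algebraMap K _ (t : K)) * (heckeT t i + 1) =
        (heckeT t i - algebraMap K _ (t : K) + 1) * heckeT t i - algebraMap K _ (t : K) := by
        simp only [sub_mul, mul_add, add_mul, mul_one, one_mul]; abel
      rw [e] at h
      exact sub_eq_zero.1 h
    rw [smul_mul_assoc, h2, Algebra.smul_def, ← map_mul, Units.inv_mul, map_one]

/-- The operators by which the generators act. -/
def genOp {K : Type*} [Field K] (q t : Kˣ) {m : ℕ} [NeZero m] :
    HGen m → Module.End K (Laurent K m)
  | HGen.T i => tOp q t i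
  | HGen.P => piOp q
  | HGen.Pinv => piInvOp q

/-- The level one polynomial representation of the affine Hecke algebra. -/
def levelOne {K : Type*} [Field K] (q t : Kˣ) (m : ℕ) [NeZero m] :
    AffineHecke K t m →ₐ[K] Module.End K (Laurent K m) :=
  RingQuot.liftAlgHom K ⟨FreeAlgebra.lift K (genOp q t), by
    intro x y h
    induction h with
    | quad i =>
      simp only [map_mul, map_sub, map_add, map_one, map_zero, AlgHom.commutes,
        FreeAlgebra.lift_ι_apply, genOp]
      refine LinearMap.ext fun F => ?_
      simp only [Module.End.mul_apply, LinearMap.sub_apply, LinearMap.add_apply,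
        Module.End.one_apply, Module.algebraMap_end_apply, map_add, tOp_quad, LinearMap.zero_apply,
        sub_smul, one_smul]
      abel
    | braid hm i =>
      simp only [map_mul, FreeAlgebra.lift_ι_apply, genOp]
      refine LinearMap.ext fun F => ?_
      exact tOp_braid q t hm i F
    | comm i j h1 h2 =>
      simp only [map_mul, FreeAlgebra.lift_ι_apply, genOp]
      by_cases h0 : j = i
      · rw [h0]
      · refine LinearMap.ext fun F => ?_
        exact tOp_comm q t h0 h1 h2 F
    | pi i =>
      simp only [map_mul, FreeAlgebra.lift_ι_apply, genOp]
      refine LinearMap.ext fun F => ?_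
      exact piOp_tOp q t i F
    | mul_inv =>
      simp only [map_mul, map_one, FreeAlgebra.lift_ι_apply, genOp]
      refine LinearMap.ext fun F => ?_
      exact piOp_piInvOp q F
    | inv_mul =>
      simp only [map_mul, map_one, FreeAlgebra.lift_ι_apply, genOp]
      refine LinearMap.ext fun F => ?_
      exact piInvOp_piOp q F⟩

end AffineHecke

section Chromatic

/-- The set `𝔼_n` of sequences `e(1), …, e(n)` with `0 ≤ e(i) < i` and `e(i) ≤ e(i + 1)`;
`e(i)` is the value at the element `i - 1` of `Fin n`. -/
structure ESeq (n : ℕ) where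
  val : Fin n → ℤ
  nonneg : ∀ i, 0 ≤ val i
  lt : ∀ i : Fin n, val i < (i : ℤ) + 1
  mono : ∀ i j : Fin n, (j : ℕ) = (i : ℕ) + 1 → val i ≤ val j

/-- The oriented unit interval graph of `e`: the vertices are `1, …, n` (where `i` is the element
`i - 1` of `Fin n`), and there is an edge `j → i` exactly if `e(i) < j < i`. -/
def unitIntervalGraph {n : ℕ} (e : ESeq n) : Digraph (Fin n) where
  Adj j i := e.val i < (j : ℤ) + 1 ∧ j < i

/-- The product `f_{i+k-1} ⋯ f_{i+1} f_i` of `k` factors. -/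
def descProd {R : Type*} [Monoid R] (f : ℤ → R) (i : ℤ) : ℕ → R
  | 0 => 1
  | k + 1 => f (i + k) * descProd f i k

/-- `1 + f_i + f_{i+1} f_i + ⋯ + f_{m+e-1} ⋯ f_i` if `e ≥ i - m`, and `0` if `e < i - m`. -/
def partialSymm {R : Type*} [Ring R] (m : ℕ) (f : ℤ → R) (i e : ℤ) : R :=
  if i - m ≤ e then ∑ k ∈ Finset.range ((m + e - i).toNat + 1), descProd f i k else 0

/-- `S_{i,e} = 1 + T_i⁻¹ + T_{i+1}⁻¹ T_i⁻¹ + ⋯ + T_{m+e-1}⁻¹ ⋯ T_i⁻¹`. -/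
def heckeS {K : Type*} [Field K] (t : Kˣ) (m : ℕ) (i e : ℤ) : AffineHecke K t m :=
  partialSymm m
    (fun k => (((heckeTu t (k : ZMod m))⁻¹ : (AffineHecke K t m)ˣ) : AffineHecke K t m)) i e

/-- `X_1 X_2 ⋯ X_n` for `n` possibly larger than `m`. -/
def prodX {K : Type*} [Field K] (q : Kˣ) (m : ℕ) [NeZero m] (n : ℕ) : Laurent K m :=
  ∏ k ∈ Finset.range n, (Xu q m ((k : ℤ) + 1) : Laurent K m)

/-- `t^{n(m-1)} S_{1,e(1)} S_{2,e(2)} ⋯ S_{n,e(n)} (X_1 X_2 ⋯ X_n)`. -/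
def qtChrom {K : Type*} [Field K] (q t : Kˣ) (m : ℕ) [NeZero m] {n : ℕ} (e : ESeq n) :
    Laurent K m :=
  (t : K) ^ (n * (m - 1)) •
    levelOne q t m (List.ofFn fun j : Fin n => heckeS t m ((j : ℤ) + 1) (e.val j)).prod
      (prodX q m n)

/-- `S̄_{1,e(1)} S̄_{2,e(2)} ⋯ S̄_{n,e(n)} (X_1 X_2 ⋯ X_n)`, with
`S̄_{i,e} = 1 + s_i + s_{i+1} s_i + ⋯ + s_{m+e-1} ⋯ s_i`. -/
def katoPoly {K : Type*} [Field K] (q : Kˣ) (m : ℕ) [NeZero m] {n : ℕ} (e : ESeq n) :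
    Laurent K m :=
  (List.ofFn fun j : Fin n =>
    partialSymm m (fun k => (sOp q (k : ZMod m) : Module.End K (Laurent K m)))
      ((j : ℤ) + 1) (e.val j)).prod (prodX q m n)

/-- The inclusion of polynomials into Laurent polynomials. -/
def toLaurent (K : Type*) [Field K] (m : ℕ) : MvPolynomial (Fin m) K →ₐ[K] Laurent K m :=
  MvPolynomial.aeval fun j => AddMonoidAlgebra.single (Pi.single j 1) 1

end Chromatic

section SymmetricFunctions

open MvPolynomial

/-- The truncation: `X_j ↦ 0` for `m' < j ≤ m`. -/
def trunc (K : Type*) [Field K] (m m' : ℕ) :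
    MvPolynomial (Fin m) K →ₐ[K] MvPolynomial (Fin m') K :=
  aeval fun j => if h : (j : ℕ) < m' then X ⟨j, h⟩ else 0

/-- The graded projective limit of the polynomial rings: families of polynomials of bounded degree
in `m = 1, 2, …` variables that are compatible under truncation. -/
def PolyLim (K : Type*) [Field K] : Subalgebra K ((m : ℕ+) → MvPolynomial (Fin m) K) where
  carrier := {f | (∀ m m' : ℕ+, m' < m → trunc K m m' (f m) = f m') ∧
    ∃ d : ℕ, ∀ m, (f m).totalDegree ≤ d}
  mul_mem' := by
    rintro f g ⟨hf, d, hd⟩ ⟨hg, d', hd'⟩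
    refine ⟨fun m m' h => ?_, d + d', fun m => ?_⟩
    · rw [Pi.mul_apply, map_mul, hf m m' h, hg m m' h, Pi.mul_apply]
    · exact (totalDegree_mul _ _).trans (add_le_add (hd m) (hd' m))
  add_mem' := by
    rintro f g ⟨hf, d, hd⟩ ⟨hg, d', hd'⟩
    refine ⟨fun m m' h => ?_, max d d', fun m => ?_⟩
    · rw [Pi.add_apply, map_add, hf m m' h, hg m m' h, Pi.add_apply]
    · exact (totalDegree_add _ _).trans (max_le_max (hd m) (hd' m))
  algebraMap_mem' := by
    intro c
    refine ⟨fun m m' _ => ?_, 0, fun m => ?_⟩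
    · exact (trunc K m m').commutes c
    · exact (totalDegree_C c).le

/-- The ring of symmetric functions: families in the projective limit all of whose members are
symmetric polynomials. -/
def SymmFun (K : Type*) [Field K] : Subalgebra K ((m : ℕ+) → MvPolynomial (Fin m) K) :=
  PolyLim K ⊓
    { carrier := {f | ∀ m, (f m).IsSymmetric}
      mul_mem' := fun hf hg m => (hf m).mul (hg m)
      add_mem' := fun hf hg m => (hf m).add (hg m)
      algebraMap_mem' := fun c _ => IsSymmetric.C c }

theorem trunc_esymm (K : Type*) [Field K] {m m' : ℕ} (h : m' ≤ m) (r : ℕ) :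
    trunc K m m' (esymm (Fin m) K r) = esymm (Fin m') K r := by
  classical
  rw [esymm, esymm, map_sum]
  have key : ∀ s : Finset (Fin m'), trunc K m m' (∏ i ∈ s.map (Fin.castLEEmb h), X i) =
      ∏ i ∈ s, X i := by
    intro s
    rw [Finset.prod_map, map_prod]
    refine Finset.prod_congr rfl fun i _ => ?_
    simp [trunc]
  symm
  refine Finset.sum_of_injOn (fun s => s.map (Fin.castLEEmb h)) ?_ ?_ ?_ ?_
  · exact fun s _ s' _ hh => Finset.map_injective _ hh
  · intro s hs
    have := (Finset.mem_powersetCard.1 (Finset.mem_coe.1 hs)).2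
    simp [Finset.mem_powersetCard, this]
  · intro s hs hns
    have hc := (Finset.mem_powersetCard.1 hs).2
    have : ∃ i ∈ s, ¬ (i : ℕ) < m' := by
      by_contra hall
      push Not at hall
      apply hns
      refine ⟨Finset.univ.filter (fun j : Fin m' => Fin.castLE h j ∈ s), ?_, ?_⟩
      · have he : (Finset.univ.filter (fun j : Fin m' => Fin.castLE h j ∈ s)).map
            (Fin.castLEEmb h) = s := by
          ext i
          simp only [Finset.mem_map, Finset.mem_filter, Finset.mem_univ, true_and]
          constructor
          · rintro ⟨j, hj, rfl⟩; exact hj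
          · intro hi; exact ⟨⟨i, hall i hi⟩, hi, rfl⟩
        rw [Finset.mem_coe, Finset.mem_powersetCard]
        refine ⟨Finset.subset_univ _, ?_⟩
        rw [← hc, ← he, Finset.card_map, he]
      · ext i
        simp only [Finset.mem_map, Finset.mem_filter, Finset.mem_univ, true_and]
        constructor
        · rintro ⟨j, hj, rfl⟩; exact hj
        · intro hi; exact ⟨⟨i, hall i hi⟩, hi, rfl⟩
    obtain ⟨i, hi, hlt⟩ := this
    rw [map_prod]
    apply Finset.prod_eq_zero hi
    simp [trunc, hlt]
  · intro s _
    exact (key s).symm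

/-- The elementary symmetric function `e_r`. -/
def elemSymm (K : Type*) [Field K] (r : ℕ) : SymmFun K :=
  ⟨fun m => esymm (Fin m) K r,
    ⟨fun _ _ h => trunc_esymm K (le_of_lt h) r, r, fun m => by
      change (esymm (Fin m) K r).totalDegree ≤ r
      rw [esymm]
      refine totalDegree_finsetSum_le fun s hs => ?_
      refine (totalDegree_finsetProd _ _).trans ?_
      rw [← (Finset.mem_powersetCard.1 hs).2]
      simp [totalDegree_X]⟩,
    fun m => esymm_isSymmetric (Fin m) K r⟩

open Classical in
/-- The chromatic quasisymmetric function `∑_κ t^{asc κ} ∏_v X_{κ v}` of an oriented graph, the sum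
over all proper colorings `κ` by positive integers, as a family in the projective limit: its
truncation to `m` variables is the sum over the colorings with values in `1, …, m`. -/
def chromQuasi {K : Type*} [Field K] (t : K) {V : Type*} [Fintype V] (Γ : Digraph V) (m : ℕ+) :
    MvPolynomial (Fin m) K :=
  ∑ κ : V → Fin m with (∀ v w, Γ.Adj v w → κ v ≠ κ w),
    C (t ^ Fintype.card {p : V × V // Γ.Adj p.1 p.2 ∧ κ p.1 < κ p.2}) * ∏ v, X (κ v)

end SymmetricFunctions

section Specialization

/-- The field `ℚ(q, t) = ℚ(t)(q)`. -/
abbrev QQt : Type := RatFunc (RatFunc ℚ)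

/-- The parameter `q`. -/
def qVar : QQtˣ := Units.mk0 RatFunc.X RatFunc.X_ne_zero

/-- The parameter `t`. -/
def tVar : QQtˣ :=
  Units.mk0 (RatFunc.C RatFunc.X) ((map_ne_zero _).2 RatFunc.X_ne_zero)

/-- The value at `q = 1`, in `ℚ(t) ⊂ ℚ(q, t)` of an element of `ℚ(q, t)` without pole there. -/
def scalarAtOne (c : QQt) : QQt := RatFunc.C (RatFunc.eval (RingHom.id (RatFunc ℚ)) 1 c)

/-- Coefficientwise specialization at `q = 1` of polynomials and Laurent polynomials. -/
def atQOne {M : Type*} (F : AddMonoidAlgebra QQt M) : AddMonoidAlgebra QQt M :=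
  AddMonoidAlgebra.ofCoeff (F.coeff.mapRange scalarAtOne (by simp [scalarAtOne]))

end Specialization

end QTChrom

end

open QTChrom

/-! In the proof vertices and variables are counted from 0, and polynomials for all m live in one
ring in X_0, X_1, ….

Since X_1⋯X_n = Πⁿ(1) and conjugation by Π shifts the indices of the T_i, the defining product
becomes S_{1,-a_0} Π S_{1,-a_1} Π ⋯ applied to 1, where a_s = s - e(s) is the number of edges into
the vertex s (`prod_partialSymm`, `qtChrom_eq`). Now only T_1, …, T_{m-1} occur. Their inverses on
polynomials are `theta` (with τ = t⁻¹), Π is `rot` (with p = q⁻¹), one factor together with its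
power of t is `step`, and the product is `chain` or `qtPoly`.

Symmetry: a partial symmetrizer turns invariants of θ_1, θ_2, … into invariants of θ_0, θ_1, …
(`theta_thetaSum_of_inv`). Monotonicity of e means a_{s+1} ≤ a_s + 1, which is what invariance needs
to pass along the chain, and a_0 = 0 makes the result fully symmetric (`theta_chain`). Integrality:
the construction exists over every domain and commutes with ring homomorphisms (`map_qtPoly`).
Stability: setting a variable to zero in a partial symmetrizer gives the shorter one times τ, and
the factor t^(m-1) absorbs this τ (`drop_thetaSum`, `drop_step`).

The comparison at q = 1 rests on the modular law, a three term relation (1 + t) f(e_1) = t f(e_2) +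
f(e_0) between graphs that differ in edges at two vertices with otherwise equal neighbours. A
function subject to it is determined by its values on disjoint unions of complete graphs
(`Modular.eq_zero`). The chromatic quasisymmetric polynomials satisfy it because the defect is
antisymmetric under exchanging two colors (`modular_chromPoly`), and the Hecke side satisfies it for
every p ≠ 0 by computations with symmetrizers (`modular_qtPoly`). At p = 1 multiplication by
elementary symmetric polynomials commutes with all operators, so both sides are multiplicative on
disjoint unions of complete graphs. A complete graph on r vertices gives [r]_t! e_r on one side and
t^(r(r-1)/2) [r]_t! e_r on the other (`chromPoly_clique`, `chain_clique`, `qtPoly_add`), and the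
quotient of these values is the effect of N. The same principle, applied modulo Λ, shows that X_Γ(t)
is a symmetric function (`chromFam_mem`). Kato's formula is the case t = 1, where θ_i is a
transposition and N is the identity (`qtFam_one_eq_chromFam`). -/

noncomputable section

namespace QTChrom

/-! ### The modular law and the uniqueness of its solutions -/

section ModularLaw

/-- The conditions on the values at `0, …, n - 1` of a sequence in `𝔼_n`, counted from `0`. -/
structure Valid (n : ℕ) (e : ℕ → ℕ) : Prop where
  le : ∀ i < n, e i ≤ i
  mono : ∀ i j, i ≤ j → j < n → e i ≤ e j

/-- The modular law for functions on `𝔼_n`. -/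
structure Modular {K V : Type*} [Field K] [AddCommGroup V] [Module K V] (t : K) (n : ℕ)
    (f : (ℕ → ℕ) → V) : Prop where
  congr : ∀ e e' : ℕ → ℕ, (∀ i < n, e i = e' i) → f e = f e'
  single : ∀ (e : ℕ → ℕ) (i c : ℕ), i < n → c + 1 < i → e c = e (c + 1) →
    Valid n (Function.update e i c) → Valid n (Function.update e i (c + 2)) →
    (1 + t) • f (Function.update e i (c + 1)) =
      t • f (Function.update e i (c + 2)) + f (Function.update e i c)
  double : ∀ (e : ℕ → ℕ) (i c : ℕ), i + 1 < n → (∀ k, i + 1 < k → k < n → e k ≠ i + 1) →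
    Valid n (Function.update (Function.update e i c) (i + 1) c) →
    Valid n (Function.update (Function.update e i (c + 1)) (i + 1) (c + 1)) →
    (1 + t) • f (Function.update (Function.update e i c) (i + 1) (c + 1)) =
      t • f (Function.update (Function.update e i (c + 1)) (i + 1) (c + 1)) +
        f (Function.update (Function.update e i c) (i + 1) c)

variable {K V : Type*} [Field K] [AddCommGroup V] [Module K V] {t : K} {n : ℕ}

theorem Modular.comp {V' : Type*} [AddCommGroup V'] [Module K V'] {f : (ℕ → ℕ) → V}
    (hf : Modular t n f) (φ : V →ₗ[K] V') : Modular t n (fun e => φ (f e)) where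
  congr e e' h := congrArg φ (hf.congr e e' h)
  single e i c h1 h2 h3 h4 h5 := by
    simpa only [map_smul, map_add] using congrArg φ (hf.single e i c h1 h2 h3 h4 h5)
  double e i c h1 h2 h3 h4 := by
    simpa only [map_smul, map_add] using congrArg φ (hf.double e i c h1 h2 h3 h4)

theorem Modular.sub {f g : (ℕ → ℕ) → V} (hf : Modular t n f) (hg : Modular t n g) :
    Modular t n (fun e => f e - g e) where
  congr e e' h := by simp only [hf.congr e e' h, hg.congr e e' h]
  single e i c h1 h2 h3 h4 h5 := by
    simp only [smul_sub, hf.single e i c h1 h2 h3 h4 h5, hg.single e i c h1 h2 h3 h4 h5]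
    abel
  double e i c h1 h2 h3 h4 := by
    simp only [smul_sub, hf.double e i c h1 h2 h3 h4, hg.double e i c h1 h2 h3 h4]
    abel

/-- A solution of the three term recurrence that vanishes at two places is zero in between. -/
theorem recurrence_eq_zero (ht : t ≠ 0) (hq : ∀ N : ℕ, ∑ i ∈ Finset.range (N + 1), t ^ i ≠ 0)
    {h : ℕ → V} {N : ℕ} (h0 : h 0 = 0) (hN : h (N + 1) = 0)
    (hr : ∀ x, x + 1 ≤ N → (1 + t) • h (x + 1) = t • h (x + 2) + h x) {x : ℕ} (hx : x ≤ N) :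
    h x = 0 := by
  -- The recurrence says that each difference is t times the next one, so the values are multiples
  -- of h 1 by t-integers up to powers of t. A zero at N + 1 then forces h 1 = 0, because the
  -- t-integer is invertible.
  have step : ∀ x, x ≤ N → t ^ x • (h (x + 1) - h x) = h 1 := by
    intro x hx
    induction x with
    | zero => simp [h0]
    | succ x ih =>
      rw [← ih (by omega), pow_succ, mul_smul]
      congr 1
      have := hr x hx
      rw [add_smul, one_smul] at this
      rw [smul_sub, sub_eq_sub_iff_add_eq_add, add_comm (h (x + 1)), ← this, add_comm]
  have sum : ∀ x, x ≤ N → t ^ x • h (x + 1) = (∑ i ∈ Finset.range (x + 1), t ^ i) • h 1 := by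
    intro x hx
    induction x with
    | zero => simp
    | succ x ih =>
      have e := step (x + 1) hx
      rw [smul_sub, sub_eq_iff_eq_add] at e
      rw [e, pow_succ', mul_smul, ih (by omega), smul_smul, Finset.mul_sum,
        Finset.sum_range_succ' _ (x + 1), add_smul, add_comm]
      simp [pow_succ']
  have h1 : h 1 = 0 := by
    have := sum N le_rfl
    rw [hN, smul_zero] at this
    exact (smul_eq_zero.1 this.symm).resolve_left (hq N)
  cases x with
  | zero => exact h0
  | succ x =>
    have := sum x (by omega)
    rw [h1, smul_zero] at this
    exact (smul_eq_zero.1 this).resolve_left (pow_ne_zero _ ht)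

/-- Reduction of the values on a block of vertices to two extremal values. -/
theorem Modular.eq_zero_of_corners {f : (ℕ → ℕ) → V} (hf : Modular t n f) (ht : t ≠ 0)
    (hq : ∀ N : ℕ, ∑ i ∈ Finset.range (N + 1), t ^ i ≠ 0) {w W : ℕ} (r : ℕ) :
    ∀ (d : ℕ) (e : ℕ → ℕ), d + r ≤ n → Valid n e →
      (∀ x, d ≤ x → x < d + r → w ≤ e x ∧ e x ≤ W) →
      (∀ c, w ≤ c → c + 1 < W → e c = e (c + 1)) → W ≤ d →
      (∀ k, d + r ≤ k → k < n → ∀ x, d < x → x < d + r → e k ≠ x) →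
      (∀ x < d, e x ≤ w) → (∀ k, d + r ≤ k → k < n → W ≤ e k) →
      (∀ e', Valid n e' → (∀ x, ¬ (d ≤ x ∧ x < d + r) → e' x = e x) →
        (∃ s ≤ r, ∀ x, d ≤ x → x < d + r → e' x = if x < d + s then w else W) → f e' = 0) →
      f e = 0 := by
  induction r with
  | zero =>
    intro d e _ he _ _ _ _ _ _ hc
    exact hc e he (fun _ _ => rfl) ⟨0, le_rfl, fun x h1 h2 => by omega⟩
  | succ r ih =>
    intro d e hdn he hrange htw hWd hk hlow hup hc
    -- If the first vertex of the block already has the value w, it joins the vertices on the left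
    -- and the shorter block is handled by induction on r.
    have low : ∀ e', Valid n e' → (∀ x, ¬ (d ≤ x ∧ x < d + (r + 1)) → e' x = e x) →
        (∀ x, d ≤ x → x < d + (r + 1) → w ≤ e' x ∧ e' x ≤ W) → e' d = w → f e' = 0 := by
      intro e' he' hoff hr' hd
      have hw := hrange d le_rfl (by omega)
      refine ih (d + 1) e' (by omega) he' (fun x h1 h2 => hr' x (by omega) (by omega)) ?_ (by omega)
        ?_ ?_ ?_ ?_
      · intro c h1 h2
        rw [hoff c (by omega), hoff (c + 1) (by omega)]
        exact htw c h1 h2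
      · intro k h1 h2 x h3 h4
        rw [hoff k (by omega)]
        exact hk k (by omega) h2 x (by omega) (by omega)
      · intro x hx
        rcases Nat.lt_or_ge x d with h | h
        · rw [hoff x (by omega)]; exact hlow x h
        · obtain rfl : x = d := by omega
          exact hd.le
      · intro k h1 h2
        rw [hoff k (by omega)]
        exact hup k (by omega) h2
      · rintro e'' he'' hoff' ⟨s, hs, hcorner⟩
        refine hc e'' he'' (fun x hx => ?_) ⟨s + 1, by omega, fun x h1 h2 => ?_⟩
        · rw [hoff' x (by omega), hoff x hx]
        · rcases Nat.lt_or_ge d x with h | h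
          · rw [hcorner x (by omega) (by omega)]
            simp only [show d + 1 + s = d + (s + 1) by omega]
          · obtain rfl : x = d := by omega
            rw [hoff' x (by omega), hd, if_pos (by omega)]
    -- Inner induction on the total distance of the values on the block from the upper bound W.
    suffices H : ∀ M : ℕ, ∀ e', Valid n e' →
        (∀ x, ¬ (d ≤ x ∧ x < d + (r + 1)) → e' x = e x) →
        (∀ x, d ≤ x → x < d + (r + 1) → w ≤ e' x ∧ e' x ≤ W) →
        ∑ i ∈ Finset.range (r + 1), (W - e' (d + i)) = M → f e' = 0 from
      H _ e he (fun _ _ => rfl) hrange rfl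
    intro M
    induction M using Nat.strong_induction_on with
    | _ M ihM =>
    intro e' he' hoff hr' hM
    by_cases hcw : e' d = w
    · exact low e' he' hoff hr' hcw
    obtain ⟨c, hcd⟩ : ∃ c, e' d = c := ⟨_, rfl⟩
    have hcr := hr' d le_rfl (by omega)
    by_cases hcW : c = W
    · refine hc e' he' hoff ⟨0, by omega, fun x h1 h2 => ?_⟩
      rw [if_neg (by omega)]
      have := he'.mono d x h1 (by omega)
      have := hr' x h1 h2
      omega
    have hex : ∃ j, 1 ≤ j ∧ (j = r + 1 ∨ e' (d + j) ≠ c) := ⟨r + 1, by omega, Or.inl rfl⟩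
    obtain ⟨j, hj1, hjr, hrun, hjend⟩ : ∃ j, 1 ≤ j ∧ j ≤ r + 1 ∧ (∀ i < j, e' (d + i) = c) ∧
        (∀ x, d + j ≤ x → x < d + (r + 1) → c + 1 ≤ e' x) := by
      classical
      have hspec := Nat.find_spec hex
      have hle : Nat.find hex ≤ r + 1 := Nat.find_min' hex ⟨by omega, Or.inl rfl⟩
      refine ⟨Nat.find hex, hspec.1, hle, fun i hi => ?_, fun x h1 h2 => ?_⟩
      · have := Nat.find_min hex hi
        rcases Nat.eq_zero_or_pos i with h0 | h0
        · rw [h0]; exact hcd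
        · by_contra h
          exact this ⟨h0, Or.inr h⟩
      · have h3 := hspec.2.resolve_left (by omega)
        have h4 := he'.mono d (d + Nat.find hex) (by omega) (by omega)
        have h5 := he'.mono _ x h1 (by omega)
        omega
    -- The first run of the block has length j and value c. `Y i` keeps c on its first i vertices
    -- and raises the others to c + 1, so that `Y j` is the given sequence and `Y 0` is closer to W.
    set Y : ℕ → ℕ → ℕ := fun i x =>
      if d ≤ x ∧ x < d + i then c else if d + i ≤ x ∧ x < d + j then c + 1 else e' x with hY
    have hYoff : ∀ i ≤ j, ∀ x, ¬ (d ≤ x ∧ x < d + (r + 1)) → Y i x = e x := by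
      intro i hi x hx
      rw [← hoff x hx, hY]
      simp only
      rw [if_neg (by omega), if_neg (by omega)]
    have hYr : ∀ i ≤ j, ∀ x, d ≤ x → x < d + (r + 1) → w ≤ Y i x ∧ Y i x ≤ W := by
      intro i hi x h1 h2
      have := hr' x h1 h2
      simp only [hY]
      split_ifs <;> omega
    have hlow' : ∀ x < d, e' x ≤ w := fun x hx => by rw [hoff x (by omega)]; exact hlow x hx
    have hup' : ∀ k, d + (r + 1) ≤ k → k < n → W ≤ e' k := fun k h1 h2 => by
      rw [hoff k (by omega)]; exact hup k h1 h2
    have valid_of : ∀ y : ℕ → ℕ, (∀ x, ¬ (d ≤ x ∧ x < d + (r + 1)) → y x = e x) →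
        (∀ x, d ≤ x → x < d + (r + 1) → w ≤ y x ∧ y x ≤ W) →
        (∀ x x', d ≤ x → x ≤ x' → x' < d + (r + 1) → y x ≤ y x') → Valid n y := by
      intro y h1 h2 h3
      refine ⟨fun i hi => ?_, fun i i' hii hi' => ?_⟩
      · by_cases h : d ≤ i ∧ i < d + (r + 1)
        · have := h2 i h.1 h.2; omega
        · rw [h1 i h]; exact he.le i hi
      · by_cases h : d ≤ i ∧ i < d + (r + 1)
        · by_cases h' : d ≤ i' ∧ i' < d + (r + 1)
          · exact h3 i i' h.1 hii h'.2
          · have a1 := h2 i h.1 h.2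
            rw [h1 i' h']
            have := hup i' (by omega) hi'
            omega
        · by_cases h' : d ≤ i' ∧ i' < d + (r + 1)
          · have a1 := h2 i' h'.1 h'.2
            rw [h1 i h]
            have := hlow i (by omega)
            omega
          · rw [h1 i h, h1 i' h']
            exact he.mono i i' hii hi'
    have hYmono : ∀ i ≤ j, ∀ x x', d ≤ x → x ≤ x' → x' < d + (r + 1) → Y i x ≤ Y i x' := by
      intro i hi x x' h1 h2 h3
      have hm := he'.mono x x' h2 (by omega)
      simp only [hY]
      split_ifs <;> try omega
      · have := hjend x' (by omega) h3; omega
      · have := hjend x' (by omega) h3; omega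
    have hYval : ∀ i ≤ j, Valid n (Y i) := fun i hi =>
      valid_of _ (hYoff i hi) (hYr i hi) (hYmono i hi)
    have hYj : f e' = f (Y j) := by
      refine hf.congr _ _ fun x _ => ?_
      simp only [hY]
      split_ifs with h1 h2
      · have := hrun (x - d) (by omega)
        rwa [show d + (x - d) = x by omega] at this
      · omega
      · rfl
    have hY0 : f (Y 0) = 0 := by
      refine ihM _ ?_ (Y 0) (hYval 0 (by omega)) (hYoff 0 (by omega)) (hYr 0 (by omega)) rfl
      rw [← hM]
      refine Finset.sum_lt_sum (fun i hi => ?_) ⟨0, by simp, ?_⟩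
      · rw [Finset.mem_range] at hi
        simp only [hY]
        split_ifs with h1 h2
        · omega
        · have := hrun i (by omega); omega
        · exact le_rfl
      · simp only [hY]
        rw [if_neg (by omega), if_pos (by omega), add_zero, hcd]
        omega
    have hupd0 : ∀ x, x ≤ c + 1 → w ≤ x → Valid n (Function.update (Y 0) d x) := by
      intro x hx hwx
      refine valid_of _ (fun z hz => ?_) (fun z h1 h2 => ?_) (fun z z' h1 h2 h3 => ?_)
      · rw [Function.update_of_ne (by omega)]; exact hYoff 0 (by omega) z hz
      · by_cases h : z = d
        · subst h; rw [Function.update_self]; omega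
        · rw [Function.update_of_ne h]; exact hYr 0 (by omega) z h1 h2
      · by_cases h' : z' = d
        · obtain rfl : z = z' := by omega
          exact le_rfl
        · rw [Function.update_of_ne h']
          by_cases h : z = d
          · subst h
            rw [Function.update_self]
            have := hYmono 0 (by omega) z z' h1 h2 h3
            have h0 : Y 0 z = c + 1 := by
              simp only [hY]; rw [if_neg (by omega), if_pos (by omega)]
            omega
          · rw [Function.update_of_ne h]
            exact hYmono 0 (by omega) z z' h1 h2 h3
    have hY1 : f (Y 1) = 0 := by
      have e1 : Y 1 = Function.update (Y 0) d c := by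
        funext x
        by_cases h : x = d
        · subst h
          simp [hY]
        · rw [Function.update_of_ne h]
          simp only [hY]
          split_ifs <;> omega
      have e0 : Function.update (Y 0) d (c + 1) = Y 0 := by
        rw [Function.update_eq_self_iff]
        simp only [hY]
        rw [if_neg (by omega), if_pos (by omega)]
      -- Only the value at d moves: at w the function vanishes by `low`, at c + 1 it is the value at
      -- `Y 0`, and in between the first form of the modular law is the recurrence.
      have := recurrence_eq_zero ht hq (h := fun x => f (Function.update (Y 0) d (w + x)))
        (N := c - w) (x := c - w) ?_ ?_ ?_ le_rfl
      · rwa [show w + (c - w) = c by omega, ← e1] at this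
      · refine low _ (hupd0 _ (by omega) (by omega)) (fun z hz => ?_) (fun z h1 h2 => ?_) ?_
        · rw [Function.update_of_ne (by omega)]; exact hYoff 0 (by omega) z hz
        · by_cases h : z = d
          · subst h; rw [Function.update_self]; omega
          · rw [Function.update_of_ne h]; exact hYr 0 (by omega) z h1 h2
        · rw [Function.update_self]; rfl
      · rw [show w + (c - w + 1) = c + 1 by omega, e0, hY0]
      · intro x hx
        refine hf.single (Y 0) d (w + x) (by omega) (by omega) ?_ (hupd0 _ (by omega) (by omega))
          (hupd0 _ (by omega) (by omega))
        rw [hYoff 0 (by omega) _ (by omega), hYoff 0 (by omega) _ (by omega)]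
        exact htw _ (by omega) (by omega)
    -- The second form of the modular law at the vertices d + i and d + i + 1 links three
    -- consecutive `Y`, so two zeros produce the next.
    have hYall : ∀ i, i + 1 ≤ j → f (Y i) = 0 ∧ f (Y (i + 1)) = 0 := by
      intro i
      induction i with
      | zero => exact fun _ => ⟨hY0, hY1⟩
      | succ i ihi =>
        intro hi
        obtain ⟨g0, g1⟩ := ihi (by omega)
        refine ⟨g1, ?_⟩
        have u0 : Function.update (Function.update (Y i) (d + i) (c + 1)) (d + i + 1) (c + 1) =
            Y i := by
          funext x
          simp only [Function.update_apply, hY]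
          split_ifs <;> omega
        have u1 : Function.update (Function.update (Y i) (d + i) c) (d + i + 1) (c + 1) =
            Y (i + 1) := by
          funext x
          simp only [Function.update_apply, hY]
          split_ifs <;> omega
        have u2 : Function.update (Function.update (Y i) (d + i) c) (d + i + 1) c =
            Y (i + 1 + 1) := by
          funext x
          simp only [Function.update_apply, hY]
          split_ifs <;> omega
        have := hf.double (Y i) (d + i) c (by omega) ?_ (by rw [u2]; exact hYval _ (by omega))
          (by rw [u0]; exact hYval _ (by omega))
        · rw [u0, u1, u2, g0, g1, smul_zero, smul_zero, zero_add] at this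
          exact this.symm
        · intro k h1 h2
          by_cases h : d ≤ k ∧ k < d + (r + 1)
          · have := hYr i (by omega) k h.1 h.2
            omega
          · rw [hYoff i (by omega) k h]
            exact hk k (by omega) h2 _ (by omega) (by omega)
    rw [hYj]
    have := (hYall (j - 1) (by omega)).2
    rwa [show j - 1 + 1 = j by omega] at this

/-- A value of `e` that separates two vertices with the same neighbours on the left. -/
def Bad (n : ℕ) (e : ℕ → ℕ) (v : ℕ) : Prop := 1 ≤ v ∧ (∃ k < n, e k = v) ∧ e (v - 1) = e v

/-- The vertices with value v form a block, and their values can be pushed to the two ends of the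
range in which all vertices have the same left neighbours as v. No vertex then has the value v. Bad
values above v may appear, but none below v that was not there before. Maximality of v excludes
values strictly inside the block, as the second form of the modular law requires. -/
theorem Modular.eq_zero_of_clear {f : (ℕ → ℕ) → V} (hf : Modular t n f) (ht : t ≠ 0)
    (hq : ∀ N : ℕ, ∑ i ∈ Finset.range (N + 1), t ^ i ≠ 0) {e : ℕ → ℕ} (he : Valid n e) {v : ℕ}
    (hv : Bad n e v) (hmax : ∀ x, v < x → ¬ Bad n e x)
    (h : ∀ e', Valid n e' → (∀ x < v, Bad n e' x → Bad n e x) → ¬ Bad n e' v → f e' = 0) :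
    f e = 0 := by
  classical
  obtain ⟨hv1, hvk, htwin⟩ := hv
  obtain ⟨hdn, hdv⟩ := Nat.find_spec hvk
  have hdmin : ∀ k < n, e k = v → Nat.find hvk ≤ k := fun k h1 h2 => Nat.find_min' hvk ⟨h1, h2⟩
  generalize Nat.find hvk = d at hdn hdv hdmin
  have hvn : v < n := by have := he.le d hdn; omega
  have hα : e v < v := by
    have := he.le (v - 1) (by omega); omega
  have hvd : v < d := by
    by_contra hcon
    have := he.mono d v (by omega) hvn
    omega
  have hltd : ∀ x < d, e x < v := by
    intro x hx
    have h1 := he.mono x d hx.le hdn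
    have h2 := hdmin x (by omega)
    omega
  have hexr : ∃ r, 1 ≤ r ∧ (d + r = n ∨ e (d + r) ≠ v) := ⟨n - d, by omega, Or.inl (by omega)⟩
  obtain ⟨r, hr1, hrn, hrv, hrend⟩ : ∃ r, 1 ≤ r ∧ d + r ≤ n ∧ (∀ i < r, e (d + i) = v) ∧
      (∀ x, d + r ≤ x → x < n → v < e x) := by
    have hspec := Nat.find_spec hexr
    have hle : Nat.find hexr ≤ n - d := Nat.find_min' hexr ⟨by omega, Or.inl (by omega)⟩
    refine ⟨Nat.find hexr, hspec.1, by omega, fun i hi => ?_, fun x h1 h2 => ?_⟩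
    · rcases Nat.eq_zero_or_pos i with h0 | h0
      · rw [h0]; exact hdv
      · by_contra hne
        exact Nat.find_min hexr hi ⟨h0, Or.inr hne⟩
    · have h3 := hspec.2.resolve_left (by omega)
      have h4 := he.mono d (d + Nat.find hexr) (by omega) (by omega)
      have h5 := he.mono _ x h1 h2
      omega
  have hblk : ∀ x, d ≤ x → x < d + r → e x = v := by
    intro x h1 h2
    have := hrv (x - d) (by omega)
    rwa [show d + (x - d) = x by omega] at this
  -- The interval from u to u' - 1 around v consists of vertices with the left neighbours of v; it
  -- is maximal on the left.
  obtain ⟨u, huv, hue, humin⟩ : ∃ u, u < v ∧ e u = e v ∧ (1 ≤ u → e (u - 1) ≠ e u) := by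
    have hex : ∃ u, e u = e v := ⟨v, rfl⟩
    refine ⟨Nat.find hex, ?_, Nat.find_spec hex, fun h1 h2 => ?_⟩
    · have := Nat.find_min' hex htwin
      omega
    · exact Nat.find_min hex (Nat.sub_lt h1 one_pos) (h2.trans (Nat.find_spec hex))
  obtain ⟨u', hvu', hu'd, hue'⟩ : ∃ u', v < u' ∧ u' ≤ d ∧ ∀ x, v ≤ x → x < u' → e x = e v := by
    have hex : ∃ u', v < u' ∧ e u' ≠ e v := ⟨d, hvd, by omega⟩
    refine ⟨Nat.find hex, (Nat.find_spec hex).1, Nat.find_min' hex ⟨hvd, by omega⟩,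
      fun x h1 h2 => ?_⟩
    rcases Nat.eq_or_lt_of_le h1 with h3 | h3
    · rw [← h3]
    · by_contra h4
      exact Nat.find_min hex h2 ⟨h3, h4⟩
  have htw : ∀ x, u ≤ x → x < u' → e x = e v := by
    intro x h1 h2
    rcases Nat.lt_or_ge x v with h3 | h3
    · have a1 := he.mono u x h1 (by omega)
      have a2 := he.mono x v h3.le hvn
      omega
    · exact hue' x h3 h2
  obtain ⟨W, hvW, hWu', hWend⟩ : ∃ W, v < W ∧ W ≤ u' ∧ (∀ k, d + r ≤ k → k < n → W ≤ e k) := by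
    by_cases hn : d + r < n
    · refine ⟨min u' (e (d + r)), lt_min hvu' (hrend _ le_rfl hn), min_le_left _ _,
        fun k h1 h2 => (min_le_right _ _).trans (he.mono _ _ h1 h2)⟩
    · exact ⟨u', hvu', le_rfl, fun k h1 h2 => by omega⟩
  have hd1 := hltd (d - 1) (by omega)
  -- The lowest value that respects both the interval of equal left neighbours and monotonicity at
  -- the left end of the block; W plays the same role at the right end.
  obtain ⟨w, hw⟩ : ∃ w, w = max u (e (d - 1)) := ⟨_, rfl⟩
  have hwu : u ≤ w := by omega
  have hwv : w < v := by omega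
  refine hf.eq_zero_of_corners ht hq r d e (w := w) (W := W) hrn he
    (fun x h1 h2 => by rw [hblk x h1 h2]; omega) (fun c h1 h2 => ?_) (by omega) ?_ ?_ hWend ?_
  · rw [htw c (by omega) (by omega), htw (c + 1) (by omega) (by omega)]
  · intro k h1 h2 x h3 h4 hkx
    refine hmax x (by omega) ⟨by omega, ⟨k, h2, hkx⟩, ?_⟩
    rw [hblk x (by omega) h4, hblk (x - 1) (by omega) (by omega)]
  · intro x hx
    have := he.mono x (d - 1) (by omega) (by omega)
    omega
  · rintro e' he' hoff ⟨s, hs, hcorner⟩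
    have hval : ∀ x, d ≤ x → x < d + r → e' x = w ∨ e' x = W := by
      intro x h1 h2
      rw [hcorner x h1 h2]
      split_ifs
      · exact Or.inl rfl
      · exact Or.inr rfl
    refine h e' he' ?_ ?_
    · rintro x hx ⟨h1, ⟨k, hkn, hkx⟩, h3⟩
      rw [hoff x (by omega), hoff (x - 1) (by omega)] at h3
      refine ⟨h1, ?_, h3⟩
      by_cases hkb : d ≤ k ∧ k < d + r
      · have := hval k hkb.1 hkb.2
        -- The other new value W exceeds v. If w = u, it is not bad by the minimality of u;
        -- otherwise w = e (d - 1) was a value of e before, so it was bad already.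
        have hxw : x = w := by omega
        by_cases hu : w = u
        · exact absurd h3 (by rw [hxw, hu]; exact humin (by omega))
        · exact ⟨d - 1, by omega, by omega⟩
      · exact ⟨k, hkn, by rw [← hoff k hkb]; exact hkx⟩
    · rintro ⟨-, ⟨k, hkn, hkx⟩, -⟩
      by_cases hkb : d ≤ k ∧ k < d + r
      · have := hval k hkb.1 hkb.2
        omega
      · rw [hoff k hkb] at hkx
        rcases Nat.lt_or_ge k d with h1 | h1
        · have := hltd k h1; omega
        · have := hrend k (by omega) hkn; omega

/-- A function with the modular law is determined by its values on the disjoint unions of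
complete graphs. -/
theorem Modular.eq_zero {f : (ℕ → ℕ) → V} (hf : Modular t n f) (ht : t ≠ 0)
    (hq : ∀ N : ℕ, ∑ i ∈ Finset.range (N + 1), t ^ i ≠ 0)
    (h : ∀ e, Valid n e → (∀ v, ¬ Bad n e v) → f e = 0) {e : ℕ → ℕ} (he : Valid n e) :
    f e = 0 := by
  -- It is enough to treat sequences without bad values from v on, whose bad values below v are
  -- among those of e. Bad values are less than n, so v = n is the start and v = 0 the goal.
  suffices H : ∀ k v, v + k = n → ∀ e, Valid n e → (∀ e', Valid n e' →
      (∀ x < v, Bad n e' x → Bad n e x) → (∀ x, v ≤ x → ¬ Bad n e' x) → f e' = 0) → f e = 0 by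
    exact H n 0 (by omega) e he fun e' he' _ h2 => h e' he' fun v => h2 v (Nat.zero_le v)
  intro k
  induction k with
  | zero =>
    intro v hv e he h'
    refine h' e he (fun _ _ hx => hx) fun x hx => ?_
    rintro ⟨_, ⟨k, hk, hkx⟩, _⟩
    have := he.le k hk
    omega
  | succ k ih =>
    intro v hv e he h'
    refine ih (v + 1) (by omega) e he fun e1 he1 hlt1 hge1 => ?_
    by_cases hb : Bad n e1 v
    -- Clearing v may create bad values above it, which a second use of the induction hypothesis
    -- removes.
    · refine hf.eq_zero_of_clear ht hq he1 hb (fun x hx => hge1 x hx) fun e2 he2 hlt2 hv2 => ?_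
      refine ih (v + 1) (by omega) e2 he2 fun e3 he3 hlt3 hge3 => ?_
      refine h' e3 he3 (fun x hx hbx => hlt1 x (by omega) (hlt2 x hx (hlt3 x (by omega) hbx)))
        fun x hx => ?_
      rcases Nat.eq_or_lt_of_le hx with h4 | h4
      · rw [← h4]
        exact fun hbx => hv2 (hlt3 v (by omega) hbx)
      · exact hge3 x h4
    · refine h' e1 he1 (fun x hx hbx => hlt1 x (by omega) hbx) fun x hx => ?_
      rcases Nat.eq_or_lt_of_le hx with h4 | h4
      · rwa [← h4]
      · exact hge1 x h4

/-- Without bad values the graph is a disjoint union of complete graphs, and each value is the first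
vertex of its component. If e v < v for a value v, then by induction e v is a fixed point, so e is
constant from e v to v; in particular v - 1 and v have the same value, and v is bad. -/
theorem Valid.apply_apply_of_not_bad {e : ℕ → ℕ} (he : Valid n e) (hb : ∀ v, ¬ Bad n e v) {k : ℕ}
    (hk : k < n) : e (e k) = e k := by
  suffices H : ∀ v k, k < n → e k = v → e v = v from H _ k hk rfl
  intro v
  induction v using Nat.strong_induction_on with
  | _ v ih =>
  intro k hk hkv
  have hvn : v < n := by have := he.le k hk; omega
  have hle := he.le v hvn
  by_contra hne
  refine hb v ⟨by omega, ⟨k, hk, hkv⟩, ?_⟩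
  have h1 := ih (e v) (by omega) v hvn rfl
  have h2 := he.mono (e v) (v - 1) (by omega) (by omega)
  have h3 := he.mono (v - 1) v (by omega) hvn
  omega

end ModularLaw

open MvPolynomial

/-! ### Inverse Demazure–Lusztig operators on polynomials over a domain -/

section DemazureLusztig

variable {R : Type*} [CommRing R]

/-- The exchange of `X_i` and `X_{i+1}`. -/
def sw (i : ℕ) : MvPolynomial ℕ R →ₐ[R] MvPolynomial ℕ R := rename (Equiv.swap i (i + 1))

@[simp] theorem sw_X_left (i : ℕ) : sw i (X i : MvPolynomial ℕ R) = X (i + 1) := by simp [sw]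

@[simp] theorem sw_X_right (i : ℕ) : sw i (X (i + 1) : MvPolynomial ℕ R) = X i := by simp [sw]

@[simp] theorem sw_C (i : ℕ) (a : R) : sw i (C a) = C a := by simp [sw]

theorem sw_X_of_ne {i j : ℕ} (h : j ≠ i) (h' : j ≠ i + 1) :
    sw i (X j : MvPolynomial ℕ R) = X j := by
  simp [sw, Equiv.swap_apply_of_ne_of_ne h h']

@[simp] theorem sw_sw (i : ℕ) (F : MvPolynomial ℕ R) : sw i (sw i F) = F := by
  simp only [sw, rename_rename]
  convert rename_id_apply F
  ext j; simp

theorem sw_braid (i : ℕ) (F : MvPolynomial ℕ R) :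
    sw i (sw (i + 1) (sw i F)) = sw (i + 1) (sw i (sw (i + 1) F)) := by
  simp only [sw, rename_rename]
  congr 2
  funext j
  simp only [Function.comp_apply, Equiv.swap_apply_def]
  split_ifs <;> omega

theorem sw_comm {i j : ℕ} (h : i + 1 < j) (F : MvPolynomial ℕ R) :
    sw i (sw j F) = sw j (sw i F) := by
  simp only [sw, rename_rename]
  congr 2
  funext k
  simp only [Function.comp_apply, Equiv.swap_apply_def]
  split_ifs <;> omega

theorem X_sub_dvd_sw_sub (i : ℕ) (F : MvPolynomial ℕ R) :
    (X (i + 1) - X i : MvPolynomial ℕ R) ∣ sw i F - F := by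
  induction F using MvPolynomial.induction_on with
  | C a => simp [sw]
  | add p q hp hq => rw [map_add, add_sub_add_comm]; exact dvd_add hp hq
  | mul_X p j hp =>
    have hX : (X (i + 1) - X i : MvPolynomial ℕ R) ∣ sw i (X j) - X j := by
      by_cases h : j = i
      · subst h; rw [sw_X_left]
      · by_cases h' : j = i + 1
        · subst h'; rw [sw_X_right]; exact ⟨-1, by ring⟩
        · rw [sw_X_of_ne h h', sub_self]; exact dvd_zero _
    rw [map_mul, show sw i p * sw i (X j) - p * X j =
      (sw i p - p) * sw i (X j) + p * (sw i (X j) - X j) by ring]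
    exact dvd_add (hp.mul_right _) (hX.mul_left _)

variable (τ : R)

/-- The right side is (τ X_{i+1} - X_i)(s_i F - F) + τ (X_{i+1} - X_i) F, and both terms are
divisible. No denominators are introduced, so the operators exist over any coefficient ring, as
integrality and specialization require. -/
theorem exists_theta (i : ℕ) (F : MvPolynomial ℕ R) : ∃ G : MvPolynomial ℕ R,
    (X (i + 1) - X i) * G = (C τ * X (i + 1) - X i) * sw i F + (1 - C τ) * X i * F := by
  obtain ⟨D, hD⟩ := X_sub_dvd_sw_sub i F
  exact ⟨(C τ * X (i + 1) - X i) * D + C τ * F, by linear_combination -(C τ * X (i + 1) - X i) * hD⟩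

theorem X_succ_sub_ne [Nontrivial R] (i : ℕ) : (X (i + 1) - X i : MvPolynomial ℕ R) ≠ 0 := by
  intro h
  have := X_injective (sub_eq_zero.1 h)
  omega

/-- The polynomial `T_i⁻¹ F`. -/
def thetaFun (i : ℕ) (F : MvPolynomial ℕ R) : MvPolynomial ℕ R := (exists_theta τ i F).choose

theorem thetaFun_spec (i : ℕ) (F : MvPolynomial ℕ R) :
    (X (i + 1) - X i) * thetaFun τ i F =
      (C τ * X (i + 1) - X i) * sw i F + (1 - C τ) * X i * F :=
  (exists_theta τ i F).choose_spec

variable (R) in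
/-- The embedding into the field of fractions. -/
abbrev toFr : MvPolynomial ℕ R →+* FractionRing (MvPolynomial ℕ R) := algebraMap _ _

theorem toFr_inj {F G : MvPolynomial ℕ R} (h : toFr R F = toFr R G) : F = G :=
  IsFractionRing.injective (MvPolynomial ℕ R) (FractionRing (MvPolynomial ℕ R)) h

theorem toFr_ne {F : MvPolynomial ℕ R} (h : F ≠ 0) : toFr R F ≠ 0 :=
  fun h0 => h (toFr_inj (h0.trans (map_zero _).symm))

variable [IsDomain R]

/-- The inverse of the Demazure–Lusztig operator `T_i` on polynomials, with `τ = t⁻¹`. -/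
def theta (i : ℕ) : MvPolynomial ℕ R →ₗ[R] MvPolynomial ℕ R where
  toFun := thetaFun τ i
  map_add' F G := by
    apply mul_left_cancel₀ (X_succ_sub_ne i)
    rw [mul_add, thetaFun_spec, thetaFun_spec, thetaFun_spec, map_add]
    ring
  map_smul' c F := by
    apply mul_left_cancel₀ (X_succ_sub_ne i)
    rw [RingHom.id_apply, mul_smul_comm, thetaFun_spec, thetaFun_spec, map_smul, smul_add,
      mul_smul_comm, mul_smul_comm]

theorem theta_spec (i : ℕ) (F : MvPolynomial ℕ R) :
    (X (i + 1) - X i) * theta τ i F =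
      (C τ * X (i + 1) - X i) * sw i F + (1 - C τ) * X i * F :=
  thetaFun_spec τ i F

variable {τ}

theorem theta_eq_of {i : ℕ} {F G : MvPolynomial ℕ R}
    (h : (X (i + 1) - X i) * G = (C τ * X (i + 1) - X i) * sw i F + (1 - C τ) * X i * F) :
    theta τ i F = G :=
  mul_left_cancel₀ (X_succ_sub_ne i) ((theta_spec τ i F).trans h.symm)

theorem theta_mul {i : ℕ} {f : MvPolynomial ℕ R} (hf : sw i f = f) (F : MvPolynomial ℕ R) :
    theta τ i (f * F) = f * theta τ i F := by
  apply theta_eq_of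
  rw [map_mul, hf]
  linear_combination f * theta_spec τ i F

theorem theta_of_sw {i : ℕ} {F : MvPolynomial ℕ R} (h : sw i F = F) : theta τ i F = τ • F := by
  apply theta_eq_of
  rw [h, smul_eq_C_mul]; ring

/-- The eigenvalue equation reads (τ X_{i+1} - X_i)(s_i F - F) = 0, and the first factor is nonzero
for every τ because X_i has coefficient -1. -/
theorem sw_of_theta {i : ℕ} {F : MvPolynomial ℕ R} (h : theta τ i F = τ • F) : sw i F = F := by
  have h1 := theta_spec τ i F
  rw [h, smul_eq_C_mul] at h1
  have hne : (C τ * X (i + 1) - X i : MvPolynomial ℕ R) ≠ 0 := by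
    intro h0
    have := congrArg (coeff (Finsupp.single i 1)) h0
    rw [coeff_sub, coeff_C_mul, coeff_X, coeff_X, if_neg, if_pos rfl] at this
    · simp at this
    · intro h; simpa using DFunLike.congr_fun h i
  apply mul_left_cancel₀ hne
  linear_combination -h1

/-- The defining equation of `theta` in the field of fractions. -/
theorem frac_theta {a b P f g : MvPolynomial ℕ R} (ha : a ≠ 0)
    (h : (b - a) * P = (C τ * b - a) * g + (1 - C τ) * a * f) :
    (1 - toFr R b / toFr R a) * toFr R P = (toFr R (C τ) - 1) * toFr R f +
        (1 - toFr R (C τ) * (toFr R b / toFr R a)) * toFr R g := by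
  have ha' := toFr_ne ha
  have h' := congrArg (toFr R) h
  simp only [map_add, map_sub, map_mul, map_one] at h'
  field_simp
  linear_combination -h'

theorem frac_ratio_ne {i j : ℕ} (h : i ≠ j) : 1 - toFr R (X i) / toFr R (X j) ≠ 0 := by
  have hj : toFr R (X j) ≠ 0 := toFr_ne (X_ne_zero j)
  rw [one_sub_div hj, div_ne_zero_iff]
  refine ⟨?_, hj⟩
  rw [sub_ne_zero]
  intro h0
  exact h (X_injective (toFr_inj h0)).symm

/-- Divided by X_i, the defining equation of θ_i has the shape of that of T_i, with τ for t and
X_{i+1}/X_i for X_i/X_{i+1}. Hence the field identities behind the Hecke relations apply again, here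
and for the two relations below. -/
theorem theta_theta (i : ℕ) (F : MvPolynomial ℕ R) :
    theta τ i (theta τ i F) = (τ - 1) • theta τ i F + τ • F := by
  have h1 := theta_spec τ i F
  have h2 := congrArg (sw i) h1
  have h3 := theta_spec τ i (theta τ i F)
  simp only [map_mul, map_sub, map_add, map_one, sw_sw, sw_X_left, sw_X_right, sw_C] at h2
  apply toFr_inj
  simp only [smul_eq_C_mul, map_add, map_mul, map_sub, map_one]
  refine field_quad (frac_ratio_ne (by omega : i + 1 ≠ i)) ?_
    (frac_theta (X_ne_zero i) h1) (frac_theta (X_ne_zero (i + 1)) h2) (frac_theta (X_ne_zero i) h3)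
  rw [div_mul_div_comm, mul_comm, div_self]
  exact mul_ne_zero (toFr_ne (X_ne_zero _)) (toFr_ne (X_ne_zero _))

theorem theta_comm {i j : ℕ} (h : i + 1 < j) (F : MvPolynomial ℕ R) :
    theta τ i (theta τ j F) = theta τ j (theta τ i F) := by
  have h1 := theta_spec τ j F
  have h2 := congrArg (sw i) h1
  have h3 := theta_spec τ i (theta τ j F)
  have k1 := theta_spec τ i F
  have k2 := congrArg (sw j) k1
  have k3 := theta_spec τ j (theta τ i F)
  simp only [map_mul, map_sub, map_add, map_one, sw_C, sw_comm h] at h2 k2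
  rw [sw_X_of_ne (by omega) (by omega), sw_X_of_ne (by omega) (by omega)] at h2 k2
  apply toFr_inj
  exact field_comm (frac_ratio_ne (by omega : i + 1 ≠ i)) (frac_ratio_ne (by omega : j + 1 ≠ j))
    (frac_theta (X_ne_zero _) h1) (frac_theta (X_ne_zero _) h2) (frac_theta (X_ne_zero _) h3)
    (frac_theta (X_ne_zero _) k1) (frac_theta (X_ne_zero _) k2) (frac_theta (X_ne_zero _) k3)

theorem theta_braid (i : ℕ) (F : MvPolynomial ℕ R) :
    theta τ i (theta τ (i + 1) (theta τ i F)) =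
      theta τ (i + 1) (theta τ i (theta τ (i + 1) F)) := by
  have h1 := theta_spec τ i F
  have h2 := congrArg (sw i) h1
  have h3 := congrArg (sw (i + 1)) h1
  have h4 := congrArg (sw i) h3
  have h5 := theta_spec τ (i + 1) (theta τ i F)
  have h6 := congrArg (sw i) h5
  have h7 := theta_spec τ i (theta τ (i + 1) (theta τ i F))
  have k1 := theta_spec τ (i + 1) F
  have k2 := congrArg (sw (i + 1)) k1
  have k3 := congrArg (sw i) k1
  have k4 := congrArg (sw (i + 1)) k3
  have k5 := theta_spec τ i (theta τ (i + 1) F)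
  have k6 := congrArg (sw (i + 1)) k5
  have k7 := theta_spec τ (i + 1) (theta τ i (theta τ (i + 1) F))
  have e1 : sw (i + 1) (X i : MvPolynomial ℕ R) = X i := sw_X_of_ne (by omega) (by omega)
  have e2 : sw i (X (i + 1 + 1) : MvPolynomial ℕ R) = X (i + 1 + 1) :=
    sw_X_of_ne (by omega) (by omega)
  simp only [map_mul, map_sub, map_add, map_one, sw_C, sw_sw, sw_X_left, sw_X_right, e1, e2]
    at h2 h3 h4 h6 k2 k3 k4 k6
  rw [← sw_braid] at k4
  have hne : ∀ j, toFr R (X j) ≠ 0 := fun j => toFr_ne (X_ne_zero j)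
  have huv : toFr R (X (i + 1)) / toFr R (X i) * (toFr R (X (i + 1 + 1)) / toFr R (X (i + 1))) =
      toFr R (X (i + 1 + 1)) / toFr R (X i) := by
    rw [mul_comm, div_mul_div_cancel₀ (hne _)]
  have H3 := frac_theta (X_ne_zero _) h3
  have H6 := frac_theta (X_ne_zero _) h6
  have K3 := frac_theta (X_ne_zero _) k3
  have K6 := frac_theta (X_ne_zero _) k6
  rw [← huv] at H3 H6 K3 K6
  have H2 := frac_theta (X_ne_zero _) h2
  have K2 := frac_theta (X_ne_zero _) k2
  rw [← inv_div] at H2 K2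
  apply toFr_inj
  refine field_braid (frac_ratio_ne (by omega : i + 1 ≠ i))
    (frac_ratio_ne (by omega : i + 1 + 1 ≠ i + 1)) ?_ (div_ne_zero (hne _) (hne _))
    (div_ne_zero (hne _) (hne _)) (frac_theta (X_ne_zero _) h1) H2 H3
    (frac_theta (X_ne_zero _) h4) (frac_theta (X_ne_zero _) h5) H6 (frac_theta (X_ne_zero _) h7)
    (frac_theta (X_ne_zero _) k1) K2 K3 (frac_theta (X_ne_zero _) k4)
    (frac_theta (X_ne_zero _) k5) K6 (frac_theta (X_ne_zero _) k7)
  rw [huv]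
  exact frac_ratio_ne (by omega)

/-- `theta` commutes with ring homomorphisms that intertwine the variables and the exchanges. -/
theorem map_theta {R' : Type*} [CommRing R'] [IsDomain R'] {τ' : R'} {i j : ℕ}
    (φ : MvPolynomial ℕ R →+* MvPolynomial ℕ R') (hτ : φ (C τ) = C τ')
    {c : MvPolynomial ℕ R'} (hc : c ≠ 0)
    (h0 : φ (X i) = c * X j) (h1 : φ (X (i + 1)) = c * X (j + 1))
    {F : MvPolynomial ℕ R} (h : φ (sw i F) = sw j (φ F)) :
    φ (theta τ i F) = theta τ' j (φ F) := by
  symm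
  apply theta_eq_of
  have := congrArg φ (theta_spec τ i F)
  simp only [map_mul, map_sub, map_add, map_one, hτ, h0, h1, h] at this
  apply mul_left_cancel₀ hc
  linear_combination this

theorem algHom_theta {i j : ℕ} (φ : MvPolynomial ℕ R →ₐ[R] MvPolynomial ℕ R)
    {c : MvPolynomial ℕ R} (hc : c ≠ 0)
    (h0 : φ (X i) = c * X j) (h1 : φ (X (i + 1)) = c * X (j + 1))
    {F : MvPolynomial ℕ R} (h : φ (sw i F) = sw j (φ F)) :
    φ (theta τ i F) = theta τ j (φ F) :=
  map_theta (φ : MvPolynomial ℕ R →+* MvPolynomial ℕ R) (φ.commutes τ) hc h0 h1 h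

end DemazureLusztig

/-! ### Partial symmetrizers and their effect on invariants and anti-invariants -/

section Symmetrizers

variable {R : Type*} [CommRing R] [IsDomain R] (τ : R)

/-- The product `θ_{s+k-1} ⋯ θ_{s+1} θ_s`. -/
def thetaProd (s : ℕ) : ℕ → MvPolynomial ℕ R →ₗ[R] MvPolynomial ℕ R
  | 0 => LinearMap.id
  | k + 1 => theta τ (s + k) ∘ₗ thetaProd s k

/-- The sum of the first `N` of the products `θ_{s+k-1} ⋯ θ_s`. -/
def thetaSum (s N : ℕ) : MvPolynomial ℕ R →ₗ[R] MvPolynomial ℕ R :=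
  ∑ k ∈ Finset.range N, thetaProd τ s k

variable {τ}

theorem thetaProd_zero (s : ℕ) (F : MvPolynomial ℕ R) : thetaProd τ s 0 F = F := rfl

theorem thetaProd_succ (s k : ℕ) (F : MvPolynomial ℕ R) :
    thetaProd τ s (k + 1) F = theta τ (s + k) (thetaProd τ s k F) := rfl

theorem thetaSum_zero (s : ℕ) (F : MvPolynomial ℕ R) : thetaSum τ s 0 F = 0 := by
  simp [thetaSum]

theorem thetaSum_succ (s N : ℕ) (F : MvPolynomial ℕ R) :
    thetaSum τ s (N + 1) F = thetaSum τ s N F + thetaProd τ s N F := by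
  simp [thetaSum, Finset.sum_range_succ]

theorem thetaSum_apply (s N : ℕ) (F : MvPolynomial ℕ R) :
    thetaSum τ s N F = ∑ k ∈ Finset.range N, thetaProd τ s k F := by
  simp [thetaSum]

theorem thetaProd_succ' (s k : ℕ) (F : MvPolynomial ℕ R) :
    thetaProd τ s (k + 1) F = thetaProd τ (s + 1) k (theta τ s F) := by
  induction k with
  | zero => rfl
  | succ k ih => rw [thetaProd_succ, ih, thetaProd_succ, add_right_comm, add_assoc]

theorem theta_thetaProd_of_lt {s k i : ℕ} (h : s + k < i) (F : MvPolynomial ℕ R) :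
    theta τ i (thetaProd τ s k F) = thetaProd τ s k (theta τ i F) := by
  induction k with
  | zero => rfl
  | succ k ih =>
    rw [thetaProd_succ, thetaProd_succ, ← theta_comm (by omega), ih (by omega)]

/-- One braid relation at the place where the product contains θ_{s+i+1} θ_{s+i}; the remaining
factors commute. -/
theorem theta_thetaProd {s k i : ℕ} (h : i + 2 ≤ k) (F : MvPolynomial ℕ R) :
    theta τ (s + i) (thetaProd τ s k F) = thetaProd τ s k (theta τ (s + i + 1) F) := by
  induction k, h using Nat.le_induction with
  | base =>
    simp only [thetaProd_succ]
    rw [← add_assoc, theta_braid, theta_thetaProd_of_lt (by omega)]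
  | succ k hk ih =>
    rw [thetaProd_succ, thetaProd_succ, theta_comm (by omega), ih]

theorem thetaProd_thetaProd {k N : ℕ} (h : k < N) (F : MvPolynomial ℕ R) :
    thetaProd τ 0 N (thetaProd τ 1 k F) = thetaProd τ 0 k (thetaProd τ 0 N F) := by
  induction k with
  | zero => rfl
  | succ k ih =>
    have := theta_thetaProd (τ := τ) (s := 0) (k := N) (i := k) (by omega) (thetaProd τ 1 k F)
    rw [thetaProd_succ, thetaProd_succ, ← ih (by omega), this, zero_add, add_comm]

theorem thetaProd_thetaSum {K N : ℕ} (h : K ≤ N) (F : MvPolynomial ℕ R) :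
    thetaProd τ 0 N (thetaSum τ 1 K F) = thetaSum τ 0 K (thetaProd τ 0 N F) := by
  rw [thetaSum_apply, thetaSum_apply, map_sum]
  refine Finset.sum_congr rfl fun k hk => thetaProd_thetaProd ?_ F
  rw [Finset.mem_range] at hk; omega

/-- The partial symmetrizer produces invariants of `θ_0, …, θ_{N-2}`. -/
theorem theta_thetaSum_of_inv {N : ℕ} {F : MvPolynomial ℕ R}
    (hF : ∀ i, 1 ≤ i → i + 1 < N → theta τ i F = τ • F) {i : ℕ} (hi : i + 1 < N) :
    theta τ i (thetaSum τ 0 N F) = τ • thetaSum τ 0 N F := by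
  rw [← sub_eq_zero, thetaSum_apply, map_sum, Finset.smul_sum, ← Finset.sum_sub_distrib]
  -- For k < i the operator passes through the product to F, and for k > i + 1 it passes as θ_{i+1};
  -- both act on F by τ. The terms k = i and k = i + 1 are exchanged and cancel by the quadratic
  -- relation.
  have key : ∀ k ∈ Finset.range N,
      theta τ i (thetaProd τ 0 k F) - τ • thetaProd τ 0 k F =
      (if k = i then thetaProd τ 0 (i + 1) F - τ • thetaProd τ 0 i F else 0) -
        (if k = i + 1 then thetaProd τ 0 (i + 1) F - τ • thetaProd τ 0 i F else 0) := by
    intro k hk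
    rw [Finset.mem_range] at hk
    rcases lt_trichotomy k i with h | h | h
    · rw [if_neg (by omega), if_neg (by omega), theta_thetaProd_of_lt (by omega),
        hF i (by omega) hi, map_smul, sub_self, sub_self]
    · subst h
      rw [if_pos rfl, if_neg (by omega), thetaProd_succ, zero_add, sub_zero]
    · rw [if_neg (by omega)]
      by_cases h' : k = i + 1
      · subst h'
        rw [if_pos rfl, thetaProd_succ, zero_add, theta_theta, sub_smul, one_smul]
        abel
      · have := theta_thetaProd (τ := τ) (s := 0) (k := k) (i := i) (by omega) F
        simp only [zero_add] at this
        rw [if_neg h', this, hF (i + 1) (by omega) (by omega), map_smul, sub_self, sub_self]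
  rw [Finset.sum_congr rfl key, Finset.sum_sub_distrib, Finset.sum_ite_eq', Finset.sum_ite_eq',
    if_pos (by simp; omega), if_pos (by simp; omega), sub_self]

theorem theta_thetaSum_of_lt {s N i : ℕ} (h : s + N ≤ i) (F : MvPolynomial ℕ R) :
    theta τ i (thetaSum τ s N F) = thetaSum τ s N (theta τ i F) := by
  rw [thetaSum_apply, thetaSum_apply, map_sum]
  refine Finset.sum_congr rfl fun k hk => theta_thetaProd_of_lt ?_ F
  rw [Finset.mem_range] at hk; omega

/-- The long product passes to the right of the symmetrizer, lowering its indices, and its first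
factor θ_0 then acts on Z by τ. -/
theorem thetaProd_thetaSum_of_inv {N : ℕ} {Z : MvPolynomial ℕ R} (hZ : theta τ 0 Z = τ • Z) :
    thetaProd τ 0 (N + 1) (thetaSum τ 1 (N + 1) Z) =
      τ • thetaSum τ 0 (N + 1) (thetaProd τ 1 N Z) := by
  rw [thetaProd_thetaSum le_rfl, thetaProd_succ', hZ, map_smul, map_smul]

/-- Raising N by one adds the last term of the inner sum and the last term of the outer sum. After
the long product is moved to the right, the outer one contains θ_0 Z = -Z and cancels the inner one.
-/
theorem thetaSum_thetaSum_of_anti {N : ℕ} {Z : MvPolynomial ℕ R} (hZ : theta τ 0 Z = -Z) :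
    thetaSum τ 0 (N + 1) (thetaSum τ 1 N Z) = 0 := by
  induction N with
  | zero => simp [thetaSum_zero]
  | succ N ih =>
    rw [thetaSum_succ 0 (N + 1), thetaProd_thetaSum le_rfl, thetaProd_succ', hZ, map_neg, map_neg,
      thetaSum_succ 1 N, map_add, ih]
    simp

end Symmetrizers

/-! ### The operator Π on polynomials -/

section Rotation

variable {R : Type*} [CommRing R] (p : R) (m : ℕ)

/-- The substitution `F(X_0, …, X_{m-1}) ↦ F(X_1, …, X_{m-1}, p X_0)`. -/
def cyc : MvPolynomial ℕ R →ₐ[R] MvPolynomial ℕ R :=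
  aeval fun j => if j + 1 < m then X (j + 1) else if j + 1 = m then C p * X 0 else X j

/-- The operator `Π`. -/
def rot : MvPolynomial ℕ R →ₗ[R] MvPolynomial ℕ R :=
  LinearMap.mulLeft R (X 0) ∘ₗ (cyc p m).toLinearMap

variable {p m}

theorem rot_apply (F : MvPolynomial ℕ R) : rot p m F = X 0 * cyc p m F := rfl

theorem cyc_X (j : ℕ) : cyc p m (X j) =
    if j + 1 < m then X (j + 1) else if j + 1 = m then C p * X 0 else X j := by
  simp [cyc]

theorem cyc_X_of_lt {j : ℕ} (h : j + 1 < m) : cyc p m (X j) = X (j + 1) := by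
  rw [cyc_X, if_pos h]

theorem cyc_X_last {j : ℕ} (h : j + 1 = m) : cyc p m (X j) = C p * X 0 := by
  rw [cyc_X, if_neg (by omega), if_pos h]

theorem cyc_X_of_le {j : ℕ} (h : m ≤ j) : cyc p m (X j) = X j := by
  rw [cyc_X, if_neg (by omega), if_neg (by omega)]

@[simp] theorem cyc_C (c : R) : cyc p m (C c) = C c := by
  simp [cyc]

theorem cyc_sw {i : ℕ} (h : i + 2 < m) (F : MvPolynomial ℕ R) :
    cyc p m (sw i F) = sw (i + 1) (cyc p m F) := by
  have : (cyc p m).comp (sw i) = (sw (i + 1)).comp (cyc p m) := by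
    apply algHom_ext
    intro j
    simp only [AlgHom.comp_apply]
    by_cases h1 : j = i
    · subst h1
      rw [sw_X_left, cyc_X_of_lt (by omega), cyc_X_of_lt (by omega), sw_X_left]
    by_cases h2 : j = i + 1
    · subst h2
      rw [sw_X_right, cyc_X_of_lt (by omega), cyc_X_of_lt (by omega), sw_X_right]
    rw [sw_X_of_ne h1 h2, cyc_X]
    split_ifs
    · rw [sw_X_of_ne (by omega) (by omega)]
    · rw [map_mul, sw_C, sw_X_of_ne (by omega) (by omega)]
    · rw [sw_X_of_ne (by omega) (by omega)]
  exact congrArg (fun f => f F) this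

theorem cyc_cyc_sw {i : ℕ} (h : i + 2 = m) (F : MvPolynomial ℕ R) :
    cyc p m (cyc p m (sw i F)) = sw 0 (cyc p m (cyc p m F)) := by
  have : ((cyc p m).comp (cyc p m)).comp (sw i) = (sw 0).comp ((cyc p m).comp (cyc p m)) := by
    apply algHom_ext
    intro j
    simp only [AlgHom.comp_apply]
    have g1 : cyc p m (cyc p m (X i)) = C p * X 0 := by
      rw [cyc_X_of_lt (by omega), cyc_X_last (by omega)]
    have g2 : cyc p m (cyc p m (X (i + 1))) = C p * X 1 := by
      rw [cyc_X_last (by omega), map_mul, cyc_C, cyc_X_of_lt (by omega)]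
    by_cases h1 : j = i
    · subst h1
      rw [sw_X_left, g1, g2, map_mul, sw_C, sw_X_left]
    by_cases h2 : j = i + 1
    · subst h2
      rw [sw_X_right, g1, g2, map_mul, sw_C, show (1 : ℕ) = 0 + 1 from rfl, sw_X_right]
    rw [sw_X_of_ne h1 h2]
    by_cases h3 : j < i
    · rw [cyc_X_of_lt (by omega), cyc_X_of_lt (by omega), sw_X_of_ne (by omega) (by omega)]
    · rw [cyc_X_of_le (by omega), cyc_X_of_le (by omega), sw_X_of_ne (by omega) (by omega)]
  exact congrArg (fun f => f F) this

variable [IsDomain R] {τ : R}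

theorem rot_theta {i : ℕ} (h : i + 2 < m) (F : MvPolynomial ℕ R) :
    rot p m (theta τ i F) = theta τ (i + 1) (rot p m F) := by
  rw [rot_apply, rot_apply, theta_mul (sw_X_of_ne (by omega) (by omega))]
  congr 1
  exact algHom_theta (cyc p m) one_ne_zero (by rw [cyc_X_of_lt (by omega), one_mul])
    (by rw [cyc_X_of_lt (by omega), one_mul]) (cyc_sw h F)

/-- Two rotations carry the last finite generator to the first one, past the affine generator, which
therefore need not act on polynomials. The variables X_{m-2}, X_{m-1} go to p X_0, p X_1, the common
factor p drops out of the equation of θ_0, and the prefactor X_0 X_1 is symmetric. -/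
theorem rot_rot_theta (hp : p ≠ 0) {i : ℕ} (h : i + 2 = m) (F : MvPolynomial ℕ R) :
    rot p m (rot p m (theta τ i F)) = theta τ 0 (rot p m (rot p m F)) := by
  have e : ∀ G : MvPolynomial ℕ R, rot p m (rot p m G) = (X 0 * X 1) * cyc p m (cyc p m G) := by
    intro G
    rw [rot_apply, rot_apply, map_mul, cyc_X_of_lt (by omega), mul_assoc]
  rw [e, e, theta_mul]
  · congr 1
    have hF : ((cyc p m).comp (cyc p m)) (sw i F) = sw 0 (((cyc p m).comp (cyc p m)) F) := by
      rw [AlgHom.comp_apply, AlgHom.comp_apply, cyc_cyc_sw h]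
    have key := algHom_theta (τ := τ) ((cyc p m).comp (cyc p m)) (C_ne_zero.2 hp) ?_ ?_ hF
    · rwa [AlgHom.comp_apply, AlgHom.comp_apply] at key
    · rw [AlgHom.comp_apply, cyc_X_of_lt (by omega), cyc_X_last (by omega)]
    · rw [AlgHom.comp_apply, cyc_X_last (by omega), map_mul, cyc_C, cyc_X_of_lt (by omega)]
  · rw [map_mul, show (1 : ℕ) = 0 + 1 from rfl, sw_X_left, sw_X_right, mul_comm]

theorem rot_thetaProd {s k : ℕ} (h : s + k + 1 < m ∨ k = 0) (F : MvPolynomial ℕ R) :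
    rot p m (thetaProd τ s k F) = thetaProd τ (s + 1) k (rot p m F) := by
  induction k with
  | zero => rfl
  | succ k ih =>
    rw [thetaProd_succ, thetaProd_succ, rot_theta (by omega), ih (by omega), add_right_comm]

theorem rot_thetaSum {s N : ℕ} (h : s + N < m) (F : MvPolynomial ℕ R) :
    rot p m (thetaSum τ s N F) = thetaSum τ (s + 1) N (rot p m F) := by
  rw [thetaSum_apply, thetaSum_apply, map_sum]
  refine Finset.sum_congr rfl fun k hk => rot_thetaProd ?_ F
  rw [Finset.mem_range] at hk; omega

end Rotation

/-! ### Products of vertex operators: invariance and the modular law -/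

section Chain

variable {R : Type*} [CommRing R] [IsDomain R] (t τ p : R) (m : ℕ)

/-- The operator by which a vertex with `b` edges to the left acts. -/
def step (b : ℕ) : MvPolynomial ℕ R →ₗ[R] MvPolynomial ℕ R :=
  t ^ (m - 1) • (thetaSum τ 0 (m - b) ∘ₗ rot p m)

/-- The product of the operators `step (a 0) ⋯ step (a (k - 1))`. -/
def chain (a : ℕ → ℕ) : ℕ → MvPolynomial ℕ R →ₗ[R] MvPolynomial ℕ R
  | 0 => LinearMap.id
  | k + 1 => chain a k ∘ₗ step t τ p m (a k)

variable {t τ p m}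

theorem step_apply (b : ℕ) (F : MvPolynomial ℕ R) :
    step t τ p m b F = t ^ (m - 1) • thetaSum τ 0 (m - b) (rot p m F) := rfl

theorem chain_zero (a : ℕ → ℕ) (F : MvPolynomial ℕ R) : chain t τ p m a 0 F = F := rfl

theorem chain_succ (a : ℕ → ℕ) (k : ℕ) (F : MvPolynomial ℕ R) :
    chain t τ p m a (k + 1) F = chain t τ p m a k (step t τ p m (a k) F) := rfl

theorem chain_add (a : ℕ → ℕ) (k l : ℕ) (F : MvPolynomial ℕ R) :
    chain t τ p m a (k + l) F = chain t τ p m a k (chain t τ p m (fun s => a (k + s)) l F) := by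
  induction l generalizing F with
  | zero => rfl
  | succ l ih => rw [← add_assoc, chain_succ, ih, chain_succ]

theorem chain_succ' (a : ℕ → ℕ) (k : ℕ) (F : MvPolynomial ℕ R) :
    chain t τ p m a (k + 1) F =
      step t τ p m (a 0) (chain t τ p m (fun s => a (s + 1)) k F) := by
  rw [add_comm k 1, chain_add]
  simp only [add_comm 1]
  rfl

theorem chain_congr {a b : ℕ → ℕ} {k : ℕ} (h : ∀ i < k, a i = b i) (F : MvPolynomial ℕ R) :
    chain t τ p m a k F = chain t τ p m b k F := by
  induction k generalizing F with
  | zero => rfl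
  | succ k ih =>
    rw [chain_succ, chain_succ, h k (Nat.lt_succ_self k), ih fun i hi => h i (by omega)]

theorem step_of_le {b : ℕ} (h : m ≤ b) (F : MvPolynomial ℕ R) : step t τ p m b F = 0 := by
  rw [step_apply, Nat.sub_eq_zero_of_le h, thetaSum_zero, smul_zero]

theorem rot_inv {i : ℕ} (h : i + 2 < m) {F : MvPolynomial ℕ R} (hF : theta τ i F = τ • F) :
    theta τ (i + 1) (rot p m F) = τ • rot p m F := by
  rw [← rot_theta h, hF, map_smul]

/-- Rotation raises the indices of the invariance by one, and the partial symmetrizer adds the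
missing index 0. -/
theorem step_inv {b : ℕ} {F : MvPolynomial ℕ R}
    (hF : ∀ i, i + b + 2 < m → theta τ i F = τ • F) {i : ℕ} (hi : i + 1 + b < m) :
    theta τ i (step t τ p m b F) = τ • step t τ p m b F := by
  rw [step_apply, map_smul, theta_thetaSum_of_inv ?_ (by omega), smul_comm]
  intro j h1 h2
  obtain ⟨j, rfl⟩ : ∃ j', j = j' + 1 := ⟨j - 1, by omega⟩
  exact rot_inv (by omega) (hF j (by omega))

theorem theta_one (i : ℕ) : theta τ i (1 : MvPolynomial ℕ R) = τ • 1 :=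
  theta_of_sw (map_one _)

/-- The growth condition is monotonicity of e. It makes the remaining chain invariant in the range
that `step_inv` needs; for a 0 = 0 the outcome is invariance under all of θ_0, …, θ_{m-2}. -/
theorem theta_chain {a : ℕ → ℕ} (ha : ∀ i, a (i + 1) ≤ a i + 1) {k i : ℕ}
    (hi : i + 1 + a 0 < m) :
    theta τ i (chain t τ p m a k 1) = τ • chain t τ p m a k 1 := by
  induction k generalizing a i with
  | zero => exact theta_one i
  | succ k ih =>
    rw [chain_succ']
    refine step_inv (fun j hj => ih (fun i => ha (i + 1)) ?_) hi
    have := ha 0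
    simp only [zero_add] at this ⊢
    omega

/-- Beyond the range of `theta_chain`, θ_i commutes with the first symmetrizer and passes through
the rotation as θ_{i-1}, while x grows by one. The excluded value a 0 = x + 1 is the only one for
which neither argument applies. For x = 0 the exclusion says that no later vertex separates the two
vertices just before the chain. -/
theorem theta_chain_of_ne {a : ℕ → ℕ} (ha : ∀ i, a (i + 1) ≤ a i + 1) {k x i : ℕ}
    (hx : i + 2 + x = m) (h : ∀ s < k, a s ≠ s + 1 + x) :
    theta τ i (chain t τ p m a k 1) = τ • chain t τ p m a k 1 := by
  induction k generalizing a x i with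
  | zero => exact theta_one i
  | succ k ih =>
    have h0 := h 0 (by omega)
    rcases Nat.lt_or_ge x (a 0) with hlt | hle
    · rw [chain_succ']
      by_cases hm : m ≤ a 0
      · rw [step_of_le hm, map_zero, smul_zero]
      · obtain ⟨i, rfl⟩ : ∃ i', i = i' + 1 := ⟨i - 1, by omega⟩
        rw [step_apply, map_smul, theta_thetaSum_of_lt (by omega), rot_inv (by omega), map_smul,
          smul_comm]
        refine ih (a := fun s => a (s + 1)) (x := x + 1) (fun i => ha (i + 1)) (by omega)
          fun s hs => ?_
        have := h (s + 1) (by omega)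
        omega
    · exact theta_chain ha (by omega)

/-- After both rotations are moved to the right, only symmetrizers of neighbouring lengths are
compared. Their differences are single products, which agree by `thetaProd_thetaSum_of_inv` and t τ
= 1. -/
theorem step_step_modular (htτ : t * τ = 1) {b : ℕ} (hb : b + 1 ≤ m) {F : MvPolynomial ℕ R}
    (hm : theta τ 0 (rot p m (rot p m F)) = τ • rot p m (rot p m F)) :
    (1 + t) • step t τ p m (b + 1) (step t τ p m (b + 1) F) =
      t • step t τ p m b (step t τ p m (b + 1) F) +
        step t τ p m (b + 1) (step t τ p m (b + 2) F) := by
  obtain ⟨N, rfl⟩ : ∃ N, m = N + b + 1 := ⟨m - b - 1, by omega⟩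
  simp only [step_apply, map_smul]
  rw [show N + b + 1 - (b + 1) = N by omega, show N + b + 1 - b = N + 1 by omega]
  rw [rot_thetaSum (by omega), rot_thetaSum (by omega), zero_add, thetaSum_succ]
  cases N with
  | zero => simp [thetaSum_zero, thetaProd_zero]
  | succ N =>
    rw [show N + 1 + b + 1 - (b + 2) = N by omega, thetaProd_thetaSum_of_inv hm,
      thetaSum_succ 1 N, map_add]
    have : t • τ • thetaSum τ 0 (N + 1) (thetaProd τ 1 N
        (rot p (N + 1 + b + 1) (rot p (N + 1 + b + 1) F))) =
      thetaSum τ 0 (N + 1) (thetaProd τ 1 N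
        (rot p (N + 1 + b + 1) (rot p (N + 1 + b + 1) F))) := by
      rw [smul_smul, htτ, one_smul]
    rw [smul_comm t, smul_comm t, smul_add t _ (τ • _), this, smul_comm (1 + t), smul_comm (1 + t)]
    simp only [← smul_add]
    congr 2
    rw [add_smul, one_smul]
    simp only [smul_add]
    abel

theorem step_of_anti {b j : ℕ} (hj : j + 2 < m) (hb : m ≤ j + 1 + b) {Z : MvPolynomial ℕ R}
    (hZ : theta τ j Z = -Z) : theta τ (j + 1) (step t τ p m b Z) = -step t τ p m b Z := by
  rw [step_apply, map_smul, theta_thetaSum_of_lt (by omega), ← rot_theta hj, hZ, map_neg, map_neg,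
    smul_neg]

theorem step_step_of_anti (hp : p ≠ 0) {b j : ℕ} (hj : j + 2 = m) {Z : MvPolynomial ℕ R}
    (hZ : theta τ j Z = -Z) : step t τ p m b (step t τ p m (b + 1) Z) = 0 := by
  by_cases hb : m ≤ b
  · exact step_of_le hb _
  have h : theta τ 0 (rot p m (rot p m Z)) = -rot p m (rot p m Z) := by
    rw [← rot_rot_theta hp hj, hZ, map_neg, map_neg]
  simp only [step_apply, map_smul]
  obtain ⟨N, hN⟩ : ∃ N, m - b = N + 1 := ⟨m - b - 1, by omega⟩
  rw [hN, show m - (b + 1) = N by omega, rot_thetaSum (by omega), zero_add,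
    thetaSum_thetaSum_of_anti h, smul_zero, smul_zero]

/-- The s vertices after c + 1 are adjacent to both c and c + 1, so their symmetrizers are short
enough to commute with θ. Each transports the anti-invariance one index up, until it reaches m - 2.
There the vertices c and c + 1, which have the same left neighbours, annihilate it by
`step_step_of_anti`. -/
theorem chain_of_anti (hp : p ≠ 0) {a : ℕ → ℕ} {c : ℕ} (hc : a (c + 1) = a c + 1) {s j : ℕ}
    (hj : j + 2 + s = m) (ha : ∀ x < s, x + 2 ≤ a (c + 2 + x)) {Z : MvPolynomial ℕ R}
    (hZ : theta τ j Z = -Z) : chain t τ p m a (c + 2 + s) Z = 0 := by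
  induction s generalizing j Z with
  | zero =>
    rw [add_zero, chain_succ, chain_succ, hc, step_step_of_anti hp hj hZ, map_zero]
  | succ s ih =>
    rw [← add_assoc, chain_succ]
    have := ha s (by omega)
    exact ih (j := j + 1) (by omega) (fun x hx => ha x (by omega))
      (step_of_anti (by omega) (by omega) hZ)

/-- The three symmetrizers differ by Y and θ_N Y, where Y is one product applied to the rotated F.
The relation amounts to the chain killing θ_N Y - τ Y, and this element is anti-invariant by the
quadratic relation. -/
theorem chain_modular (htτ : t * τ = 1) (hp : p ≠ 0) {a : ℕ → ℕ} {c s : ℕ}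
    (hc : a (c + 1) = a c + 1) (ha : ∀ x < s, x + 2 ≤ a (c + 2 + x)) (F : MvPolynomial ℕ R) :
    (1 + t) • chain t τ p m a (c + 2 + s) (step t τ p m (s + 1) F) =
      t • chain t τ p m a (c + 2 + s) (step t τ p m s F) +
        chain t τ p m a (c + 2 + s) (step t τ p m (s + 2) F) := by
  rcases Nat.lt_or_ge m (s + 1) with h | h
  · rw [step_of_le (show m ≤ s + 1 by omega), step_of_le (show m ≤ s by omega),
      step_of_le (show m ≤ s + 2 by omega)]; simp
  rcases Nat.lt_or_ge m (s + 2) with h' | h'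
  -- Too few variables for the general argument: the graph contains a clique with more than m
  -- vertices, and the remaining term vanishes because one symmetrizer of the chain is empty.
  · obtain rfl : m = s + 1 := by omega
    have : chain t τ p (s + 1) a (c + 2 + s) (step t τ p (s + 1) s F) = 0 := by
      cases s with
      | zero =>
        rw [add_zero, chain_succ, hc, step_of_le (b := a c + 1) (by omega), map_zero]
      | succ s =>
        rw [← add_assoc, chain_succ, step_of_le (b := a (c + 2 + s)) (by have := ha s; omega),
          map_zero]
    rw [this, step_of_le le_rfl, step_of_le (by omega)]; simp
  obtain ⟨N, rfl⟩ : ∃ N, m = s + 2 + N := ⟨m - (s + 2), by omega⟩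
  set V := rot p (s + 2 + N) F with hV
  set Y := thetaProd τ 0 N V with hY
  have hZ : theta τ N (theta τ N Y - τ • Y) = -(theta τ N Y - τ • Y) := by
    rw [map_sub, theta_theta, map_smul, sub_smul, one_smul]; abel
  have h0 := chain_of_anti (t := t) hp hc (show N + 2 + s = s + 2 + N by omega) ha hZ
  have e1 : step t τ p (s + 2 + N) (s + 1) F = t ^ (s + 2 + N - 1) • (thetaSum τ 0 N V + Y) := by
    rw [step_apply, show s + 2 + N - (s + 1) = N + 1 by omega, thetaSum_succ]
  have e0 : step t τ p (s + 2 + N) s F =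
      t ^ (s + 2 + N - 1) • (thetaSum τ 0 N V + Y + theta τ N Y) := by
    rw [step_apply, show s + 2 + N - s = N + 1 + 1 by omega, thetaSum_succ, thetaSum_succ,
      thetaProd_succ, zero_add]
  have e2 : step t τ p (s + 2 + N) (s + 2) F = t ^ (s + 2 + N - 1) • thetaSum τ 0 N V := by
    rw [step_apply, show s + 2 + N - (s + 2) = N by omega]
  rw [map_sub, map_smul, sub_eq_zero] at h0
  rw [e0, e1, e2]
  simp only [map_smul, map_add, h0]
  have : t • τ • chain t τ p (s + 2 + N) a (c + 2 + s) Y = chain t τ p (s + 2 + N) a (c + 2 + s) Y := by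
    rw [smul_smul, htτ, one_smul]
  rw [smul_comm (1 + t), smul_comm t, ← smul_add]
  congr 1
  simp only [smul_add, this, add_smul, one_smul]
  abel

end Chain

/-! ### Setting a variable to zero -/

section Stability

variable {R : Type*} [CommRing R] (r : ℕ)

/-- The substitution `X_r ↦ 0` that moves the later variables down by one. -/
def drop : MvPolynomial ℕ R →ₐ[R] MvPolynomial ℕ R :=
  aeval fun j => if j < r then X j else if j = r then 0 else X (j - 1)

variable {r}

theorem drop_X_of_lt {j : ℕ} (h : j < r) : drop r (X j : MvPolynomial ℕ R) = X j := by
  simp [drop, h]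

theorem drop_X_self : drop r (X r : MvPolynomial ℕ R) = 0 := by
  simp [drop]

theorem drop_X_of_gt {j : ℕ} (h : r < j) : drop r (X j : MvPolynomial ℕ R) = X (j - 1) := by
  simp [drop, h.ne', show ¬ j < r by omega]

@[simp] theorem drop_C (c : R) : drop r (C c) = C c := by simp [drop]

theorem drop_sw {i : ℕ} (h : i + 1 < r) (F : MvPolynomial ℕ R) :
    drop r (sw i F) = sw i (drop r F) := by
  have : (drop r).comp (sw i) = (sw i : MvPolynomial ℕ R →ₐ[R] _).comp (drop r) := by
    apply algHom_ext
    intro j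
    simp only [AlgHom.comp_apply]
    by_cases h1 : j = i
    · subst h1
      rw [sw_X_left, drop_X_of_lt (by omega), drop_X_of_lt (by omega), sw_X_left]
    by_cases h2 : j = i + 1
    · subst h2
      rw [sw_X_right, drop_X_of_lt (by omega), drop_X_of_lt (by omega), sw_X_right]
    rw [sw_X_of_ne h1 h2]
    rcases lt_trichotomy j r with h3 | h3 | h3
    · rw [drop_X_of_lt h3, sw_X_of_ne h1 h2]
    · rw [h3, drop_X_self, map_zero]
    · rw [drop_X_of_gt h3, sw_X_of_ne (by omega) (by omega)]
  exact congrArg (fun f => f F) this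

theorem drop_succ_sw (F : MvPolynomial ℕ R) : drop (r + 1) (sw r F) = drop r F := by
  have : (drop (r + 1)).comp (sw r) = (drop r : MvPolynomial ℕ R →ₐ[R] _) := by
    apply algHom_ext
    intro j
    simp only [AlgHom.comp_apply]
    by_cases h1 : j = r
    · subst h1
      rw [sw_X_left, drop_X_self, drop_X_self]
    by_cases h2 : j = r + 1
    · subst h2
      rw [sw_X_right, drop_X_of_lt (by omega), drop_X_of_gt (by omega), Nat.add_sub_cancel]
    rw [sw_X_of_ne h1 h2]
    rcases lt_or_gt_of_ne h1 with h3 | h3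
    · rw [drop_X_of_lt h3, drop_X_of_lt (by omega)]
    · rw [drop_X_of_gt h3, drop_X_of_gt (by omega)]
  exact congrArg (fun f => f F) this

theorem drop_rot {p : R} {m : ℕ} (h : r < m) (F : MvPolynomial ℕ R) :
    drop (r + 1) (rot p (m + 1) F) = rot p m (drop r F) := by
  rw [rot_apply, rot_apply, map_mul, drop_X_of_lt (by omega)]
  congr 1
  have : (drop (r + 1)).comp (cyc p (m + 1)) = (cyc p m).comp (drop r) := by
    apply algHom_ext
    intro j
    simp only [AlgHom.comp_apply]
    rcases lt_trichotomy j r with h3 | h3 | h3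
    · rw [drop_X_of_lt h3, cyc_X_of_lt (by omega), cyc_X_of_lt (by omega),
        drop_X_of_lt (by omega)]
    · rw [h3, drop_X_self, cyc_X_of_lt (by omega), drop_X_self, map_zero]
    · rw [drop_X_of_gt h3]
      rcases lt_trichotomy j m with h4 | h4 | h4
      · rw [cyc_X_of_lt (by omega), cyc_X_of_lt (by omega), drop_X_of_gt (by omega)]
        congr 1; omega
      · rw [cyc_X_last (by omega), cyc_X_last (by omega), map_mul, drop_C,
          drop_X_of_lt (by omega)]
      · rw [cyc_X_of_le (by omega), cyc_X_of_le (by omega), drop_X_of_gt (by omega)]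
  exact congrArg (fun f => f F) this

/-- In a polynomial symmetric in X_0, …, X_s it does not matter which of these variables is set to
zero. This makes it possible to choose the index that fits each vertex operator. -/
theorem drop_eq_of_inv {F : MvPolynomial ℕ R} {r s : ℕ} (hrs : r ≤ s)
    (hF : ∀ i, i < s → sw i F = F) : drop r F = drop s F := by
  induction s, hrs using Nat.le_induction with
  | base => rfl
  | succ s h ih => rw [ih fun i hi => hF i (by omega), ← drop_succ_sw, hF s (by omega)]

variable [IsDomain R] {τ : R}

theorem drop_theta {i : ℕ} (h : i + 1 < r) (F : MvPolynomial ℕ R) :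
    drop r (theta τ i F) = theta τ i (drop r F) :=
  algHom_theta (drop r) one_ne_zero (by rw [drop_X_of_lt (by omega), one_mul])
    (by rw [drop_X_of_lt (by omega), one_mul]) (drop_sw h F)

theorem drop_thetaProd {k : ℕ} (h : k < r) (F : MvPolynomial ℕ R) :
    drop r (thetaProd τ 0 k F) = thetaProd τ 0 k (drop r F) := by
  induction k with
  | zero => rfl
  | succ k ih =>
    rw [thetaProd_succ, thetaProd_succ, drop_theta (by omega), ih (by omega)]

theorem drop_succ_theta (F : MvPolynomial ℕ R) :
    drop (r + 1) (theta τ r F) = drop r F - (1 - τ) • drop (r + 1) F := by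
  have h := congrArg (drop (r + 1)) (theta_spec τ r F)
  simp only [map_mul, map_sub, map_add, map_one, drop_C, drop_X_self, drop_X_of_lt (r.lt_succ_self),
    drop_succ_sw] at h
  apply mul_left_cancel₀ (X_ne_zero (R := R) r)
  rw [smul_eq_C_mul, map_sub, map_one]
  linear_combination -h

/-- By `drop_succ_theta` each further factor contributes one more term of the symmetrizer with
coefficient τ - 1. The recursion starts at 0 since H vanishes at X_0 = 0, as every polynomial in the
image of Π does. -/
theorem drop_thetaProd_self {H : MvPolynomial ℕ R} (h0 : drop 0 H = 0)
    (hH : ∀ i, 1 ≤ i → i < r → sw i H = H) :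
    drop r (thetaProd τ 0 r H) = (τ - 1) • thetaSum τ 0 r (drop r H) := by
  induction r with
  | zero => rw [thetaProd_zero, h0, thetaSum_zero, smul_zero]
  | succ r ih =>
    rw [thetaProd_succ, zero_add, drop_succ_theta, ih fun i h1 h2 => hH i h1 (by omega),
      drop_thetaProd r.lt_succ_self, thetaSum_succ]
    cases r with
    | zero => simp [thetaSum_zero, ← neg_smul]
    | succ r =>
      rw [← drop_succ_sw, hH (r + 1) (by omega) (by omega), smul_add, sub_eq_add_neg, ← neg_smul,
        neg_sub]

theorem drop_thetaSum {H : MvPolynomial ℕ R} (h0 : drop 0 H = 0)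
    (hH : ∀ i, 1 ≤ i → i < r → sw i H = H) :
    drop r (thetaSum τ 0 (r + 1) H) = τ • thetaSum τ 0 r (drop r H) := by
  rw [thetaSum_succ, map_add, drop_thetaProd_self h0 hH, sub_smul, one_smul, thetaSum_apply,
    thetaSum_apply, map_sum,
    Finset.sum_congr rfl fun k hk => drop_thetaProd (Finset.mem_range.1 hk) H]
  abel

/-- The factor τ from `drop_thetaSum` turns t^m, which belongs to m + 1 variables, into t^(m-1);
this is the purpose of the normalization. -/
theorem drop_step {t p : R} (htτ : t * τ = 1) {m b : ℕ} (hm : 1 ≤ m) (hb : b ≤ m)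
    {F : MvPolynomial ℕ R} (hF : ∀ i, i + b + 2 < m + 1 → theta τ i F = τ • F) :
    drop (m - b) (step t τ p (m + 1) b F) = step t τ p m b (drop (m - b - 1) F) := by
  obtain ⟨r, rfl⟩ : ∃ r, m = r + b := ⟨m - b, by omega⟩
  rw [step_apply, step_apply, Nat.add_sub_cancel, show r + b + 1 - b = r + 1 by omega, map_smul,
    drop_thetaSum (by rw [rot_apply, map_mul, drop_X_self, zero_mul]), smul_smul,
    show r + b + 1 - 1 = (r + b - 1) + 1 by omega, pow_succ, mul_assoc, htτ, mul_one]
  · cases r with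
    | zero => rw [thetaSum_zero, thetaSum_zero]
    | succ r => rw [drop_rot (by omega), Nat.add_sub_cancel]
  · intro i h1 h2
    obtain ⟨i, rfl⟩ : ∃ i', i = i' + 1 := ⟨i - 1, by omega⟩
    exact sw_of_theta (rot_inv (by omega) (hF i (by omega)))

theorem drop_chain {t p : R} (htτ : t * τ = 1) {m : ℕ} (hm : 1 ≤ m) {a : ℕ → ℕ}
    (ha : ∀ i, a (i + 1) ≤ a i + 1) {k r : ℕ} (hr : r ≤ m - a 0) :
    drop r (chain t τ p (m + 1) a k 1) = chain t τ p m a k 1 := by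
  induction k generalizing a r with
  | zero => simp [chain_zero]
  | succ k ih =>
    have ha0 := ha 0
    rw [zero_add] at ha0
    -- The chain is symmetric enough to replace r by the index m - a 0 at which `drop_step` applies.
    rw [drop_eq_of_inv hr fun i hi => sw_of_theta (theta_chain ha (by omega)), chain_succ',
      chain_succ']
    rcases Nat.lt_or_ge m (a 0) with h | h
    · rw [step_of_le (by omega), step_of_le (by omega), map_zero]
    rw [drop_step htτ hm h, ih (fun i => ha (i + 1))]
    · simp only [zero_add]; omega
    · intro i hi
      exact theta_chain (fun i => ha (i + 1)) (by simp only [zero_add]; omega)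

end Stability

/-! ### Generating functions of colorings and the exchange of two colors -/

section ColoringSums

variable {K : Type*} [Field K] {α V : Type*} [Fintype V]

/-- The generating function of the colorings with colors in `α`. -/
def colSum (α : Type*) [Fintype α] (f : (V → α) → K) : MvPolynomial α K := by
  classical exact ∑ κ : V → α, C (f κ) * ∏ v, X (κ v)

theorem colSum_eq [DecidableEq V] [Fintype α] (f : (V → α) → K) :
    colSum α f = ∑ κ : V → α, C (f κ) * ∏ v, X (κ v) := by
  unfold colSum; congr!

theorem colSum_swap [DecidableEq V] [Fintype α] (u v : V) (f : (V → α) → K) :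
    colSum α (fun κ => f (κ ∘ Equiv.swap u v)) = colSum α f := by
  rw [colSum_eq, colSum_eq]
  refine Fintype.sum_equiv ((Equiv.swap u v).arrowCongr (Equiv.refl α)) _ _ fun κ => ?_
  congr 1
  exact Fintype.prod_equiv (Equiv.swap u v) _ _ fun i => by simp

/-- Exchanging the colors of u and v preserves the monomial, so the sum equals its own negative. -/
theorem colSum_eq_zero [CharZero K] [DecidableEq V] [Fintype α] {u v : V} {f : (V → α) → K}
    (h : ∀ κ, f (κ ∘ Equiv.swap u v) = -f κ) : colSum α f = 0 := by
  have h1 := colSum_swap u v f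
  simp only [h] at h1
  rw [colSum_eq, colSum_eq] at h1
  rw [colSum_eq]
  simp only [map_neg, neg_mul, Finset.sum_neg_distrib] at h1
  exact self_eq_neg.1 h1.symm

theorem colSum_add [Fintype α] (f g : (V → α) → K) :
    colSum α (fun κ => f κ + g κ) = colSum α f + colSum α g := by
  classical
  simp only [colSum_eq, ← Finset.sum_add_distrib, map_add, add_mul]

theorem colSum_smul [Fintype α] (a : K) (f : (V → α) → K) :
    colSum α (fun κ => a * f κ) = a • colSum α f := by
  classical
  simp only [colSum_eq, Finset.smul_sum, smul_eq_C_mul, ← mul_assoc, map_mul]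

/-- Three coloring weights whose defect from a linear relation is antisymmetric. -/
theorem colSum_relation [CharZero K] [DecidableEq V] [Fintype α] {u v : V}
    {f g h d : (V → α) → K} {a b : K} (hd : ∀ κ, d (κ ∘ Equiv.swap u v) = -d κ)
    (H : ∀ κ, a * f κ = b * g κ + (h κ + d κ)) :
    a • colSum α f = b • colSum α g + colSum α h := by
  rw [← colSum_smul, funext H, colSum_add, colSum_add, colSum_smul, colSum_eq_zero hd, add_zero]

end ColoringSums

/-! ### Weights of colorings as products over edges -/

section ColoringWeights

variable {K : Type*} [Field K] (t : K) {α : Type*} [LinearOrder α]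

/-- The weight of an edge whose ends have the colors `x` and `y`. -/
def edgeWeight (x y : α) : K := if x = y then 0 else if x < y then t else 1

open Classical in
/-- The weight of a coloring of the directed graph with edge relation `r`. -/
def colWeight {V : Type*} [Fintype V] (r : V → V → Prop) (κ : V → α) : K :=
  ∏ p : V × V, if r p.1 p.2 then edgeWeight t (κ p.1) (κ p.2) else 1

variable {t}

theorem edgeWeight_self (x : α) : edgeWeight t x x = 0 := if_pos rfl

theorem edgeWeight_of_lt {x y : α} (h : x < y) : edgeWeight t x y = t := by
  rw [edgeWeight, if_neg h.ne, if_pos h]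

theorem edgeWeight_of_gt {x y : α} (h : y < x) : edgeWeight t x y = 1 := by
  rw [edgeWeight, if_neg h.ne', if_neg h.not_gt]

/-- With x, y the colors of two adjacent vertices that have otherwise the same neighbours, and z
that of a common target, the bracket is the defect of the modular law for a single coloring. The
exchange of x and y changes its sign, so it disappears in the sum over all colorings. -/
theorem edgeWeight_antisymm_source (x y z : α) :
    edgeWeight t x y * ((1 + t) * edgeWeight t y z - t - edgeWeight t x z * edgeWeight t y z) =
      -(edgeWeight t y x *
        ((1 + t) * edgeWeight t x z - t - edgeWeight t y z * edgeWeight t x z)) := by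
  have key : ∀ x y : α, x < y →
      edgeWeight t x y * ((1 + t) * edgeWeight t y z - t - edgeWeight t x z * edgeWeight t y z) =
      -(edgeWeight t y x *
        ((1 + t) * edgeWeight t x z - t - edgeWeight t y z * edgeWeight t x z)) := by
    intro x y h
    rw [edgeWeight_of_lt h, edgeWeight_of_gt h]
    rcases lt_trichotomy z x with h1 | rfl | h1
    · rw [edgeWeight_of_gt h1, edgeWeight_of_gt (h1.trans h)]; ring
    · rw [edgeWeight_self, edgeWeight_of_gt h]; ring
    rw [edgeWeight_of_lt h1]
    rcases lt_trichotomy z y with h2 | rfl | h2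
    · rw [edgeWeight_of_gt h2]; ring
    · rw [edgeWeight_self]; ring
    · rw [edgeWeight_of_lt h2]; ring
  rcases lt_trichotomy x y with h | rfl | h
  · exact key x y h
  · rw [edgeWeight_self]; ring
  · rw [key y x h, neg_neg]

theorem edgeWeight_antisymm_target (x y z : α) :
    edgeWeight t x y * ((1 + t) * edgeWeight t z x - t - edgeWeight t z x * edgeWeight t z y) =
      -(edgeWeight t y x *
        ((1 + t) * edgeWeight t z y - t - edgeWeight t z y * edgeWeight t z x)) := by
  have key : ∀ x y : α, x < y →
      edgeWeight t x y * ((1 + t) * edgeWeight t z x - t - edgeWeight t z x * edgeWeight t z y) =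
      -(edgeWeight t y x *
        ((1 + t) * edgeWeight t z y - t - edgeWeight t z y * edgeWeight t z x)) := by
    intro x y h
    rw [edgeWeight_of_lt h, edgeWeight_of_gt h]
    rcases lt_trichotomy z x with h1 | rfl | h1
    · rw [edgeWeight_of_lt h1, edgeWeight_of_lt (h1.trans h)]; ring
    · rw [edgeWeight_self, edgeWeight_of_lt h]; ring
    rw [edgeWeight_of_gt h1]
    rcases lt_trichotomy z y with h2 | rfl | h2
    · rw [edgeWeight_of_lt h2]; ring
    · rw [edgeWeight_self]; ring
    · rw [edgeWeight_of_gt h2]; ring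
  rcases lt_trichotomy x y with h | rfl | h
  · exact key x y h
  · rw [edgeWeight_self]; ring
  · rw [key y x h, neg_neg]

variable {V : Type*} [Fintype V]

theorem colWeight_swap [DecidableEq V] {r : V → V → Prop} {u v : V}
    (h : ∀ a b, r (Equiv.swap u v a) (Equiv.swap u v b) ↔ r a b) (κ : V → α) :
    colWeight t r (κ ∘ Equiv.swap u v) = colWeight t r κ := by
  classical
  refine Fintype.prod_equiv (Equiv.prodCongr (Equiv.swap u v) (Equiv.swap u v)) _ _ fun p => ?_
  simp only [Equiv.prodCongr_apply, Prod.map_fst, Prod.map_snd, h, Function.comp_apply]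

theorem colWeight_insert {r r' : V → V → Prop} {x y : V}
    (h : ∀ a b, r' a b ↔ r a b ∨ (a = x ∧ b = y)) (hxy : ¬ r x y) (κ : V → α) :
    colWeight t r' κ = colWeight t r κ * edgeWeight t (κ x) (κ y) := by
  classical
  have : ∀ p : V × V, (if r' p.1 p.2 then edgeWeight t (κ p.1) (κ p.2) else 1) =
      (if r p.1 p.2 then edgeWeight t (κ p.1) (κ p.2) else 1) *
        (if p = (x, y) then edgeWeight t (κ p.1) (κ p.2) else 1) := by
    rintro ⟨a, b⟩
    by_cases hab : a = x ∧ b = y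
    · obtain ⟨rfl, rfl⟩ := hab
      simp [h, hxy]
    · simp only [h, hab, or_false, Prod.mk.injEq, if_false, mul_one]
  unfold colWeight
  rw [Finset.prod_congr rfl fun p _ => this p, Finset.prod_mul_distrib, Finset.prod_ite_eq']
  simp

end ColoringWeights

/-! ### The modular law for chromatic quasisymmetric polynomials -/

section UnitInterval

variable {K : Type*} [Field K] (t : K)

/-- The edges of the unit interval graph of `e`, counted from `0`. -/
def edge (n : ℕ) (e : ℕ → ℕ) (j i : Fin n) : Prop := e i ≤ j ∧ j < i

/-- The chromatic quasisymmetric polynomial of `e` in `m` variables. -/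
def chromPoly (n : ℕ) (m : ℕ) (e : ℕ → ℕ) : MvPolynomial (Fin m) K :=
  colSum (Fin m) (colWeight t (edge n e))

variable {t} {n : ℕ}

theorem swap_iff_of_twins {r : Fin n → Fin n → Prop} {u v : Fin n} (huu : ¬ r u u) (hvv : ¬ r v v)
    (huv : ¬ r u v) (hvu : ¬ r v u) (h1 : ∀ a, a ≠ u → a ≠ v → (r a u ↔ r a v))
    (h2 : ∀ a, a ≠ u → a ≠ v → (r u a ↔ r v a)) (a b : Fin n) :
    r (Equiv.swap u v a) (Equiv.swap u v b) ↔ r a b := by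
  by_cases hau : a = u
  · subst hau
    rw [Equiv.swap_apply_left]
    by_cases hbu : b = a
    · subst hbu; simp [huu, hvv]
    · by_cases hbv : b = v
      · subst hbv; simp [huv, hvu]
      · rw [Equiv.swap_apply_of_ne_of_ne hbu hbv, h2 b hbu hbv]
  · by_cases hav : a = v
    · subst hav
      rw [Equiv.swap_apply_right]
      by_cases hbu : b = u
      · subst hbu; simp [huv, hvu]
      · by_cases hbv : b = a
        · subst hbv; simp [huu, hvv]
        · rw [Equiv.swap_apply_of_ne_of_ne hbu hbv, h2 b hbu hbv]
    · rw [Equiv.swap_apply_of_ne_of_ne hau hav]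
      by_cases hbu : b = u
      · subst hbu; rw [Equiv.swap_apply_left, h1 a hau hav]
      · by_cases hbv : b = v
        · subst hbv; rw [Equiv.swap_apply_right, h1 a hau hav]
        · rw [Equiv.swap_apply_of_ne_of_ne hbu hbv]

theorem chromPoly_congr {m : ℕ} {e e' : ℕ → ℕ} (h : ∀ i < n, e i = e' i) :
    chromPoly t n m e = chromPoly t n m e' := by
  have : edge n e = edge n e' := by
    funext j i
    simp only [edge, h i i.2]
  rw [chromPoly, this, chromPoly]

/-- In both forms of the law there are two vertices u, v that become interchangeable once the edge
between them and the varying edges to a third vertex z are removed. The weight of the remaining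
graph is symmetric in u and v, and the defect of the relation is antisymmetric. -/
theorem modular_chromPoly [CharZero K] (m : ℕ) : Modular t n (chromPoly (K := K) t n m) where
  congr e e' h := chromPoly_congr h
  single e i c hi hci htw hv0 hv2 := by
    obtain ⟨u, hu⟩ : ∃ u : Fin n, (u : ℕ) = c := ⟨⟨c, by omega⟩, rfl⟩
    obtain ⟨v, hv⟩ : ∃ v : Fin n, (v : ℕ) = c + 1 := ⟨⟨c + 1, by omega⟩, rfl⟩
    obtain ⟨z, hz⟩ : ∃ z : Fin n, (z : ℕ) = i := ⟨⟨i, by omega⟩, rfl⟩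
    -- Validity at both extreme values leaves no room for the value c + 1 elsewhere, so c and c + 1
    -- have the same right neighbours apart from i.
    have hne : ∀ k < n, Function.update e i (c + 2) k ≠ c + 1 := by
      intro k hk
      by_cases hki : k = i
      · subst hki; rw [Function.update_self]; omega
      · rw [Function.update_of_ne hki]
        rcases lt_or_gt_of_ne hki with h | h
        · have := hv0.mono k i h.le hi
          rw [Function.update_self, Function.update_of_ne hki] at this
          omega
        · have := hv2.mono i k h.le hk
          rw [Function.update_self, Function.update_of_ne hki] at this
          omega
    have hec : e c ≤ c := by
      have := hv0.le c (by omega)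
      rwa [Function.update_of_ne (by omega)] at this
    have hE : ∀ e (a b : Fin n), edge n e a b ↔ e b ≤ a ∧ (a : ℕ) < b := fun _ _ _ => Iff.rfl
    -- The common part of the three graphs, without the edge u → v; it is stable under exchanging u
    -- and v.
    set r0 : Fin n → Fin n → Prop :=
      fun a b => edge n (Function.update e i (c + 2)) a b ∧ ¬ (a = u ∧ b = v) with hr0
    have h2 : ∀ κ : Fin n → Fin m, colWeight t (edge n (Function.update e i (c + 2))) κ =
        colWeight t r0 κ * edgeWeight t (κ u) (κ v) := by
      refine colWeight_insert (fun a b => ?_) (fun h => h.2 ⟨rfl, rfl⟩)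
      by_cases hab : a = u ∧ b = v
      · obtain ⟨rfl, rfl⟩ := hab
        simp only [hr0, and_self, or_true, iff_true, hE, hu, hv]
        rw [Function.update_of_ne (by omega)]; omega
      · simp only [hr0, hab, not_false_eq_true, and_true, or_false]
    have h1 : ∀ κ : Fin n → Fin m, colWeight t (edge n (Function.update e i (c + 1))) κ =
        colWeight t (edge n (Function.update e i (c + 2))) κ * edgeWeight t (κ v) (κ z) := by
      refine colWeight_insert (fun a b => ?_) (fun h => ?_)
      · simp only [hE, Fin.ext_iff, hv, hz]
        by_cases hb : (b : ℕ) = i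
        · simp only [hb, Function.update_self, and_true]; omega
        · simp only [Function.update_of_ne hb]; omega
      · simp only [hE, hv, hz, Function.update_self] at h
        omega
    have h0 : ∀ κ : Fin n → Fin m, colWeight t (edge n (Function.update e i c)) κ =
        colWeight t (edge n (Function.update e i (c + 1))) κ * edgeWeight t (κ u) (κ z) := by
      refine colWeight_insert (fun a b => ?_) (fun h => ?_)
      · simp only [hE, Fin.ext_iff, hu, hz]
        by_cases hb : (b : ℕ) = i
        · simp only [hb, Function.update_self, and_true]; omega
        · simp only [Function.update_of_ne hb]; omega
      · simp only [hE, hu, hz, Function.update_self] at h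
        omega
    have hsym := swap_iff_of_twins (r := r0) (u := u) (v := v) (fun h => by have := h.1.2; omega)
      (fun h => by have := h.1.2; omega) (fun h => h.2 ⟨rfl, rfl⟩)
      (fun h => by have := h.1.2; omega)
      (fun a ha1 ha2 => by
        simp only [hr0, hE, Fin.ext_iff, hu, hv, ne_eq] at ha1 ha2 ⊢
        rw [Function.update_of_ne (by omega), Function.update_of_ne (by omega)]
        omega)
      (fun a ha1 ha2 => by
        simp only [hr0, hE, Fin.ext_iff, hu, hv, ne_eq] at ha1 ha2 ⊢
        have := hne a a.2
        omega)
    have hsz : Equiv.swap u v z = z :=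
      Equiv.swap_apply_of_ne_of_ne (fun h => by rw [Fin.ext_iff] at h; omega)
        (fun h => by rw [Fin.ext_iff] at h; omega)
    refine colSum_relation (u := u) (v := v) (d := fun κ => colWeight t r0 κ *
      (edgeWeight t (κ u) (κ v) * ((1 + t) * edgeWeight t (κ v) (κ z) - t -
        edgeWeight t (κ u) (κ z) * edgeWeight t (κ v) (κ z)))) (fun κ => ?_) fun κ => ?_
    · rw [colWeight_swap hsym]
      simp only [Function.comp_apply, Equiv.swap_apply_left, Equiv.swap_apply_right, hsz]
      rw [edgeWeight_antisymm_source]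
      ring
    · rw [h0, h1, h2]; ring
  double e i c hi hk hv0 hv2 := by
    have hci : c + 1 ≤ i := by
      have := hv2.le i (by omega)
      rwa [Function.update_of_ne (by omega), Function.update_self] at this
    obtain ⟨u, hu⟩ : ∃ u : Fin n, (u : ℕ) = i := ⟨⟨i, by omega⟩, rfl⟩
    obtain ⟨v, hv⟩ : ∃ v : Fin n, (v : ℕ) = i + 1 := ⟨⟨i + 1, by omega⟩, rfl⟩
    obtain ⟨z, hz⟩ : ∃ z : Fin n, (z : ℕ) = c := ⟨⟨c, by omega⟩, rfl⟩
    have hE : ∀ e (a b : Fin n), edge n e a b ↔ e b ≤ a ∧ (a : ℕ) < b := fun _ _ _ => Iff.rfl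
    set e2 := Function.update (Function.update e i (c + 1)) (i + 1) (c + 1) with he2
    set e1 := Function.update (Function.update e i c) (i + 1) (c + 1) with he1
    set e0 := Function.update (Function.update e i c) (i + 1) c with he0
    have e2u : e2 i = c + 1 := by rw [he2, Function.update_of_ne (by omega), Function.update_self]
    have e2v : e2 (i + 1) = c + 1 := by rw [he2, Function.update_self]
    have e1u : e1 i = c := by rw [he1, Function.update_of_ne (by omega), Function.update_self]
    have e1v : e1 (i + 1) = c + 1 := by rw [he1, Function.update_self]
    have e0u : e0 i = c := by rw [he0, Function.update_of_ne (by omega), Function.update_self]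
    have e0v : e0 (i + 1) = c := by rw [he0, Function.update_self]
    have e2o : ∀ b, b ≠ i → b ≠ i + 1 → e2 b = e b := fun b h h' => by
      rw [he2, Function.update_of_ne h', Function.update_of_ne h]
    have e1o : ∀ b, b ≠ i → b ≠ i + 1 → e1 b = e b := fun b h h' => by
      rw [he1, Function.update_of_ne h', Function.update_of_ne h]
    have e0o : ∀ b, b ≠ i → b ≠ i + 1 → e0 b = e b := fun b h h' => by
      rw [he0, Function.update_of_ne h', Function.update_of_ne h]
    clear_value e2 e1 e0
    have cases3 : ∀ {P : ℕ → Prop} (b : ℕ), P i → P (i + 1) → (b ≠ i → b ≠ i + 1 → P b) → P b := by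
      intro P b h1 h2 h3
      by_cases hb : b = i
      · rwa [hb]
      by_cases hb' : b = i + 1
      · rwa [hb']
      exact h3 hb hb'
    set r0 : Fin n → Fin n → Prop := fun a b => edge n e2 a b ∧ ¬ (a = u ∧ b = v) with hr0
    have h2 : ∀ κ : Fin n → Fin m, colWeight t (edge n e2) κ =
        colWeight t r0 κ * edgeWeight t (κ u) (κ v) := by
      refine colWeight_insert (fun a b => ?_) (fun h => h.2 ⟨rfl, rfl⟩)
      by_cases hab : a = u ∧ b = v
      · obtain ⟨rfl, rfl⟩ := hab
        simp only [hr0, and_self, or_true, iff_true, hE, hu, hv, e2v]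
        omega
      · simp only [hr0, hab, not_false_eq_true, and_true, or_false]
    have h1 : ∀ κ : Fin n → Fin m, colWeight t (edge n e1) κ =
        colWeight t (edge n e2) κ * edgeWeight t (κ z) (κ u) := by
      refine colWeight_insert (fun a b => ?_) (fun h => ?_)
      · simp only [hE, Fin.ext_iff, hu, hz]
        refine cases3 (P := fun b => e1 b ≤ a ∧ (a : ℕ) < b ↔
          (e2 b ≤ a ∧ (a : ℕ) < b) ∨ (a : ℕ) = c ∧ b = i) b ?_ ?_ ?_
        · rw [e1u, e2u]; omega
        · rw [e1v, e2v]; omega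
        · intro hb hb'
          rw [e1o b hb hb', e2o b hb hb']; omega
      · simp only [hE, hu, hz, e2u] at h
        omega
    have h0 : ∀ κ : Fin n → Fin m, colWeight t (edge n e0) κ =
        colWeight t (edge n e1) κ * edgeWeight t (κ z) (κ v) := by
      refine colWeight_insert (fun a b => ?_) (fun h => ?_)
      · simp only [hE, Fin.ext_iff, hv, hz]
        refine cases3 (P := fun b => e0 b ≤ a ∧ (a : ℕ) < b ↔
          (e1 b ≤ a ∧ (a : ℕ) < b) ∨ (a : ℕ) = c ∧ b = i + 1) b ?_ ?_ ?_
        · rw [e0u, e1u]; omega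
        · rw [e0v, e1v]; omega
        · intro hb hb'
          rw [e0o b hb hb', e1o b hb hb']; omega
      · simp only [hE, hv, hz, e1v] at h
        omega
    have hsym := swap_iff_of_twins (r := r0) (u := u) (v := v) (fun h => by have := h.1.2; omega)
      (fun h => by have := h.1.2; omega) (fun h => h.2 ⟨rfl, rfl⟩)
      (fun h => by have := h.1.2; omega)
      (fun a ha1 ha2 => by
        simp only [hr0, hE, Fin.ext_iff, hu, hv, ne_eq, e2u, e2v] at ha1 ha2 ⊢
        omega)
      (fun a ha1 ha2 => by
        simp only [hr0, hE, Fin.ext_iff, hu, hv, ne_eq] at ha1 ha2 ⊢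
        have h3 : i + 1 < (a : ℕ) → e2 a ≠ i + 1 := fun h => by
          rw [e2o a (by omega) (by omega)]
          exact hk a h a.2
        omega)
    have hsz : Equiv.swap u v z = z :=
      Equiv.swap_apply_of_ne_of_ne (fun h => by rw [Fin.ext_iff] at h; omega)
        (fun h => by rw [Fin.ext_iff] at h; omega)
    refine colSum_relation (u := u) (v := v) (d := fun κ => colWeight t r0 κ *
      (edgeWeight t (κ u) (κ v) * ((1 + t) * edgeWeight t (κ z) (κ u) - t -
        edgeWeight t (κ z) (κ u) * edgeWeight t (κ z) (κ v)))) (fun κ => ?_) fun κ => ?_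
    · rw [colWeight_swap hsym]
      simp only [Function.comp_apply, Equiv.swap_apply_left, Equiv.swap_apply_right, hsz]
      rw [edgeWeight_antisymm_target]
      ring
    · rw [h0, h1, h2]; ring

end UnitInterval

/-! ### t-integers and t-factorials -/

section QNumbers

variable {K : Type*} [CommRing K]

/-- The `t`-integer `1 + t + ⋯ + t^{n-1}`. -/
def tInt (t : K) (n : ℕ) : K := ∑ i ∈ Finset.range n, t ^ i

/-- The `t`-factorial. -/
def tFact (t : K) (n : ℕ) : K := ∏ i ∈ Finset.range n, tInt t (i + 1)

theorem tInt_zero (t : K) : tInt t 0 = 0 := by simp [tInt]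

theorem tInt_succ (t : K) (n : ℕ) : tInt t (n + 1) = tInt t n + t ^ n :=
  Finset.sum_range_succ _ _

theorem tFact_zero (t : K) : tFact t 0 = 1 := by simp [tFact]

theorem tFact_succ (t : K) (n : ℕ) : tFact t (n + 1) = tFact t n * tInt t (n + 1) :=
  Finset.prod_range_succ _ _

end QNumbers

/-! ### Chromatic quasisymmetric polynomials of complete graphs and disjoint unions -/

section Cliques

variable {K : Type*} [Field K] {t : K}

theorem colWeight_add {α : Type*} [LinearOrder α] {b r : ℕ} {e : ℕ → ℕ}
    (he : ∀ i, b ≤ i → i < b + r → e i = b) (κ : Fin b → α) (κ' : Fin r → α) :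
    colWeight t (edge (b + r) e) (Fin.append κ κ') =
      colWeight t (edge b e) κ * colWeight t (edge r fun _ => 0) κ' := by
  classical
  have hE : ∀ n e (i j : Fin n), edge n e i j ↔ e j ≤ i ∧ (i : ℕ) < j := fun _ _ _ _ => Iff.rfl
  simp only [colWeight, Fintype.prod_prod_type, Fin.prod_univ_add, Fin.append_left,
    Fin.append_right]
  have h1 : ∀ (i : Fin b) (j : Fin r), ¬ edge (b + r) e (Fin.castAdd r i) (Fin.natAdd b j) := by
    intro i j
    rw [hE, Fin.val_natAdd, he _ (by omega) (by omega), Fin.val_castAdd]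
    omega
  have h2 : ∀ (i : Fin b) (j : Fin r), ¬ edge (b + r) e (Fin.natAdd b j) (Fin.castAdd r i) := by
    intro i j
    rw [hE, Fin.val_natAdd, Fin.val_castAdd]
    omega
  have h3 : ∀ i j : Fin b, edge (b + r) e (Fin.castAdd r i) (Fin.castAdd r j) ↔ edge b e i j :=
    fun _ _ => Iff.rfl
  have h4 : ∀ i j : Fin r, edge (b + r) e (Fin.natAdd b i) (Fin.natAdd b j) ↔
      edge r (fun _ => 0) i j := by
    intro i j
    rw [hE, hE, Fin.val_natAdd, Fin.val_natAdd, he _ (by omega) (by omega)]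
    omega
  simp [h1, h2, h3, h4]

theorem chromPoly_add {b r m : ℕ} {e : ℕ → ℕ} (he : ∀ i, b ≤ i → i < b + r → e i = b) :
    chromPoly t (b + r) m e = chromPoly t b m e * chromPoly t r m fun _ => 0 := by
  simp only [chromPoly, colSum_eq]
  rw [Finset.sum_mul_sum, ← Finset.sum_product', Finset.univ_product_univ]
  symm
  refine Fintype.sum_equiv (Fin.appendEquiv b r) _ _ fun p => ?_
  change _ = C (colWeight t (edge (b + r) e) (Fin.append p.1 p.2)) * ∏ v, X (Fin.append p.1 p.2 v)
  rw [colWeight_add he, Fin.prod_univ_add, map_mul]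
  simp only [Fin.append_left, Fin.append_right]
  ring

/-- The product for y is t to the number of elements of S below y, and these numbers run through 0,
…, |S| - 1. -/
theorem sum_prod_edgeWeight {α : Type*} [LinearOrder α] (S : Finset α) :
    ∑ y ∈ S, ∏ x ∈ S.erase y, edgeWeight t x y = tInt t S.card := by
  induction S using Finset.induction_on_max with
  | empty => simp [tInt_zero]
  | insert a s hs ih =>
    have ha : a ∉ s := fun h => lt_irrefl _ (hs a h)
    rw [Finset.sum_insert ha, Finset.erase_insert ha, Finset.card_insert_of_notMem ha, tInt_succ,
      add_comm]
    congr 1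
    · rw [← ih]
      refine Finset.sum_congr rfl fun y hy => ?_
      rw [Finset.erase_insert_of_ne (hs y hy).ne', Finset.prod_insert
        (fun h => ha (Finset.mem_of_mem_erase h)), edgeWeight_of_gt (hs y hy), one_mul]
    · rw [Finset.prod_congr rfl fun x hx => edgeWeight_of_lt (hs x hx), Finset.prod_const]

theorem colWeight_clique_snoc {α : Type*} [LinearOrder α] {r : ℕ} (κ : Fin r → α) (y : α) :
    colWeight t (edge (r + 1) fun _ => 0) (Fin.snoc κ y : Fin (r + 1) → α) =
      colWeight t (edge r fun _ => 0) κ * ∏ j, edgeWeight t (κ j) y := by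
  classical
  have hE : ∀ n e (i j : Fin n), edge n e i j ↔ e j ≤ i ∧ (i : ℕ) < j := fun _ _ _ _ => Iff.rfl
  simp only [colWeight, Fintype.prod_prod_type, Fin.prod_univ_castSucc, Fin.snoc_castSucc,
    Fin.snoc_last]
  have h1 : ∀ i : Fin r, edge (r + 1) (fun _ => 0) i.castSucc (Fin.last r) := by
    intro i; rw [hE, Fin.val_castSucc, Fin.val_last]; omega
  have h2 : ∀ i : Fin (r + 1), ¬ edge (r + 1) (fun _ => 0) (Fin.last r) i := by
    intro i; rw [hE, Fin.val_last]; omega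
  have h3 : ∀ i j : Fin r, edge (r + 1) (fun _ => 0) i.castSucc j.castSucc ↔
      edge r (fun _ => 0) i j := fun _ _ => Iff.rfl
  simp [h1, h2, h3, Finset.prod_mul_distrib]

theorem injective_of_colWeight_ne_zero {α : Type*} [LinearOrder α] {r : ℕ} {κ : Fin r → α}
    (h : colWeight t (edge r fun _ => 0) κ ≠ 0) : Function.Injective κ := by
  classical
  have key : ∀ i j, i < j → κ i ≠ κ j := by
    intro i j hij hκ
    refine h (Finset.prod_eq_zero (Finset.mem_univ (i, j)) ?_)
    rw [if_pos ⟨Nat.zero_le _, hij⟩, hκ, edgeWeight_self]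
  intro i j hij
  rcases lt_trichotomy i j with h | h | h
  · exact absurd hij (key i j h)
  · exact h
  · exact absurd hij.symm (key j i h)

/-- Only injective colorings contribute, so everything is grouped by the set of colors. An arbitrary
function φ of this set is allowed in order that the induction can absorb the color of the last
vertex. -/
theorem sum_colWeight_clique {α A : Type*} [LinearOrder α] [Fintype α] [AddCommGroup A] [Module K A]
    (r : ℕ) (φ : Finset α → A) :
    ∑ κ : Fin r → α, colWeight t (edge r fun _ => 0) κ • φ (Finset.univ.image κ) =
      tFact t r • ∑ S ∈ Finset.powersetCard r Finset.univ, φ S := by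
  induction r generalizing φ with
  | zero => simp [tFact_zero, colWeight]
  | succ r ih =>
    rw [← (Fin.snocEquiv fun _ : Fin (r + 1) => α).sum_comp, Fintype.sum_prod_type, Finset.sum_comm]
    have h1 : ∀ κ : Fin r → α, ∑ y : α, colWeight t (edge (r + 1) fun _ => 0)
          (Fin.snocEquiv (fun _ : Fin (r + 1) => α) (y, κ)) •
          φ (Finset.univ.image (Fin.snocEquiv (fun _ : Fin (r + 1) => α) (y, κ))) =
        colWeight t (edge r fun _ => 0) κ • ∑ y : α,
          (∏ x ∈ Finset.univ.image κ, edgeWeight t x y) • φ (insert y (Finset.univ.image κ)) := by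
      intro κ
      rw [Finset.smul_sum]
      refine Finset.sum_congr rfl fun y _ => ?_
      change colWeight t _ (Fin.snoc κ y : Fin (r + 1) → α) •
        φ (Finset.univ.image (Fin.snoc κ y : Fin (r + 1) → α)) = _
      have himg : Finset.univ.image (Fin.snoc κ y : Fin (r + 1) → α) =
          insert y (Finset.univ.image κ) := by
        ext z
        simp only [Finset.mem_image, Finset.mem_univ, true_and, Finset.mem_insert]
        constructor
        · rintro ⟨i, rfl⟩
          refine Fin.lastCases ?_ (fun i => ?_) i
          · simp
          · simp
        · rintro (rfl | ⟨i, rfl⟩)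
          · exact ⟨Fin.last r, by simp⟩
          · exact ⟨i.castSucc, by simp⟩
      rw [colWeight_clique_snoc, himg, mul_smul]
      by_cases h0 : colWeight t (edge r fun _ => 0) κ = 0
      · rw [h0, zero_smul, zero_smul]
      · rw [Finset.prod_image (injective_of_colWeight_ne_zero h0).injOn]
    rw [Finset.sum_congr rfl fun κ _ => h1 κ, ih fun S => ∑ y : α,
      (∏ x ∈ S, edgeWeight t x y) • φ (insert y S), tFact_succ, mul_smul]
    congr 1
    have h2 : ∀ S : Finset α, ∑ y : α, (∏ x ∈ S, edgeWeight t x y) • φ (insert y S) =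
        ∑ y ∈ Sᶜ, (∏ x ∈ S, edgeWeight t x y) • φ (insert y S) := by
      intro S
      symm
      refine Finset.sum_subset (Finset.subset_univ _) fun y _ hy => ?_
      rw [Finset.prod_eq_zero (by simpa using hy) (edgeWeight_self y), zero_smul]
    have h3 : ∀ S ∈ Finset.powersetCard (r + 1) (Finset.univ : Finset α), tInt t (r + 1) • φ S =
        ∑ y ∈ S, (∏ x ∈ S.erase y, edgeWeight t x y) • φ S := by
      intro S hS
      rw [← Finset.sum_smul, sum_prod_edgeWeight, (Finset.mem_powersetCard.1 hS).2]
    rw [Finset.sum_congr rfl fun S _ => h2 S, Finset.smul_sum, Finset.sum_congr rfl h3,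
      Finset.sum_sigma', Finset.sum_sigma']
    -- A set of r colors with one further color is the same as a set of r + 1 colors with a marked
    -- element.
    refine Finset.sum_bij' (fun p _ => ⟨insert p.2 p.1, p.2⟩) (fun p _ => ⟨p.1.erase p.2, p.2⟩)
      ?_ ?_ ?_ ?_ ?_
    · rintro ⟨S, y⟩ h
      simp only [Finset.mem_sigma, Finset.mem_powersetCard, Finset.subset_univ, true_and,
        Finset.mem_compl] at h ⊢
      exact ⟨by rw [Finset.card_insert_of_notMem h.2, h.1], Finset.mem_insert_self _ _⟩
    · rintro ⟨S, y⟩ h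
      simp only [Finset.mem_sigma, Finset.mem_powersetCard, Finset.subset_univ, true_and,
        Finset.mem_compl] at h ⊢
      exact ⟨by rw [Finset.card_erase_of_mem h.2, h.1, Nat.add_sub_cancel], Finset.notMem_erase _ _⟩
    · rintro ⟨S, y⟩ h
      simp only [Finset.mem_sigma, Finset.mem_compl] at h
      simp only [Finset.erase_insert h.2]
    · rintro ⟨S, y⟩ h
      simp only [Finset.mem_sigma] at h
      simp only [Finset.insert_erase h.2]
    · rintro ⟨S, y⟩ h
      simp only [Finset.mem_sigma, Finset.mem_compl] at h
      simp only [Finset.erase_insert h.2]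

theorem chromPoly_clique (r m : ℕ) :
    chromPoly t r m (fun _ => 0) = C (tFact t r) * esymm (Fin m) K r := by
  rw [chromPoly, colSum_eq, ← smul_eq_C_mul, esymm, ← sum_colWeight_clique]
  refine Finset.sum_congr rfl fun κ _ => ?_
  rw [smul_eq_C_mul]
  by_cases h0 : colWeight t (edge r fun _ => 0) κ = 0
  · rw [h0, map_zero, zero_mul, zero_mul]
  · rw [Finset.prod_image (injective_of_colWeight_ne_zero h0).injOn]

end Cliques

/-! ### Comparison with the definition by proper colorings and ascents -/

section ChromaticQuasisymmetric

variable {K : Type*} [Field K] {t : K}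

open Classical in
theorem colWeight_eq {V α : Type*} [Fintype V] [LinearOrder α] (r : V → V → Prop) (κ : V → α) :
    colWeight t r κ = if ∀ v w, r v w → κ v ≠ κ w then
      t ^ Fintype.card {p : V × V // r p.1 p.2 ∧ κ p.1 < κ p.2} else 0 := by
  split_ifs with h
  · have : ∀ p : V × V, (if r p.1 p.2 then edgeWeight t (κ p.1) (κ p.2) else 1) =
        if r p.1 p.2 ∧ κ p.1 < κ p.2 then t else 1 := by
      intro p
      by_cases hp : r p.1 p.2
      · rw [if_pos hp]
        rcases lt_or_gt_of_ne (h _ _ hp) with h1 | h1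
        · rw [edgeWeight_of_lt h1, if_pos ⟨hp, h1⟩]
        · rw [edgeWeight_of_gt h1, if_neg fun h2 => h1.not_gt h2.2]
      · rw [if_neg hp, if_neg fun h2 => hp h2.1]
    have h2 : colWeight t r κ = ∏ p : V × V, if r p.1 p.2 ∧ κ p.1 < κ p.2 then t else 1 :=
      Finset.prod_congr rfl fun p _ => this p
    rw [h2, Fintype.card_subtype, Finset.prod_ite, Finset.prod_const, Finset.prod_const_one,
      mul_one]
  · push Not at h
    obtain ⟨v, w, h1, h2⟩ := h
    refine Finset.prod_eq_zero (Finset.mem_univ (v, w)) ?_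
    rw [if_pos h1, h2, edgeWeight_self]

/-- The values of a sequence in `𝔼_n` as a function on `ℕ`, counted from `0`. -/
def ESeq.toFun {n : ℕ} (e : ESeq n) (i : ℕ) : ℕ :=
  if h : i < n then (e.val ⟨i, h⟩).toNat else 0

theorem ESeq.toFun_coe {n : ℕ} (e : ESeq n) (i : Fin n) : (e.toFun i : ℤ) = e.val i := by
  rw [ESeq.toFun, dif_pos i.2, Int.toNat_of_nonneg (e.nonneg _)]

theorem ESeq.valid {n : ℕ} (e : ESeq n) : Valid n e.toFun where
  le i hi := by
    have h1 := e.toFun_coe ⟨i, hi⟩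
    have h2 := e.lt ⟨i, hi⟩
    simp only at h1 h2
    omega
  mono i j hij hj := by
    induction j, hij using Nat.le_induction with
    | base => exact le_rfl
    | succ j h ih =>
      have h1 := e.toFun_coe ⟨j, by omega⟩
      have h2 := e.toFun_coe ⟨j + 1, hj⟩
      have h3 := e.mono ⟨j, by omega⟩ ⟨j + 1, hj⟩ rfl
      have h4 := ih (by omega)
      simp only at h1 h2
      omega

theorem chromQuasi_unitIntervalGraph {n : ℕ} (e : ESeq n) (m : ℕ+) :
    chromQuasi t (unitIntervalGraph e) m = chromPoly t n m e.toFun := by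
  classical
  have hadj : ∀ a b, (unitIntervalGraph e).Adj a b ↔ edge n e.toFun a b := by
    intro a b
    have := e.toFun_coe b
    simp only [unitIntervalGraph, edge]
    omega
  have hr : edge n e.toFun = (unitIntervalGraph e).Adj := by
    funext a b
    exact propext (hadj a b).symm
  rw [chromQuasi, chromPoly, colSum_eq, Finset.sum_filter, hr]
  refine Finset.sum_congr (by congr!) fun κ _ => ?_
  rw [colWeight_eq]
  split_ifs
  · congr!
  · rw [map_zero, zero_mul]

end ChromaticQuasisymmetric

/-! ### Vertex operators on elementary symmetric polynomials -/

section ElementarySymmetric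

variable {R : Type*} [CommRing R]

variable (R) in
/-- The elementary symmetric polynomial of degree `r` in `X_0, …, X_{M-1}`. -/
def eN : ℕ → ℕ → MvPolynomial ℕ R
  | _, 0 => 1
  | 0, _ + 1 => 0
  | M + 1, r + 1 => eN M (r + 1) + X M * eN M r

@[simp] theorem eN_zero_right (M : ℕ) : eN R M 0 = 1 := by cases M <;> rfl

@[simp] theorem eN_zero_succ (r : ℕ) : eN R 0 (r + 1) = 0 := rfl

theorem eN_succ (M r : ℕ) : eN R (M + 1) (r + 1) = eN R M (r + 1) + X M * eN R M r := rfl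

theorem eN_eq_sum (M r : ℕ) :
    eN R M r = ∑ S ∈ Finset.powersetCard r (Finset.range M), ∏ i ∈ S, X i := by
  induction M generalizing r with
  | zero =>
    cases r with
    | zero => simp
    | succ r => rw [Finset.powersetCard_eq_empty.2 (by simp), Finset.sum_empty, eN_zero_succ]
  | succ M ih =>
    cases r with
    | zero => simp
    | succ r =>
      have hM : ∀ S ∈ Finset.powersetCard r (Finset.range M), M ∉ S := fun S hS h => by
        simpa using (Finset.mem_powersetCard.1 hS).1 h
      rw [Finset.range_add_one, Finset.powersetCard_succ_insert (by simp), Finset.sum_union,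
        Finset.sum_image, eN_succ, ih, ih, Finset.mul_sum]
      · congr 1
        exact Finset.sum_congr rfl fun S hS => (Finset.prod_insert (hM S hS)).symm
      · intro S hS S' hS' h
        rw [← Finset.erase_insert (hM S hS), h, Finset.erase_insert (hM S' hS')]
      · rw [Finset.disjoint_left]
        intro S hS hS'
        obtain ⟨S', -, rfl⟩ := Finset.mem_image.1 hS'
        simpa using (Finset.mem_powersetCard.1 hS).1 (Finset.mem_insert_self _ _)

theorem sw_eN_of_le {M i : ℕ} (h : M ≤ i) (r : ℕ) : sw i (eN R M r) = eN R M r := by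
  induction M generalizing r with
  | zero => cases r <;> simp
  | succ M ih =>
    cases r with
    | zero => simp
    | succ r =>
      rw [eN_succ, map_add, map_mul, ih (by omega), ih (by omega), sw_X_of_ne (by omega) (by omega)]

theorem sw_eN {M i : ℕ} (h : i + 1 < M) (r : ℕ) : sw i (eN R M r) = eN R M r := by
  induction M, h using Nat.le_induction generalizing r with
  | base =>
    rcases r with _ | _ | r
    · simp
    · simp only [eN_succ, eN_zero_right, map_add, map_mul, map_one, sw_eN_of_le le_rfl, sw_X_left,
        sw_X_right]
      ring
    · simp only [eN_succ, map_add, map_mul, sw_eN_of_le le_rfl, sw_X_left, sw_X_right]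
      ring
  | succ M hM ih =>
    cases r with
    | zero => simp
    | succ r => rw [eN_succ, map_add, map_mul, ih, ih, sw_X_of_ne (by omega) (by omega)]

/-- The substitution `X_i ↦ X_{i+1}`. -/
def shift : MvPolynomial ℕ R →ₐ[R] MvPolynomial ℕ R := rename Nat.succ

theorem shift_X (i : ℕ) : shift (X i : MvPolynomial ℕ R) = X (i + 1) := rename_X _ _

theorem shift_eN_succ (M r : ℕ) :
    shift (eN R (M + 1) (r + 1)) = shift (eN R M (r + 1)) + X (M + 1) * shift (eN R M r) := by
  rw [eN_succ, map_add, map_mul, shift_X]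

theorem eN_succ' (M r : ℕ) :
    eN R (M + 1) (r + 1) = shift (eN R M (r + 1)) + X 0 * shift (eN R M r) := by
  induction M generalizing r with
  | zero => cases r <;> simp [eN_succ]
  | succ M ih =>
    rw [eN_succ, shift_eN_succ, ih]
    cases r with
    | zero => simp only [eN_zero_right, map_one]; ring
    | succ r => rw [shift_eN_succ, ih]; ring

theorem cyc_eN {p : R} {M m : ℕ} (h : M < m) (r : ℕ) : cyc p m (eN R M r) = shift (eN R M r) := by
  induction M generalizing r with
  | zero => cases r <;> simp
  | succ M ih =>
    cases r with
    | zero => simp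
    | succ r =>
      rw [shift_eN_succ, eN_succ, map_add, map_mul, ih (by omega), ih (by omega),
        cyc_X_of_lt (by omega)]

/-- For p = 1 the substitution is a cyclic permutation of the first m variables. This is where q = 1
becomes essential. -/
theorem cyc_one_eN {m : ℕ} (r : ℕ) : cyc 1 m (eN R m r) = eN R m r := by
  rcases m with _ | m
  · cases r <;> simp
  · cases r with
    | zero => simp
    | succ r =>
      rw [eN_succ, map_add, map_mul, cyc_eN (by omega), cyc_eN (by omega),
        cyc_X_last rfl, map_one, one_mul, ← eN_succ, eN_succ']

variable [IsDomain R] {t τ p : R}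

theorem theta_X_left (i : ℕ) : theta τ i (X i) = C τ * X (i + 1) + (C τ - 1) * X i := by
  apply theta_eq_of
  rw [sw_X_left]; ring

theorem theta_X_right (i : ℕ) : theta τ i (X (i + 1)) = X i := by
  apply theta_eq_of
  rw [sw_X_right]; ring

theorem thetaProd_mul {s k : ℕ} {f : MvPolynomial ℕ R}
    (hf : ∀ i, s ≤ i → i < s + k → sw i f = f) (F : MvPolynomial ℕ R) :
    thetaProd τ s k (f * F) = f * thetaProd τ s k F := by
  induction k with
  | zero => rfl
  | succ k ih =>
    rw [thetaProd_succ, thetaProd_succ, ih fun i h1 h2 => hf i h1 (by omega),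
      theta_mul (hf _ (by omega) (by omega))]

theorem thetaSum_mul {s N : ℕ} {f : MvPolynomial ℕ R}
    (hf : ∀ i, s ≤ i → i + 1 < s + N → sw i f = f) (F : MvPolynomial ℕ R) :
    thetaSum τ s N (f * F) = f * thetaSum τ s N F := by
  rw [thetaSum_apply, thetaSum_apply, Finset.mul_sum]
  refine Finset.sum_congr rfl fun k hk => thetaProd_mul (fun i h1 h2 => hf i h1 ?_) F
  rw [Finset.mem_range] at hk; omega

/-- Induction on k. The new factor θ_k commutes with polynomials in X_0, …, X_{k-1} and has to be
computed only on 1, X_k, X_{k+1} and X_k X_{k+1}. -/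
theorem thetaProd_X_mul_shift (htτ : t * τ = 1) (k r : ℕ) :
    t ^ k • thetaProd τ 0 k (X 0 * shift (eN R k r)) =
      C (1 - t ^ (r + 1)) * eN R k (r + 1) + X k * eN R k r := by
  have hC : (C t * C τ : MvPolynomial ℕ R) = 1 := by rw [← C_mul, htτ, C_1]
  induction k generalizing r with
  | zero => cases r <;> simp [thetaProd_zero]
  | succ k ih =>
    have hX : ∀ F : MvPolynomial ℕ R,
        thetaProd τ 0 k (X (k + 1) * F) = X (k + 1) * thetaProd τ 0 k F := fun F =>
      thetaProd_mul (fun i _ h => sw_X_of_ne (by omega) (by omega)) F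
    have h1 : theta τ k (1 : MvPolynomial ℕ R) = C τ := by
      rw [theta_one, smul_eq_C_mul, mul_one]
    have hk : ∀ (s : ℕ) (F : MvPolynomial ℕ R),
        theta τ k (eN R k s * F) = eN R k s * theta τ k F := fun s F =>
      theta_mul (sw_eN_of_le le_rfl s) F
    have hc : ∀ (c : R) (F : MvPolynomial ℕ R), theta τ k (C c * F) = C c * theta τ k F :=
      fun c F => theta_mul (sw_C _ _) F
    have hk1 : ∀ s : ℕ, theta τ k (eN R k s) = C τ * eN R k s := fun s => by
      have := hk s 1
      rwa [mul_one, h1, mul_comm] at this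
    have hXX : ∀ s : ℕ, theta τ k (X (k + 1) * (X k * eN R k s)) =
        C τ * (X (k + 1) * (X k * eN R k s)) := fun s => by
      rw [theta_of_sw, smul_eq_C_mul]
      rw [map_mul, map_mul, sw_X_left, sw_X_right, sw_eN_of_le le_rfl]; ring
    rw [thetaProd_succ, zero_add, pow_succ', mul_smul, ← map_smul]
    cases r with
    | zero =>
      have e := ih 0
      simp only [eN_zero_right, map_one, mul_one, zero_add] at e ⊢
      rw [e, map_add, hc, hk1, theta_X_left, smul_eq_C_mul, eN_succ, eN_zero_right, map_sub,
        map_one, pow_one]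
      linear_combination ((1 - C t) * eN R k 1 + X (k + 1) + X k) * hC
    | succ r =>
      rw [shift_eN_succ, mul_add, mul_left_comm (X 0), map_add, hX, smul_add, ih, ← mul_smul_comm,
        ih, mul_add, map_add, map_add, map_add, hc, hk1, mul_comm (X k), hk, theta_X_left,
        mul_left_comm (X (k + 1)), hc, mul_comm (X (k + 1)) (eN R k (r + 1)), hk, theta_X_right,
        hXX, smul_eq_C_mul, eN_succ, eN_succ]
      simp only [map_sub, map_one, map_pow]
      linear_combination ((1 - C t ^ (r + 2)) * eN R k (r + 2) + eN R k (r + 1) * (X (k + 1) + X k) +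
        X (k + 1) * (X k * eN R k r)) * hC

/-- The geometric sum (t - 1)[s]_t = t^s - 1 makes the terms from `thetaProd_X_mul_shift` telescope
to a t-integer. -/
theorem thetaSum_X_mul_shift (htτ : t * τ = 1) (M r : ℕ) :
    t ^ M • thetaSum τ 0 (M + 1) (X 0 * shift (eN R M r)) =
      C (tInt t (r + 1)) * eN R (M + 1) (r + 1) := by
  induction M generalizing r with
  | zero =>
    cases r <;> simp [thetaSum_succ, thetaSum_zero, thetaProd_zero, eN_succ, tInt]
  | succ M ih =>
    have hX : ∀ F : MvPolynomial ℕ R,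
        thetaSum τ 0 (M + 1) (X (M + 1) * F) = X (M + 1) * thetaSum τ 0 (M + 1) F := fun F =>
      thetaSum_mul (fun i _ h => sw_X_of_ne (by omega) (by omega)) F
    have hg : ∀ s : ℕ, tInt t s * (t - 1) = t ^ s - 1 := fun s => geom_sum_mul t s
    rw [thetaSum_succ, smul_add, thetaProd_X_mul_shift htτ]
    cases r with
    | zero =>
      have e := ih 0
      simp only [eN_zero_right, map_one, mul_one, zero_add, pow_succ', mul_smul] at e ⊢
      rw [e, smul_eq_C_mul, eN_succ (M + 1)]
      simp [tInt]
      ring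
    | succ r =>
      rw [shift_eN_succ, mul_add, mul_left_comm (X 0), map_add, hX, pow_succ', mul_smul, smul_add,
        ih, ← mul_smul_comm, ih, smul_eq_C_mul, eN_succ (M + 1) (r + 1)]
      have h1 := congrArg (C : R → MvPolynomial ℕ R) (hg (r + 2))
      have h2 := congrArg (C : R → MvPolynomial ℕ R) (hg (r + 1))
      have h3 := congrArg (C : R → MvPolynomial ℕ R) (tInt_succ t (r + 1))
      simp only [map_sub, map_one, map_pow, map_mul, map_add] at h1 h2 h3 ⊢
      linear_combination eN R (M + 1) (r + 2) * h1 + X (M + 1) * eN R (M + 1) (r + 1) * (h2 - h3)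

/-- The shift k enters because removing the first vertex of a clique raises the numbers of left
neighbours of the others by one. The polynomial to be rotated involves only X_0, …, X_{m-k-2}, so
the rotation is a mere shift and p plays no role. -/
theorem chain_clique (htτ : t * τ = 1) {m : ℕ} (k r : ℕ) :
    chain t τ p m (fun s => k + s) r 1 =
      (t ^ (k * r + r.choose 2) * tFact t r) • eN R (m - k) r := by
  induction r generalizing k with
  | zero => simp [chain_zero, tFact_zero]
  | succ r ih =>
    rw [chain_succ', add_zero]
    have : (fun s => k + (s + 1)) = fun s => (k + 1) + s := by funext s; omega
    rw [this, ih]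
    rcases Nat.lt_or_ge k m with h | h
    · obtain ⟨M, rfl⟩ : ∃ M, m = k + M + 1 := ⟨m - k - 1, by omega⟩
      rw [map_smul, step_apply, show k + M + 1 - 1 = k + M by omega,
        show k + M + 1 - (k + 1) = M by omega, show k + M + 1 - k = M + 1 by omega, rot_apply,
        cyc_eN (by omega), pow_add t k M,
        mul_smul (t ^ k), thetaSum_X_mul_shift htτ, ← smul_eq_C_mul, smul_smul,
        smul_smul, tFact_succ, Nat.choose_succ_succ' r 1, Nat.choose_one_right]
      congr 1
      ring
    · rw [step_of_le h, Nat.sub_eq_zero_of_le h, eN_zero_succ, smul_zero]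

end ElementarySymmetric

/-! ### The polynomials of unit interval graphs on the Hecke side -/

section UnitIntervalChains

/-- The polynomial attached to the unit interval graph of `e`. -/
def qtPoly {R : Type*} [CommRing R] [IsDomain R] (t τ p : R) (n m : ℕ) (e : ℕ → ℕ) :
    MvPolynomial ℕ R := chain t τ p m (fun i => i - e i) n 1

variable {K : Type*} [Field K] {t τ p : K} {m n : ℕ}

theorem qtPoly_congr {e e' : ℕ → ℕ} (h : ∀ i < n, e i = e' i) :
    qtPoly t τ p n m e = qtPoly t τ p n m e' :=
  chain_congr (fun i hi => by rw [h i hi]) 1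

/-- A valid sequence may be continued to a monotone sequence. -/
theorem Valid.exists_monotone {e : ℕ → ℕ} (he : Valid n e) :
    ∃ e' : ℕ → ℕ, (∀ i < n, e i = e' i) ∧ ∀ i, e' i ≤ e' (i + 1) := by
  refine ⟨fun i => e (min i (n - 1)), fun i hi => by simp only [min_eq_left (show i ≤ n - 1 by omega)],
    fun i => ?_⟩
  rcases Nat.eq_zero_or_pos n with rfl | hn
  · simp
  · exact he.mono _ _ (by omega) (by omega)

theorem qtPoly_eq_chain (j : ℕ) {e : ℕ → ℕ} (l : ℕ) :
    qtPoly t τ p (j + l) m e = chain t τ p m (fun i => i - e i) j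
      (chain t τ p m (fun i => (j + i) - e (j + i)) l 1) :=
  chain_add _ _ _ _

theorem chain_update_of_le {e : ℕ → ℕ} {i c k : ℕ} (h : k ≤ i) (F : MvPolynomial ℕ K) :
    chain t τ p m (fun s => s - Function.update e i c s) k F =
      chain t τ p m (fun s => s - e s) k F :=
  chain_congr (fun s hs => by rw [Function.update_of_ne (by omega)]) F

/-- The first form is `chain_modular`, with the chain of the vertices before i. The second is
`step_step_modular`, whose hypothesis on θ_0 after two rotations is invariance of the later vertices
under θ_{m-2}; this holds since no later vertex has the value i + 1. -/
theorem modular_qtPoly (htτ : t * τ = 1) (hp : p ≠ 0) :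
    Modular t n (qtPoly (R := K) t τ p n m) where
  congr e e' h := qtPoly_congr h
  single e i c hi hci htw hv0 hv2 := by
    obtain ⟨l, rfl⟩ : ∃ l, n = i + 1 + l := ⟨n - (i + 1), by omega⟩
    have hec : e c ≤ c := by
      have := hv0.le c (by omega)
      rwa [Function.update_of_ne (by omega)] at this
    have hle : ∀ x < i, e x ≤ c := fun x hx => by
      have := hv0.mono x i hx.le hi
      rwa [Function.update_of_ne (by omega), Function.update_self] at this
    have hrw : ∀ v, qtPoly t τ p (i + 1 + l) m (Function.update e i v) =
        chain t τ p m (fun s => s - e s) i (step t τ p m (i - v)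
          (chain t τ p m (fun s => (i + 1 + s) - e (i + 1 + s)) l 1)) := by
      intro v
      rw [qtPoly_eq_chain, chain_succ, chain_update_of_le le_rfl, Function.update_self]
      congr 2
      exact chain_congr (fun s _ => by rw [Function.update_of_ne (by omega)]) 1
    rw [hrw, hrw, hrw]
    obtain ⟨s, rfl⟩ : ∃ s, i = c + 2 + s := ⟨i - (c + 2), by omega⟩
    have := chain_modular (m := m) htτ hp (a := fun s => s - e s) (c := c) (s := s)
      (by simp only [← htw]; omega)
      (fun x hx => by have := hle (c + 2 + x) (by omega); omega)
      (chain t τ p m (fun x => (c + 2 + s + 1 + x) - e (c + 2 + s + 1 + x)) l 1)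
    rwa [show c + 2 + s - (c + 1) = s + 1 by omega, show c + 2 + s - (c + 2) = s by omega,
      show c + 2 + s - c = s + 2 by omega]
  double e i c hi hk hv0 hv2 := by
    obtain ⟨l, rfl⟩ : ∃ l, n = i + 2 + l := ⟨n - (i + 2), by omega⟩
    have hci : c + 1 ≤ i := by
      have := hv2.le i (by omega)
      rwa [Function.update_of_ne (by omega), Function.update_self] at this
    -- The invariance lemmas ask for a_{s+1} ≤ a_s + 1 at all indices, hence the continuation of e
    -- beyond n.
    obtain ⟨e', hee', hmono⟩ := hv0.exists_monotone
    set F := chain t τ p m (fun s => (i + 2 + s) - e' (i + 2 + s)) l 1 with hF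
    have hrw : ∀ v w, qtPoly t τ p (i + 2 + l) m
          (Function.update (Function.update e i v) (i + 1) w) =
        chain t τ p m (fun s => s - e s) i (step t τ p m (i - v) (step t τ p m (i + 1 - w) F)) := by
      intro v w
      rw [qtPoly_eq_chain, chain_succ, chain_succ, chain_update_of_le (by omega),
        chain_update_of_le le_rfl, Function.update_self, Function.update_of_ne (by omega),
        Function.update_self]
      congr 3
      refine chain_congr (fun s hs => ?_) 1
      rw [← hee' _ (by omega)]
      simp only [Function.update_of_ne (show i + 2 + s ≠ i + 1 by omega),
        Function.update_of_ne (show i + 2 + s ≠ i by omega)]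
    rw [hrw, hrw, hrw]
    obtain ⟨b, rfl⟩ : ∃ b, i = c + 1 + b := ⟨i - (c + 1), by omega⟩
    rw [show c + 1 + b - c = b + 1 by omega, show c + 1 + b + 1 - (c + 1) = b + 1 by omega,
      show c + 1 + b - (c + 1) = b by omega, show c + 1 + b + 1 - c = b + 2 by omega]
    rcases Nat.lt_or_ge (b + 1) m with hbm | hbm
    · rw [← map_smul, step_step_modular htτ hbm.le, map_add, map_smul]
      obtain ⟨j, rfl⟩ : ∃ j, m = j + 2 := ⟨m - 2, by omega⟩
      rw [← rot_rot_theta hp rfl, hF, theta_chain_of_ne (x := 0) ?_ rfl, map_smul, map_smul]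
      · intro s hs
        have h1 := hk (c + 1 + b + 2 + s) (by omega) (by omega)
        have h2 := hee' (c + 1 + b + 2 + s) (by omega)
        rw [Function.update_of_ne (by omega), Function.update_of_ne (by omega)] at h2
        omega
      · intro s
        have := hmono (c + 1 + b + 2 + s)
        simp only [← add_assoc]
        omega
    · simp [step_of_le hbm]

theorem step_mul_eN (b r : ℕ) (F : MvPolynomial ℕ K) :
    step t τ 1 m b (eN K m r * F) = eN K m r * step t τ 1 m b F := by
  rw [step_apply, step_apply, rot_apply, rot_apply, map_mul (cyc 1 m), cyc_one_eN, mul_left_comm,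
    thetaSum_mul (fun i _ h => sw_eN (by omega) r), mul_smul_comm]

theorem chain_mul_eN (a : ℕ → ℕ) (k r : ℕ) (F : MvPolynomial ℕ K) :
    chain t τ 1 m a k (eN K m r * F) = eN K m r * chain t τ 1 m a k F := by
  induction k generalizing F with
  | zero => rfl
  | succ k ih => rw [chain_succ, step_mul_eN, ih, chain_succ]

/-- The last r vertices form a separate clique and contribute a multiple of e_r in all m variables;
at p = 1 this factor passes through the operators of the earlier vertices. -/
theorem qtPoly_add (htτ : t * τ = 1) {b r : ℕ} {e : ℕ → ℕ}
    (he : ∀ i, b ≤ i → i < b + r → e i = b) :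
    qtPoly t τ 1 (b + r) m e = C (t ^ r.choose 2 * tFact t r) * eN K m r * qtPoly t τ 1 b m e := by
  have h1 : chain t τ 1 m (fun i => (b + i) - e (b + i)) r (1 : MvPolynomial ℕ K) =
      chain t τ 1 m (fun i => 0 + i) r 1 :=
    chain_congr (fun i hi => by rw [he _ (by omega) (by omega)]; omega) 1
  rw [qtPoly_eq_chain, h1, chain_clique htτ, map_smul, ← mul_one (eN K (m - 0) r), Nat.sub_zero,
    chain_mul_eN, zero_mul, zero_add, smul_eq_C_mul, mul_assoc, qtPoly]

theorem theta_qtPoly {e : ℕ → ℕ} (he : Valid n e) {i : ℕ} (hi : i + 1 < m) :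
    theta τ i (qtPoly t τ p n m e) = τ • qtPoly t τ p n m e := by
  obtain ⟨e', hee', hmono⟩ := he.exists_monotone
  rw [qtPoly_congr hee', qtPoly, theta_chain _ (by simpa using hi)]
  intro i
  have := hmono i
  omega

theorem drop_qtPoly (htτ : t * τ = 1) (hm : 1 ≤ m) {e : ℕ → ℕ} (he : Valid n e) :
    drop m (qtPoly t τ p n (m + 1) e) = qtPoly t τ p n m e := by
  obtain ⟨e', hee', hmono⟩ := he.exists_monotone
  rw [qtPoly_congr hee', qtPoly_congr hee', qtPoly, qtPoly, drop_chain htτ hm _ (by simp)]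
  intro i
  have := hmono i
  omega

end UnitIntervalChains

/-! ### Symmetric functions as polynomials in the elementary ones -/

section SymmetricFunctionBasis

variable {K : Type*} [Field K]

theorem esymm_isHomogeneous (m r : ℕ) : (esymm (Fin m) K r).IsHomogeneous r := by
  rw [esymm]
  refine IsHomogeneous.sum _ _ _ fun S hS => ?_
  have := IsHomogeneous.prod S (fun i : Fin m => (X i : MvPolynomial (Fin m) K)) (fun _ => 1)
    fun i _ => isHomogeneous_X K i
  rwa [Finset.sum_const, (Finset.mem_powersetCard.1 hS).2, smul_eq_mul, mul_one] at this

/-- A symmetric polynomial of degree at most `d` is a polynomial in `e_1, …, e_d`. -/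
theorem exists_esymm_expression {m d : ℕ} {f : MvPolynomial (Fin m) K} (hf : f.IsSymmetric)
    (hd : f.totalDegree ≤ d) :
    ∃ Q : MvPolynomial (Fin d) K, aeval (fun i : Fin d => esymm (Fin m) K (i + 1)) Q = f := by
  classical
  obtain ⟨P, hP⟩ := (esymmAlgHom_fin_bijective K m).2 ⟨f, hf⟩
  have hP' : aeval (fun i : Fin m => esymm (Fin m) K (i + 1)) P = f := by
    rw [← esymmAlgHom_apply, hP]
  rw [← AlgHom.mem_range]
  let w : (Fin m →₀ ℕ) → ℕ := fun s => ∑ i : Fin m, ((i : ℕ) + 1) * s i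
  let M : (Fin m →₀ ℕ) → MvPolynomial (Fin m) K := fun s =>
    C (P.coeff s) * ∏ i : Fin m, esymm (Fin m) K (i + 1) ^ s i
  have hM : ∀ s, (M s).IsHomogeneous (w s) := fun s => by
    have := (isHomogeneous_C (Fin m) (P.coeff s)).mul (IsHomogeneous.prod Finset.univ
      (fun i : Fin m => esymm (Fin m) K (i + 1) ^ s i) (fun i : Fin m => ((i : ℕ) + 1) * s i)
      fun i _ => (esymm_isHomogeneous m (i + 1)).pow (s i))
    rwa [zero_add] at this
  have hsum : f = ∑ s ∈ P.support, M s := by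
    rw [← hP', aeval_def, eval₂_eq']
    rfl
  have hlow : f = ∑ s ∈ P.support with w s ≤ d, M s := by
    ext x
    rcases Nat.lt_or_ge d x.degree with h | h
    · rw [coeff_eq_zero_of_totalDegree_lt (lt_of_le_of_lt hd h), coeff_sum]
      refine (Finset.sum_eq_zero fun s hs => (hM s).coeff_eq_zero ?_).symm
      have := (Finset.mem_filter.1 hs).2
      omega
    · conv_lhs => rw [hsum, ← Finset.sum_filter_add_sum_filter_not P.support (fun s => w s ≤ d)]
      rw [coeff_add, add_eq_left, coeff_sum]
      refine Finset.sum_eq_zero fun s hs => (hM s).coeff_eq_zero ?_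
      have := (Finset.mem_filter.1 hs).2
      omega
  rw [hlow]
  refine Subalgebra.sum_mem _ fun s hs => ?_
  refine Subalgebra.mul_mem _ (Subalgebra.algebraMap_mem _ (P.coeff s)) ?_
  refine Subalgebra.prod_mem _ fun i _ => ?_
  by_cases hsi : s i = 0
  · rw [hsi, pow_zero]; exact Subalgebra.one_mem _
  have hid : (i : ℕ) < d := by
    have h1 := (Finset.mem_filter.1 hs).2
    have h2 : ((i : ℕ) + 1) * s i ≤ w s :=
      Finset.single_le_sum (f := fun i : Fin m => ((i : ℕ) + 1) * s i) (fun _ _ => Nat.zero_le _)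
        (Finset.mem_univ i)
    have h3 : ((i : ℕ) + 1) * 1 ≤ ((i : ℕ) + 1) * s i := Nat.mul_le_mul_left _ (by omega)
    omega
  have hmem : esymm (Fin m) K (i + 1) ∈
      (aeval (R := K) fun j : Fin d => esymm (Fin m) K (j + 1)).range :=
    ⟨X ⟨i, hid⟩, aeval_X _ _⟩
  exact Subalgebra.pow_mem _ hmem _

variable (K) in
/-- The algebra homomorphism `y_i ↦ e_{i+1}`. -/
def esymmHom : MvPolynomial ℕ K →ₐ[K] SymmFun K := aeval fun i => elemSymm K (i + 1)

theorem esymmHom_X (i : ℕ) : esymmHom K (X i) = elemSymm K (i + 1) := aeval_X _ _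

theorem esymmHom_apply (P : MvPolynomial ℕ K) (m : ℕ+) :
    (esymmHom K P : (m : ℕ+) → MvPolynomial (Fin m) K) m =
      aeval (fun i : ℕ => esymm (Fin m) K (i + 1)) P := by
  have : ((Pi.evalAlgHom K (fun m : ℕ+ => MvPolynomial (Fin m) K) m).comp
      (SymmFun K).val).comp (esymmHom K) = aeval (fun i : ℕ => esymm (Fin m) K (i + 1)) := by
    apply algHom_ext
    intro i
    rw [AlgHom.comp_apply, esymmHom_X, aeval_X]
    rfl
  exact DFunLike.congr_fun this P

theorem esymmHom_rename {d : ℕ} (Q : MvPolynomial (Fin d) K) (m : ℕ+) :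
    (esymmHom K (rename Fin.val Q) : (m : ℕ+) → MvPolynomial (Fin m) K) m =
      aeval (fun i : Fin d => esymm (Fin m) K (i + 1)) Q := by
  rw [esymmHom_apply, aeval_rename]
  rfl

theorem aeval_esymm_injective {d m : ℕ} (h : d ≤ m) :
    Function.Injective (aeval (R := K) fun i : Fin d => esymm (Fin m) K (i + 1)) := by
  intro P Q hPQ
  apply esymmAlgHom_fin_injective K h
  ext1
  rwa [← esymmAlgHom_apply, ← esymmAlgHom_apply] at hPQ

theorem esymmHom_injective : Function.Injective (esymmHom K) := by
  rw [injective_iff_map_eq_zero]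
  intro P hP
  obtain ⟨d, hd⟩ : ∃ d, ∀ i ∈ P.vars, i < d :=
    ⟨P.vars.sup id + 1, fun i hi => Nat.lt_succ_of_le (Finset.le_sup (f := id) hi)⟩
  obtain ⟨Q, rfl⟩ := exists_rename_eq_of_vars_subset_range P (Fin.val : Fin d → ℕ)
    Fin.val_injective fun i hi => ⟨⟨i, hd i hi⟩, rfl⟩
  have h := esymmHom_rename Q d.succPNat
  rw [hP] at h
  have : Q = 0 := aeval_esymm_injective (Nat.le_succ d) (by rw [map_zero]; exact h.symm)
  rw [this, map_zero]

/-- The degree bound gives one finite set of generators e_1, …, e_d for all m. They are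
algebraically independent in at least d variables, so truncation forces the same expression for
every m > d. The index d + 1 is used because the number of variables must be positive. -/
theorem esymmHom_surjective : Function.Surjective (esymmHom K) := by
  rintro ⟨f, ⟨hf, d, hd⟩, hs⟩
  choose Q hQ using fun m : ℕ+ => exists_esymm_expression (hs m) (hd m)
  have htr : ∀ (m m' : ℕ+), m' < m →
      aeval (fun i : Fin d => esymm (Fin m') K (i + 1)) (Q m) = f m' := by
    intro m m' h
    rw [← hf m m' h, ← hQ m, ← AlgHom.comp_apply]
    congr 1
    apply algHom_ext
    intro i
    rw [AlgHom.comp_apply, aeval_X, aeval_X]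
    exact (trunc_esymm K (le_of_lt h) _).symm
  refine ⟨rename Fin.val (Q d.succPNat), Subtype.ext (funext fun m => ?_)⟩
  rw [esymmHom_rename]
  rcases lt_trichotomy m d.succPNat with h | rfl | h
  · exact htr _ _ h
  · exact hQ _
  · have : Q m = Q d.succPNat := aeval_esymm_injective (Nat.le_succ d)
      ((htr m d.succPNat h).trans (hQ _).symm)
    rw [← this]
    exact hQ m

variable (K) in
/-- The ring of symmetric functions is the polynomial ring in `e_1, e_2, …`. -/
def esymmEquiv : MvPolynomial ℕ K ≃ₐ[K] SymmFun K :=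
  AlgEquiv.ofBijective (esymmHom K) ⟨esymmHom_injective, esymmHom_surjective⟩

theorem esymmEquiv_X (i : ℕ) : esymmEquiv K (X i) = elemSymm K (i + 1) := esymmHom_X i

theorem elemSymm_zero : elemSymm K 0 = 1 := Subtype.ext (funext fun m => esymm_zero (Fin m) K)

theorem symmFun_algHom_ext {A : Type*} [Semiring A] [Algebra K A] {φ ψ : SymmFun K →ₐ[K] A}
    (h : ∀ r, φ (elemSymm K (r + 1)) = ψ (elemSymm K (r + 1))) : φ = ψ := by
  have : φ.comp (esymmEquiv K : MvPolynomial ℕ K →ₐ[K] SymmFun K) =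
      ψ.comp (esymmEquiv K : MvPolynomial ℕ K →ₐ[K] SymmFun K) := by
    apply algHom_ext
    intro i
    change φ (esymmEquiv K (X i)) = ψ (esymmEquiv K (X i))
    rw [esymmEquiv_X, h]
  ext1 F
  obtain ⟨P, rfl⟩ := (esymmEquiv K).surjective F
  exact DFunLike.congr_fun this P

/-- The automorphism of the polynomial ring that scales the variables. -/
def scaleVars (u : ℕ → Kˣ) : MvPolynomial ℕ K ≃ₐ[K] MvPolynomial ℕ K :=
  AlgEquiv.ofAlgHom (aeval fun i => C (u i : K) * X i) (aeval fun i => C ((u i)⁻¹ : Kˣ).val * X i)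
    (by
      apply algHom_ext
      intro i
      simp [← mul_assoc, ← C_mul])
    (by
      apply algHom_ext
      intro i
      simp [← mul_assoc, ← C_mul])

/-- The automorphism of the ring of symmetric functions that scales the `e_r`. -/
def scaleSymm (u : ℕ → Kˣ) : SymmFun K ≃ₐ[K] SymmFun K :=
  ((esymmEquiv K).symm.trans (scaleVars fun i => u (i + 1))).trans (esymmEquiv K)

theorem scaleSymm_elemSymm {u : ℕ → Kˣ} (hu : u 0 = 1) (r : ℕ) :
    scaleSymm u (elemSymm K r) = (u r : K) • elemSymm K r := by
  cases r with
  | zero => rw [elemSymm_zero, map_one, hu, Units.val_one, one_smul]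
  | succ r =>
    rw [scaleSymm, AlgEquiv.trans_apply, AlgEquiv.trans_apply, ← esymmEquiv_X,
      AlgEquiv.symm_apply_apply, ← map_smul, smul_eq_C_mul]
    congr 1
    exact aeval_X _ _

end SymmetricFunctionBasis

/-! ### From polynomials in infinitely many variables to Laurent polynomials -/

section Evaluation

variable {K : Type*} [Field K]

/-- The truncation of polynomials in infinitely many variables to the first `m` variables. -/
def restr (R : Type*) [CommRing R] (m : ℕ) : MvPolynomial ℕ R →ₐ[R] MvPolynomial (Fin m) R :=
  aeval fun i => if h : i < m then X ⟨i, h⟩ else 0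

theorem restr_X_of_lt {R : Type*} [CommRing R] {m i : ℕ} (h : i < m) :
    restr R m (X i) = X ⟨i, h⟩ := by
  rw [restr, aeval_X, dif_pos h]

theorem restr_X_of_le {R : Type*} [CommRing R] {m i : ℕ} (h : m ≤ i) : restr R m (X i) = 0 := by
  rw [restr, aeval_X, dif_neg h.not_gt]

variable (K) in
/-- The value of a polynomial at the first `m` variables in the ring of Laurent polynomials. -/
def evL (m : ℕ) : MvPolynomial ℕ K →ₐ[K] Laurent K m := (toLaurent K m).comp (restr K m)

theorem evL_X_of_le {m i : ℕ} (h : m ≤ i) : evL K m (X i) = 0 := by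
  rw [evL, AlgHom.comp_apply, restr_X_of_le h, map_zero]

theorem intCast_zmod_eq_iff {m : ℕ} {a b : ℤ} (h : |b - a| < m) : (a : ZMod m) = (b : ZMod m) ↔ a = b := by
  rw [ZMod.intCast_eq_intCast_iff_dvd_sub]
  constructor
  · intro hd
    have := Int.eq_zero_of_abs_lt_dvd hd h
    omega
  · rintro rfl; simp

variable (q : Kˣ) {m : ℕ} [NeZero m]

theorem evL_X_of_lt {i : ℕ} (h : i < m) : evL K m (X i) = (Xu q m ((i : ℤ) + 1) : Laurent K m) := by
  rw [evL, AlgHom.comp_apply, restr_X_of_lt h, toLaurent, aeval_X]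
  have := congrArg Units.val (Xu_succ q (⟨i, h⟩ : Fin m))
  exact this.symm

theorem Xu_add_self : (Xu q m ((m : ℤ) + 1) : Laurent K m) =
    algebraMap K (Laurent K m) ((q⁻¹ : Kˣ) : K) * (Xu q m 1 : Laurent K m) := by
  rw [add_comm, Xu_add]
  rfl

theorem shiftX_evL (F : MvPolynomial ℕ K) :
    shiftX q 1 (evL K m F) = evL K m (cyc ((q⁻¹ : Kˣ) : K) m F) := by
  have h0 : 0 < m := Nat.pos_of_ne_zero (NeZero.ne m)
  have : (shiftX q 1).comp (evL K m) = (evL K m).comp (cyc ((q⁻¹ : Kˣ) : K) m) := by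
    apply algHom_ext
    intro j
    rw [AlgHom.comp_apply, AlgHom.comp_apply]
    rcases Nat.lt_or_ge j m with h | h
    · rw [evL_X_of_lt q h, shiftX_Xu]
      rcases Nat.lt_or_ge (j + 1) m with h' | h'
      · rw [cyc_X_of_lt h', evL_X_of_lt q h']; push_cast; rfl
      · obtain rfl : m = j + 1 := by omega
        rw [cyc_X_last rfl, map_mul, evL_X_of_lt q h0]
        have := Xu_add_self q (m := j + 1)
        push_cast at this ⊢
        rw [this]
        congr 1
        exact ((evL K (j + 1)).commutes _).symm
    · rw [cyc_X_of_le h, evL_X_of_le h, map_zero]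
  exact DFunLike.congr_fun this F

theorem piOp_evL (F : MvPolynomial ℕ K) :
    piOp q (evL K m F) = evL K m (rot ((q⁻¹ : Kˣ) : K) m F) := by
  rw [rot_apply, map_mul, ← shiftX_evL, evL_X_of_lt q (Nat.pos_of_ne_zero (NeZero.ne m))]
  simp [piOp]

theorem permX_evL {i : ℕ} (hi : i + 1 < m) (F : MvPolynomial ℕ K) :
    permX q (((i : ℤ) + 1 : ℤ) : ZMod m) (evL K m F) = evL K m (sw i F) := by
  have : (permX q (((i : ℤ) + 1 : ℤ) : ZMod m)).comp (evL K m) = (evL K m).comp (sw i) := by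
    apply algHom_ext
    intro j
    rw [AlgHom.comp_apply, AlgHom.comp_apply]
    rcases Nat.lt_or_ge j m with h | h
    · rw [evL_X_of_lt q h, permX_Xu]
      have h1 : (((j : ℤ) + 1 : ℤ) : ZMod m) = (((i : ℤ) + 1 : ℤ) : ZMod m) ↔ j = i := by
        rw [intCast_zmod_eq_iff (by rw [abs_lt]; omega)]; omega
      have h2 : (((j : ℤ) + 1 : ℤ) : ZMod m) = (((i : ℤ) + 1 : ℤ) : ZMod m) + 1 ↔ j = i + 1 := by
        have : (((i : ℤ) + 1 : ℤ) : ZMod m) + 1 = (((i : ℤ) + 2 : ℤ) : ZMod m) := by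
          push_cast; ring
        rw [this, intCast_zmod_eq_iff (by rw [abs_lt]; omega)]; omega
      simp only [swapIdx, h1, h2]
      split_ifs with g1 g2
      · subst g1
        rw [sw_X_left, evL_X_of_lt q hi]; push_cast; rfl
      · subst g2
        rw [sw_X_right, evL_X_of_lt q (by omega)]; push_cast; congr 2; ring
      · rw [sw_X_of_ne g1 g2, evL_X_of_lt q h]
    · rw [sw_X_of_ne (by omega) (by omega), evL_X_of_le h, map_zero]
  exact DFunLike.congr_fun this F

theorem sOp_evL {i : ℕ} (hi : i + 1 < m) (F : MvPolynomial ℕ K) :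
    sOp q (((i : ℤ) + 1 : ℤ) : ZMod m) (evL K m F) = evL K m (sw i F) := by
  have h0 : (((i : ℤ) + 1 : ℤ) : ZMod m) ≠ 0 := by
    rw [← Int.cast_zero, Ne, intCast_zmod_eq_iff (by rw [abs_lt]; omega)]; omega
  rw [sOp, if_neg (by omega), if_neg h0, AlgHom.toLinearMap_apply, permX_evL q hi]

/-- One composition is enough: T_i acts invertibly, so its inverse must act by θ_i on evaluated
polynomials. The identity is checked after clearing the denominators X_{i+1} and 1 - X_i X_{i+1}⁻¹.
-/
theorem tOp_evL (t : Kˣ) {i : ℕ} (hi : i + 1 < m) (F : MvPolynomial ℕ K) :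
    tOp q t (((i : ℤ) + 1 : ℤ) : ZMod m) (evL K m (theta ((t⁻¹ : Kˣ) : K) i F)) = evL K m F := by
  have hm : m ≠ 1 := by omega
  set z : ZMod m := (((i : ℤ) + 1 : ℤ) : ZMod m) with hz
  set G := theta ((t⁻¹ : Kˣ) : K) i F with hG
  have h1 := congrArg (evL K m) (theta_spec ((t⁻¹ : Kˣ) : K) i F)
  have h2 := congrArg (fun P => evL K m (sw i P)) (theta_spec ((t⁻¹ : Kˣ) : K) i F)
  have h3 := tOp_spec q t hm z (evL K m G)
  rw [sOp_evL q hi] at h3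
  simp only [map_mul, map_sub, map_add, map_one, sw_X_left, sw_X_right, sw_C, sw_sw, ← hG] at h1 h2
  rw [evL_X_of_lt q (show i < m by omega), evL_X_of_lt q hi] at h1 h2
  have hb : (ratio q z : Laurent K m) * (Xu q m ((i : ℤ) + 1 + 1) : Laurent K m) =
      (Xu q m ((i : ℤ) + 1) : Laurent K m) := by
    rw [ratio_eq q hz.symm, ← Units.val_mul, inv_mul_cancel_right]
  have hc : algebraMap K (Laurent K m) t * evL K m (C ((t⁻¹ : Kˣ) : K)) = 1 := by
    rw [show evL K m (C ((t⁻¹ : Kˣ) : K)) = algebraMap K (Laurent K m) ((t⁻¹ : Kˣ) : K) from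
      (evL K m).commutes _, ← map_mul, Units.mul_inv, map_one]
  apply mul_left_cancel₀ (ratio_ne q hm z)
  have hbne : (Xu q m ((i : ℤ) + 1 + 1) : Laurent K m) ≠ 0 := Units.ne_zero _
  apply mul_left_cancel₀ hbne
  apply mul_left_cancel₀ hbne
  apply mul_left_cancel₀ (ratio_ne q hm z)
  simp only [Nat.cast_add, Nat.cast_one] at h1 h2
  generalize (ratio q z : Laurent K m) = ρ at *
  generalize (Xu q m ((i : ℤ) + 1 + 1) : Laurent K m) = b at *
  generalize (Xu q m ((i : ℤ) + 1) : Laurent K m) = a at *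
  generalize algebraMap K (Laurent K m) t = T at *
  generalize evL K m (C ((t⁻¹ : Kˣ) : K)) = τ at *
  subst hb
  linear_combination b * b * (1 - ρ) * h3 + b * (T - 1) * h1 - b * (1 - T * ρ) * h2 +
    b * b * (1 - ρ) * (evL K m (sw i F) - ρ * evL K m F) * hc

end Evaluation

/-! ### Moving Π through the products of partial symmetrizers -/

section Representation

variable {K : Type*} [Field K] {q : Kˣ} {m : ℕ} {f : ℤ → Module.End K (Laurent K m)}

variable {τ : K}

theorem descProd_evL (hf : ∀ i : ℕ, i + 1 < m → ∀ F, f ((i : ℤ) + 1) (evL K m F) =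
    evL K m (theta τ i F)) {k : ℕ} (hk : k < m) (F : MvPolynomial ℕ K) :
    descProd f 1 k (evL K m F) = evL K m (thetaProd τ 0 k F) := by
  induction k with
  | zero => rfl
  | succ k ih =>
    rw [descProd, Module.End.mul_apply, ih (by omega), add_comm, hf k hk, thetaProd_succ, zero_add]

/-- For i = 1 and e = -a the sum has m - a terms, and only operators of index 1, …, m - 1 occur,
which preserve polynomials. For a ≥ m both sides are zero. -/
theorem partialSymm_evL (hf : ∀ i : ℕ, i + 1 < m → ∀ F, f ((i : ℤ) + 1) (evL K m F) =
    evL K m (theta τ i F)) (a : ℕ) (F : MvPolynomial ℕ K) :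
    partialSymm m f 1 (-a) (evL K m F) = evL K m (thetaSum τ 0 (m - a) F) := by
  unfold partialSymm
  rcases Nat.lt_or_ge a m with h | h
  · rw [if_pos (by omega), show ((m : ℤ) + -a - 1).toNat + 1 = m - a by omega, LinearMap.sum_apply,
      thetaSum_apply, map_sum]
    refine Finset.sum_congr rfl fun k hk => descProd_evL hf ?_ F
    rw [Finset.mem_range] at hk; omega
  · rw [if_neg (by omega), Nat.sub_eq_zero_of_le h, thetaSum_zero, map_zero, LinearMap.zero_apply]

variable [NeZero m]

theorem descProd_piOp (hf : ∀ k F, f (k + 1) (piOp q F) = piOp q (f k F)) (i : ℤ) (k : ℕ)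
    (F : Laurent K m) : descProd f (i + 1) k (piOp q F) = piOp q (descProd f i k F) := by
  induction k with
  | zero => rfl
  | succ k ih =>
    rw [descProd, Module.End.mul_apply, ih, add_right_comm, hf, descProd, Module.End.mul_apply]

theorem partialSymm_piOp (hf : ∀ k F, f (k + 1) (piOp q F) = piOp q (f k F)) (i e : ℤ)
    (F : Laurent K m) :
    partialSymm m f (i + 1) (e + 1) (piOp q F) = piOp q (partialSymm m f i e F) := by
  unfold partialSymm
  by_cases h : i - m ≤ e
  · rw [if_pos h, if_pos (by omega), LinearMap.sum_apply, LinearMap.sum_apply, map_sum,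
      show (m + (e + 1) - (i + 1)).toNat = (m + e - i).toNat by congr 1; ring]
    exact Finset.sum_congr rfl fun k _ => descProd_piOp hf i k F
  · rw [if_neg h, if_neg (by omega), LinearMap.zero_apply, LinearMap.zero_apply, map_zero]

theorem partialSymm_piOp_pow (hf : ∀ k F, f (k + 1) (piOp q F) = piOp q (f k F)) (j : ℕ) (e : ℤ)
    (F : Laurent K m) :
    partialSymm m f ((j : ℤ) + 1) e (((piOp q) ^ j) F) =
      ((piOp q) ^ j) (partialSymm m f 1 (e - j) F) := by
  induction j generalizing e with
  | zero => simp
  | succ j ih =>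
    have := partialSymm_piOp hf ((j : ℤ) + 1) (e - 1) (((piOp q) ^ j) F)
    rw [sub_add_cancel] at this
    rw [pow_succ', Module.End.mul_apply, Module.End.mul_apply, Nat.cast_succ, this, ih]
    congr 4
    ring

theorem piOp_pow_one (n : ℕ) : ((piOp q (m := m)) ^ n) 1 = prodX q m n := by
  induction n with
  | zero => simp [prodX]
  | succ n ih =>
    rw [pow_succ', Module.End.mul_apply, ih]
    simp only [piOp, prodX, LinearMap.comp_apply, LinearMap.mulLeft_apply,
      AlgHom.toLinearMap_apply, map_prod, shiftX_Xu]
    rw [Finset.prod_range_succ', mul_comm]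
    push_cast
    rfl

/-- The power Π^j moves to the left through the symmetrizer at j + 1, which becomes the one at 1
with e - j = -a_0, and one rotation stays behind. Only the commutation with Π and the action of the
finite generators are used, so that the T_i⁻¹ and the s_i are treated together. -/
theorem prod_partialSymm {t : K} (hf : ∀ k F, f (k + 1) (piOp q F) = piOp q (f k F))
    (hθ : ∀ i : ℕ, i + 1 < m → ∀ F, f ((i : ℤ) + 1) (evL K m F) = evL K m (theta τ i F))
    (n j : ℕ) (ε : Fin n → ℤ) (a : ℕ → ℕ) (ha : ∀ s : Fin n, (a s : ℤ) = (j : ℤ) + s - ε s) :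
    t ^ (n * (m - 1)) • (List.ofFn fun s : Fin n => partialSymm m f (((j + s : ℕ) : ℤ) + 1)
        (ε s)).prod (((piOp q) ^ (j + n)) 1) =
      ((piOp q) ^ j) (evL K m (chain t τ ((q⁻¹ : Kˣ) : K) m a n 1)) := by
  induction n generalizing j a with
  | zero => simp [chain_zero]
  | succ n ih =>
    have e1 := ih (j + 1) (fun s => ε s.succ) (fun s => a (s + 1)) fun s => by
      have := ha s.succ
      rw [Fin.val_succ] at this
      rw [this]; push_cast; ring
    rw [List.ofFn_succ, List.prod_cons, Module.End.mul_apply, add_mul, one_mul, pow_add, mul_smul,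
      smul_comm, ← map_smul]
    have h1 : (fun s : Fin n => partialSymm m f (((j + s.succ : ℕ) : ℤ) + 1) (ε s.succ)) =
        fun s : Fin n => partialSymm m f (((j + 1 + s : ℕ) : ℤ) + 1) (ε s.succ) := by
      funext s
      rw [Fin.val_succ, add_right_comm, add_assoc]
    have h0 : ε 0 - j = -(a 0 : ℤ) := by
      have := ha 0
      rw [Fin.val_zero] at this
      push_cast at this ⊢
      omega
    rw [h1, show j + (n + 1) = j + 1 + n by omega, e1, Fin.val_zero, add_zero, pow_succ,
      Module.End.mul_apply, partialSymm_piOp_pow hf, h0, piOp_evL, partialSymm_evL hθ, chain_succ',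
      step_apply, map_smul, map_smul]

theorem prod_partialSymm_eq {t : K} (hf : ∀ k F, f (k + 1) (piOp q F) = piOp q (f k F))
    (hθ : ∀ i : ℕ, i + 1 < m → ∀ F, f ((i : ℤ) + 1) (evL K m F) = evL K m (theta τ i F))
    {n : ℕ} (e : ESeq n) :
    t ^ (n * (m - 1)) • (List.ofFn fun s : Fin n => partialSymm m f ((s : ℤ) + 1)
        (e.val s)).prod (prodX q m n) =
      evL K m (qtPoly t τ ((q⁻¹ : Kˣ) : K) n m e.toFun) := by
  have := prod_partialSymm (t := t) hf hθ n 0 e.val (fun s => s - e.toFun s) fun s => by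
    have h1 := e.toFun_coe s
    have h2 := e.lt s
    push_cast
    omega
  simpa [piOp_pow_one, qtPoly] using this

theorem map_partialSymm {A B : Type*} [Ring A] [Ring B] (φ : A →+* B) (m : ℕ) (g : ℤ → A)
    (i e : ℤ) : φ (partialSymm m g i e) = partialSymm m (fun k => φ (g k)) i e := by
  have h : ∀ k, φ (descProd g i k) = descProd (fun k => φ (g k)) i k := by
    intro k
    induction k with
    | zero => exact map_one φ
    | succ k ih => rw [descProd, map_mul, ih, descProd]
  unfold partialSymm
  split_ifs
  · rw [map_sum]
    exact Finset.sum_congr rfl fun k _ => h k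
  · exact map_zero φ

theorem levelOne_heckeT (q t : Kˣ) (i : ZMod m) : levelOne q t m (heckeT t i) = tOp q t i := by
  rw [levelOne, heckeT, RingQuot.liftAlgHom_mkAlgHom_apply, FreeAlgebra.lift_ι_apply]
  rfl

theorem levelOne_inv_tOp (q t : Kˣ) (i : ZMod m) (F : Laurent K m) :
    levelOne q t m (((heckeTu t i)⁻¹ : (AffineHecke K t m)ˣ) : AffineHecke K t m)
      (tOp q t i F) = F := by
  rw [← levelOne_heckeT, ← Module.End.mul_apply, ← map_mul]
  have : (((heckeTu t i)⁻¹ : (AffineHecke K t m)ˣ) : AffineHecke K t m) * heckeT t i = 1 :=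
    (heckeTu t i).inv_mul
  rw [this, map_one, Module.End.one_apply]

theorem tOp_levelOne_inv (q t : Kˣ) (i : ZMod m) (F : Laurent K m) :
    tOp q t i (levelOne q t m (((heckeTu t i)⁻¹ : (AffineHecke K t m)ˣ) : AffineHecke K t m)
      F) = F := by
  rw [← levelOne_heckeT, ← Module.End.mul_apply, ← map_mul]
  have : heckeT t i * (((heckeTu t i)⁻¹ : (AffineHecke K t m)ˣ) : AffineHecke K t m) = 1 :=
    (heckeTu t i).mul_inv
  rw [this, map_one, Module.End.one_apply]

theorem qtChrom_eq (q t : Kˣ) {n : ℕ} (e : ESeq n) :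
    qtChrom q t m e =
      evL K m (qtPoly (t : K) ((t⁻¹ : Kˣ) : K) ((q⁻¹ : Kˣ) : K) n m e.toFun) := by
  rw [qtChrom, map_list_prod, List.map_ofFn, ← prod_partialSymm_eq (t := (t : K)) (f := fun k : ℤ =>
    levelOne q t m (((heckeTu t (k : ZMod m))⁻¹ : (AffineHecke K t m)ˣ) : AffineHecke K t m))]
  · congr 4
    funext s
    exact map_partialSymm (levelOne q t m).toRingHom _ _ _ _
  · intro k F
    have := piOp_tOp q t (k : ZMod m)
      (levelOne q t m (((heckeTu t (k : ZMod m))⁻¹ : (AffineHecke K t m)ˣ) : AffineHecke K t m) F)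
    rw [tOp_levelOne_inv] at this
    rw [this]
    push_cast
    rw [levelOne_inv_tOp]
  · intro i hi F
    conv_lhs => rw [← tOp_evL q t hi F]
    rw [levelOne_inv_tOp]

theorem theta_one_eq_sw (i : ℕ) (F : MvPolynomial ℕ K) : theta 1 i F = sw i F := by
  apply theta_eq_of
  rw [map_one]; ring

theorem katoPoly_eq (q : Kˣ) {n : ℕ} (e : ESeq n) :
    katoPoly q m e = evL K m (qtPoly 1 1 ((q⁻¹ : Kˣ) : K) n m e.toFun) := by
  rw [katoPoly, ← prod_partialSymm_eq (f := fun k : ℤ =>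
    (sOp q (k : ZMod m) : Module.End K (Laurent K m))), one_pow, one_smul]
  · intro k F
    push_cast
    by_cases hm : m = 1
    · simp [sOp, hm]
    · rw [piOp_sOp q hm]
  · intro i hi F
    rw [theta_one_eq_sw]
    exact sOp_evL q hi F

end Representation

/-! ### A degree bound independent of the number of variables -/

section Degree

variable {R : Type*} [CommRing R]

theorem totalDegree_aeval_le {σ τ : Type*} {f : σ → MvPolynomial τ R}
    (hf : ∀ i, (f i).totalDegree ≤ 1) (F : MvPolynomial σ R) :
    (aeval f F).totalDegree ≤ F.totalDegree := by
  rw [aeval_def, eval₂_eq]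
  refine totalDegree_finsetSum_le fun d hd => ?_
  refine (totalDegree_mul _ _).trans ?_
  rw [algebraMap_eq, totalDegree_C, zero_add]
  refine (totalDegree_finsetProd _ _).trans (le_trans ?_ (le_totalDegree hd))
  refine Finset.sum_le_sum fun i _ => (totalDegree_pow _ _).trans ?_
  exact (Nat.mul_le_mul_left _ (hf i)).trans (Nat.mul_one _).le

theorem totalDegree_X_le {σ : Type*} (i : σ) : (X i : MvPolynomial σ R).totalDegree ≤ 1 := by
  exact (totalDegree_monomial_le _ _).trans (Finsupp.sum_single_index rfl).le

theorem totalDegree_cyc_le {p : R} (m : ℕ) (F : MvPolynomial ℕ R) :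
    (cyc p m F).totalDegree ≤ F.totalDegree := by
  refine totalDegree_aeval_le (fun j => ?_) F
  split_ifs
  · exact totalDegree_X_le _
  · refine (totalDegree_mul _ _).trans ?_
    rw [totalDegree_C, zero_add]
    exact totalDegree_X_le _
  · exact totalDegree_X_le _

theorem totalDegree_restr_le (m : ℕ) (F : MvPolynomial ℕ R) :
    (restr R m F).totalDegree ≤ F.totalDegree := by
  refine totalDegree_aeval_le (fun j => ?_) F
  split_ifs
  · exact totalDegree_X_le _
  · rw [totalDegree_zero]; exact Nat.zero_le _

variable [IsDomain R] {t τ p : R}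

/-- In the defining equation both sides carry a linear factor, and over a domain the degree of a
product of nonzero polynomials is the sum of the degrees. -/
theorem totalDegree_theta_le (i : ℕ) (F : MvPolynomial ℕ R) :
    (theta τ i F).totalDegree ≤ F.totalDegree := by
  by_cases h0 : theta τ i F = 0
  · rw [h0, totalDegree_zero]; exact Nat.zero_le _
  have h1 : 1 ≤ (X (i + 1) - X i : MvPolynomial ℕ R).totalDegree := by
    have hc : Finsupp.single i 1 ∈ (X (i + 1) - X i : MvPolynomial ℕ R).support := by
      rw [mem_support_iff, coeff_sub, coeff_X, coeff_X, if_neg, if_pos rfl]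
      · simp
      · intro h
        have := (Finsupp.single_left_inj one_ne_zero).1 h
        omega
    refine le_trans ?_ (le_totalDegree hc)
    rw [Finsupp.sum_single_index rfl]
  have h2 := totalDegree_mul_of_isDomain (X_succ_sub_ne (R := R) i) h0
  rw [theta_spec] at h2
  have h3 : ((C τ * X (i + 1) - X i) * sw i F + (1 - C τ) * X i * F).totalDegree ≤
      1 + F.totalDegree := by
    refine (totalDegree_add _ _).trans (max_le ?_ ?_)
    · refine (totalDegree_mul _ _).trans (add_le_add ?_ (totalDegree_rename_le _ _))
      refine (totalDegree_sub _ _).trans (max_le ?_ (totalDegree_X_le i))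
      refine (totalDegree_mul _ _).trans ?_
      rw [totalDegree_C, zero_add]
      exact totalDegree_X_le _
    · refine (totalDegree_mul _ _).trans (add_le_add_left ?_ _)
      refine (totalDegree_mul _ _).trans ?_
      rw [← C_1, ← C_sub, totalDegree_C, zero_add]
      exact totalDegree_X_le _
  omega

theorem totalDegree_step_le (m b : ℕ) (F : MvPolynomial ℕ R) :
    (step t τ p m b F).totalDegree ≤ 1 + F.totalDegree := by
  have hW : ∀ (k : ℕ) (G : MvPolynomial ℕ R), (thetaProd τ 0 k G).totalDegree ≤ G.totalDegree := by
    intro k G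
    induction k with
    | zero => rw [thetaProd_zero]
    | succ k ih => rw [thetaProd_succ]; exact (totalDegree_theta_le _ _).trans ih
  rw [step_apply, thetaSum_apply, smul_eq_C_mul]
  refine (totalDegree_mul _ _).trans ?_
  rw [totalDegree_C, zero_add]
  refine totalDegree_finsetSum_le fun k _ => (hW k _).trans ?_
  rw [rot_apply]
  exact (totalDegree_mul _ _).trans (add_le_add (totalDegree_X_le _) (totalDegree_cyc_le _ _))

theorem totalDegree_qtPoly_le (n m : ℕ) (e : ℕ → ℕ) : (qtPoly t τ p n m e).totalDegree ≤ n := by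
  suffices H : ∀ (a : ℕ → ℕ) (F : MvPolynomial ℕ R),
      (chain t τ p m a n F).totalDegree ≤ n + F.totalDegree by
    have := H (fun i => i - e i) 1
    rwa [totalDegree_one] at this
  intro a F
  induction n generalizing F with
  | zero => rw [zero_add]; exact le_rfl
  | succ n ih =>
    rw [chain_succ]
    have h1 := ih (step t τ p m (a n) F)
    have h2 := totalDegree_step_le (t := t) (τ := τ) (p := p) m (a n) F
    omega

end Degree

/-! ### Restriction to finitely many variables -/

section Truncation

variable {R : Type*} [CommRing R]

theorem restr_drop (m : ℕ) (F : MvPolynomial ℕ R) : restr R m (drop m F) = restr R m F := by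
  have : (restr R m).comp (drop m) = restr R m := by
    apply algHom_ext
    intro j
    rw [AlgHom.comp_apply]
    rcases lt_trichotomy j m with h | h | h
    · rw [drop_X_of_lt h]
    · rw [h, drop_X_self, map_zero, restr_X_of_le le_rfl]
    · rw [drop_X_of_gt h, restr_X_of_le (by omega), restr_X_of_le h.le]
  exact DFunLike.congr_fun this F

theorem trunc_restr {K : Type*} [Field K] {m m' : ℕ} (h : m' ≤ m) (F : MvPolynomial ℕ K) :
    trunc K m m' (restr K m F) = restr K m' F := by
  have : (trunc K m m').comp (restr K m) = restr K m' := by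
    apply algHom_ext
    intro j
    rw [AlgHom.comp_apply]
    rcases Nat.lt_or_ge j m with h1 | h1
    · rw [restr_X_of_lt h1, trunc, aeval_X, restr, aeval_X]
    · rw [restr_X_of_le h1, map_zero, restr_X_of_le (h.trans h1)]
  exact DFunLike.congr_fun this F

theorem isSymmetric_restr {m : ℕ} {F : MvPolynomial ℕ R} (hF : ∀ i, i + 1 < m → sw i F = F) :
    (restr R m F).IsSymmetric := by
  rcases m with _ | m
  · intro σ
    rw [Subsingleton.elim σ 1]
    exact rename_id_apply _
  have hs : ∀ i : Fin m, rename (Equiv.swap i.castSucc i.succ) (restr R (m + 1) F) =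
      restr R (m + 1) F := by
    intro i
    have : (rename (Equiv.swap i.castSucc i.succ) : MvPolynomial (Fin (m + 1)) R →ₐ[R] _).comp
        (restr R (m + 1)) = (restr R (m + 1)).comp (sw (i : ℕ)) := by
      apply algHom_ext
      intro j
      rw [AlgHom.comp_apply, AlgHom.comp_apply]
      by_cases h1 : j = i
      · subst h1
        rw [sw_X_left, restr_X_of_lt (by omega), restr_X_of_lt (by omega), rename_X]
        congr 1
        exact Equiv.swap_apply_left _ _
      by_cases h2 : j = i + 1
      · subst h2
        rw [sw_X_right, restr_X_of_lt (by omega), restr_X_of_lt (by omega), rename_X]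
        congr 1
        exact Equiv.swap_apply_right _ _
      rw [sw_X_of_ne h1 h2]
      rcases Nat.lt_or_ge j (m + 1) with h | h
      · rw [restr_X_of_lt h, rename_X, Equiv.swap_apply_of_ne_of_ne]
        · simpa [Fin.ext_iff] using h1
        · simpa [Fin.ext_iff] using h2
      · rw [restr_X_of_le h, map_zero]
    have h := DFunLike.congr_fun this F
    rw [AlgHom.comp_apply, AlgHom.comp_apply, hF i (by omega)] at h
    exact h
  intro σ
  have hσ : σ ∈ Submonoid.closure
      (Set.range fun i : Fin m => Equiv.swap i.castSucc i.succ) := by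
    rw [Equiv.Perm.mclosure_swap_castSucc_succ]
    trivial
  induction hσ using Submonoid.closure_induction with
  | mem x hx => obtain ⟨i, rfl⟩ := hx; exact hs i
  | one => exact rename_id_apply _
  | mul x y _ _ hx hy =>
    rw [Equiv.Perm.coe_mul, ← rename_rename, hy, hx]

end Truncation

/-! ### Families over all m as elements of the projective limit -/

section Families

variable {K : Type*} [Field K] {n : ℕ}

/-- The family of the polynomials attached to `e` in any number of variables. -/
def qtFam (t τ p : K) (n : ℕ) (e : ℕ → ℕ) (m : ℕ+) : MvPolynomial (Fin m) K :=
  restr K m (qtPoly t τ p n m e)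

/-- The family of the chromatic quasisymmetric polynomials of `e`. -/
def chromFam (t : K) (n : ℕ) (e : ℕ → ℕ) (m : ℕ+) : MvPolynomial (Fin m) K := chromPoly t n m e

variable {t τ p : K}

theorem qtFam_isSymmetric {e : ℕ → ℕ} (he : Valid n e) (m : ℕ+) :
    (qtFam t τ p n e m).IsSymmetric :=
  isSymmetric_restr fun _ hi => sw_of_theta (theta_qtPoly he hi)

theorem restr_qtPoly (htτ : t * τ = 1) {e : ℕ → ℕ} (he : Valid n e) {m m' : ℕ} (h0 : 1 ≤ m')
    (h : m' ≤ m) : restr K m' (qtPoly t τ p n m e) = restr K m' (qtPoly t τ p n m' e) := by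
  induction m, h using Nat.le_induction with
  | base => rfl
  | succ m h ih =>
    rw [← ih, ← trunc_restr h, ← restr_drop, drop_qtPoly htτ (by omega) he, trunc_restr h]

theorem trunc_qtFam (htτ : t * τ = 1) {e : ℕ → ℕ} (he : Valid n e) {m m' : ℕ+} (h : m' < m) :
    trunc K m m' (qtFam t τ p n e m) = qtFam t τ p n e m' := by
  have h' : (m' : ℕ) ≤ m := le_of_lt h
  rw [qtFam, trunc_restr h', restr_qtPoly htτ he m'.pos h', qtFam]

theorem qtFam_mem (htτ : t * τ = 1) {e : ℕ → ℕ} (he : Valid n e) :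
    qtFam t τ p n e ∈ SymmFun K :=
  ⟨⟨fun _ _ h => trunc_qtFam htτ he h, n, fun _ =>
    (totalDegree_restr_le _ _).trans (totalDegree_qtPoly_le _ _ _)⟩, qtFam_isSymmetric he⟩

theorem Modular.pi {ι : Type*} {V : ι → Type*} [∀ i, AddCommGroup (V i)] [∀ i, Module K (V i)]
    {f : ∀ i, (ℕ → ℕ) → V i} (hf : ∀ i, Modular t n (f i)) :
    Modular t n fun e i => f i e where
  congr e e' h := funext fun i => (hf i).congr e e' h
  single e i c h1 h2 h3 h4 h5 := funext fun j => (hf j).single e i c h1 h2 h3 h4 h5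
  double e i c h1 h2 h3 h4 := funext fun j => (hf j).double e i c h1 h2 h3 h4

theorem modular_chromFam [CharZero K] : Modular t n (chromFam (K := K) t n) :=
  Modular.pi fun m => modular_chromPoly m

theorem modular_qtFam (htτ : t * τ = 1) (hp : p ≠ 0) : Modular t n (qtFam (K := K) t τ p n) :=
  Modular.pi fun m : ℕ+ => (modular_qtPoly htτ hp).comp (restr K m).toLinearMap

theorem restr_eN (m r : ℕ) : restr K m (eN K m r) = esymm (Fin m) K r := by
  have hr : Finset.range m = (Finset.univ : Finset (Fin m)).map Fin.valEmbedding := by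
    rw [Fin.map_valEmbedding_univ, Nat.Iio_eq_range]
  rw [eN_eq_sum, hr, Finset.powersetCard_map, Finset.sum_map, map_sum,
    esymm]
  refine Finset.sum_congr rfl fun S _ => ?_
  change restr K m (∏ i ∈ S.map Fin.valEmbedding, X i) = _
  rw [Finset.prod_map, map_prod]
  exact Finset.prod_congr rfl fun i _ => restr_X_of_lt i.2

end Families

/-! ### Comparison of the two families at p = 1 -/

section Comparison

variable {K : Type*} [Field K]

/-- The scalars `t^{r(r-1)/2}`. -/
def triangularPow (t : Kˣ) (r : ℕ) : Kˣ := t ^ r.choose 2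

/-- Induction on n by splitting off the component of the last vertex. Its first vertex b is a fixed
point of e, so the vertices from b on form a separate clique. This multiplies G by [r]_t! e_r, and
the power of t produced by the Hecke side is the scalar by which e_r is scaled. -/
theorem exists_symmFun_of_not_bad (t : Kˣ) {n : ℕ} {e : ℕ → ℕ} (he : Valid n e)
    (hb : ∀ v, ¬ Bad n e v) : ∃ G : SymmFun K,
      (G : (m : ℕ+) → MvPolynomial (Fin m) K) = chromFam (t : K) n e ∧
      (scaleSymm (triangularPow t) G : (m : ℕ+) → MvPolynomial (Fin m) K) =
        qtFam (t : K) ((t⁻¹ : Kˣ) : K) 1 n e := by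
  induction n using Nat.strong_induction_on with
  | _ n ih =>
  rcases Nat.eq_zero_or_pos n with rfl | hn
  · refine ⟨1, funext fun m => ?_, funext fun m => ?_⟩
    · simp [chromFam, chromPoly, colSum_eq, colWeight]
    · rw [map_one, qtFam, qtPoly, chain_zero, map_one]
      rfl
  obtain ⟨b, hbn⟩ : ∃ b, e (n - 1) = b := ⟨_, rfl⟩
  have hle := he.le (n - 1) (by omega)
  obtain ⟨r, rfl⟩ : ∃ r, n = b + r := ⟨n - b, by omega⟩
  have hr : 1 ≤ r := by omega
  have hblock : ∀ i, b ≤ i → i < b + r → e i = b := by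
    intro i h1 h2
    have h3 := he.mono i (b + r - 1) (by omega) (by omega)
    have h4 := he.mono b i h1 h2
    have h5 := he.apply_apply_of_not_bad hb (k := b + r - 1) (by omega)
    rw [hbn] at h5
    omega
  obtain ⟨G, hG1, hG2⟩ := ih b (by omega) ⟨fun i hi => he.le i (by omega),
    fun i j hij hj => he.mono i j hij (by omega)⟩ fun v ⟨h1, ⟨k, hk, hkv⟩, h3⟩ =>
      hb v ⟨h1, ⟨k, by omega, hkv⟩, h3⟩
  refine ⟨G * (tFact (t : K) r • elemSymm K r), funext fun m => ?_, funext fun m => ?_⟩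
  · rw [chromFam, chromPoly_add hblock, chromPoly_clique]
    change (G : (m : ℕ+) → MvPolynomial (Fin m) K) m * (tFact (t : K) r • esymm (Fin m) K r) = _
    rw [hG1, smul_eq_C_mul]
    rfl
  · rw [map_mul, map_smul, scaleSymm_elemSymm (by simp [triangularPow])]
    change (scaleSymm (triangularPow t) G : (m : ℕ+) → MvPolynomial (Fin m) K) m *
      (tFact (t : K) r • (triangularPow t r : K) • esymm (Fin m) K r) = _
    rw [hG2, qtFam, qtFam, qtPoly_add t.mul_inv hblock, map_mul, map_mul, restr_eN, ← algebraMap_eq,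
      AlgHom.commutes, algebraMap_eq, smul_smul, smul_eq_C_mul, triangularPow, Units.val_pow_eq_pow_val]
    ring_nf

/-- Uniqueness for the modular law is applied to the class modulo the symmetric functions, which
vanishes on disjoint unions of complete graphs. -/
theorem chromFam_mem [CharZero K] {t : Kˣ}
    (hq : ∀ N : ℕ, ∑ i ∈ Finset.range (N + 1), (t : K) ^ i ≠ 0) {n : ℕ} {e : ℕ → ℕ}
    (he : Valid n e) : chromFam (t : K) n e ∈ SymmFun K := by
  have h := ((modular_chromFam (K := K) (t := (t : K)) (n := n)).comp
    (Subalgebra.toSubmodule (SymmFun K)).mkQ).eq_zero t.ne_zero hq (fun e he hb => ?_) he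
  · rwa [Submodule.mkQ_apply, Submodule.Quotient.mk_eq_zero] at h
  · obtain ⟨G, hG, -⟩ := exists_symmFun_of_not_bad t he hb
    rw [Submodule.mkQ_apply, Submodule.Quotient.mk_eq_zero, ← hG]
    exact G.2

/-- At `p = 1` the polynomials attached to `e` are given by the chromatic quasisymmetric
function. -/
theorem scaleSymm_chromFam [CharZero K] {t : Kˣ}
    (hq : ∀ N : ℕ, ∑ i ∈ Finset.range (N + 1), (t : K) ^ i ≠ 0) {n : ℕ} {e : ℕ → ℕ}
    (he : Valid n e) :
    (scaleSymm (triangularPow t) ⟨chromFam (t : K) n e, chromFam_mem hq he⟩ :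
      (m : ℕ+) → MvPolynomial (Fin m) K) = qtFam (t : K) ((t⁻¹ : Kˣ) : K) 1 n e := by
  -- The scaling is defined on symmetric functions only; a linear extension to all families makes it
  -- possible to compose it with the modular function.
  obtain ⟨g, hg⟩ := LinearMap.exists_extend (p := Subalgebra.toSubmodule (SymmFun K))
    ((Subalgebra.toSubmodule (SymmFun K)).subtype ∘ₗ (scaleSymm (triangularPow t)).toLinearMap)
  have hg' : ∀ G : SymmFun K, g (G : (m : ℕ+) → MvPolynomial (Fin m) K) =
      (scaleSymm (triangularPow t) G : (m : ℕ+) → MvPolynomial (Fin m) K) := fun G =>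
    DFunLike.congr_fun hg G
  have h := ((modular_chromFam (K := K) (t := (t : K)) (n := n)).comp g).sub
    (modular_qtFam (p := 1) t.mul_inv one_ne_zero) |>.eq_zero t.ne_zero hq (fun e he hb => ?_) he
  · rw [sub_eq_zero] at h
    rw [← h, ← hg']
  · obtain ⟨G, hG1, hG2⟩ := exists_symmFun_of_not_bad t he hb
    rw [← hG1, hg', hG2, sub_self]

/-- At t = 1 all scalars t^(r(r-1)/2) are 1, so the scaling automorphism is the identity; the
t-integers are positive integers, nonzero in characteristic zero. -/
theorem qtFam_one_eq_chromFam [CharZero K] {n : ℕ} {e : ℕ → ℕ} (he : Valid n e) :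
    qtFam (1 : K) 1 1 n e = chromFam 1 n e := by
  have hq : ∀ N : ℕ, ∑ i ∈ Finset.range (N + 1), ((1 : Kˣ) : K) ^ i ≠ 0 := fun N => by
    simpa using Nat.cast_add_one_ne_zero N
  have h := scaleSymm_chromFam hq he
  have hid : (scaleSymm (triangularPow (1 : Kˣ)) : SymmFun K →ₐ[K] SymmFun K) = AlgHom.id K _ := by
    apply symmFun_algHom_ext
    intro r
    change scaleSymm (triangularPow (1 : Kˣ)) (elemSymm K (r + 1)) = elemSymm K (r + 1)
    rw [scaleSymm_elemSymm (by simp [triangularPow])]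
    simp [triangularPow]
  have h2 : ∀ G : SymmFun K, scaleSymm (triangularPow (1 : Kˣ)) G = G := fun G =>
    DFunLike.congr_fun hid G
  rw [h2] at h
  simpa using h.symm

end Comparison

/-! ### Compatibility with homomorphisms of the coefficient ring -/

section BaseChange

variable {R R' : Type*} [CommRing R] [CommRing R'] (φ : R →+* R')

theorem map_cyc (p : R) (m : ℕ) (F : MvPolynomial ℕ R) :
    map φ (cyc p m F) = cyc (φ p) m (map φ F) := by
  induction F using MvPolynomial.induction_on with
  | C a => simp
  | add F G hF hG => simp only [map_add, hF, hG]
  | mul_X F j h =>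
    simp only [map_mul, h, map_X, cyc_X]
    congr 1
    split_ifs <;> simp

theorem map_restr (m : ℕ) (F : MvPolynomial ℕ R) :
    map φ (restr R m F) = restr R' m (map φ F) := by
  induction F using MvPolynomial.induction_on with
  | C a => simp [restr]
  | add F G hF hG => simp only [map_add, hF, hG]
  | mul_X F j h =>
    rw [map_mul, map_mul, h, map_mul, map_mul, map_X, restr, aeval_X, restr, aeval_X]
    congr 1
    split_ifs <;> simp

variable [IsDomain R] [IsDomain R'] {t τ p : R}

theorem map_thetaProd (k : ℕ) (F : MvPolynomial ℕ R) :
    map φ (thetaProd τ 0 k F) = thetaProd (φ τ) 0 k (map φ F) := by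
  induction k with
  | zero => rfl
  | succ k ih =>
    rw [thetaProd_succ, thetaProd_succ, ← ih]
    exact map_theta (map φ) (map_C _ _) one_ne_zero (by rw [map_X, one_mul])
      (by rw [map_X, one_mul]) (map_rename _ _ _)

theorem map_step (m b : ℕ) (F : MvPolynomial ℕ R) :
    map φ (step t τ p m b F) = step (φ t) (φ τ) (φ p) m b (map φ F) := by
  rw [step_apply, step_apply, smul_eq_C_mul, smul_eq_C_mul, map_mul, map_C, map_pow, thetaSum_apply,
    thetaSum_apply, map_sum, rot_apply, rot_apply]
  congr 1
  refine Finset.sum_congr rfl fun k _ => ?_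
  rw [map_thetaProd, map_mul, map_X, map_cyc]

theorem map_qtPoly (n m : ℕ) (e : ℕ → ℕ) :
    map φ (qtPoly t τ p n m e) = qtPoly (φ t) (φ τ) (φ p) n m e := by
  suffices H : ∀ (a : ℕ → ℕ) (F : MvPolynomial ℕ R), map φ (chain t τ p m a n F) =
      chain (φ t) (φ τ) (φ p) m a n (map φ F) by
    rw [qtPoly, H, map_one]; rfl
  intro a F
  induction n generalizing F with
  | zero => rfl
  | succ n ih => rw [chain_succ, ih, map_step, chain_succ]

theorem map_restr_qtPoly (n m : ℕ) (e : ℕ → ℕ) :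
    map φ (restr R m (qtPoly t τ p n m e)) =
      restr R' m (qtPoly (φ t) (φ τ) (φ p) n m e) := by
  rw [map_restr, map_qtPoly]

end BaseChange

/-! ### Specialization at q = 1 -/

section ValueAtOne

/-- The coefficients of the Laurent polynomial of a polynomial come from the coefficients of the
polynomial. -/
theorem exists_coeff_toLaurent {R K : Type*} [CommRing R] [Field K] {m : ℕ}
    (P : MvPolynomial (Fin m) R) (a : Fin m → ℤ) :
    ∃ c : R, ∀ ψ : R →+* K, (toLaurent K m (map ψ P)).coeff a = ψ c := by
  induction P using MvPolynomial.induction_on generalizing a with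
  | C r =>
    refine ⟨if a = 0 then r else 0, fun ψ => ?_⟩
    rw [map_C, ← algebraMap_eq, AlgHom.commutes]
    change Finsupp.single (0 : Fin m → ℤ) (ψ r) a = _
    rw [Finsupp.single_apply]
    split_ifs with h1 h2 h2
    · rfl
    · exact absurd h1.symm h2
    · exact absurd h2.symm h1
    · rw [map_zero]
  | add F G hF hG =>
    obtain ⟨c, hc⟩ := hF a
    obtain ⟨d, hd⟩ := hG a
    refine ⟨c + d, fun ψ => ?_⟩
    rw [map_add, map_add, AddMonoidAlgebra.coeff_add, Finsupp.add_apply, hc, hd, map_add]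
  | mul_X F j h =>
    obtain ⟨c, hc⟩ := h (a - Pi.single j 1)
    refine ⟨c, fun ψ => ?_⟩
    rw [map_mul, map_mul, map_X, ← hc ψ]
    have : toLaurent K m (X j) = AddMonoidAlgebra.single (Pi.single j 1) 1 := aeval_X _ _
    rw [this, AddMonoidAlgebra.coeff_mul_single_eq_coeff_mul (a - Pi.single j 1), mul_one]
    intro b _
    exact eq_sub_iff_add_eq.symm

/-- The elements of `ℚ(q, t)` without pole at `q = 1`. -/
def regularAtOne : Subring QQt where
  carrier := {c | c.denom.eval₂ (RingHom.id (RatFunc ℚ)) 1 ≠ 0}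
  mul_mem' {a b} ha hb := fun h => by
    have := Polynomial.eval₂_eq_zero_of_dvd_of_eval₂_eq_zero _ _ (RatFunc.denom_mul_dvd a b) h
    rw [Polynomial.eval₂_mul] at this
    exact (mul_ne_zero ha hb) this
  one_mem' := by simp
  add_mem' {a b} ha hb := fun h => by
    have := Polynomial.eval₂_eq_zero_of_dvd_of_eval₂_eq_zero _ _ (RatFunc.denom_add_dvd a b) h
    rw [Polynomial.eval₂_mul] at this
    exact (mul_ne_zero ha hb) this
  zero_mem' := by simp
  neg_mem' {a} ha := fun h => by
    have h1 : -a = RatFunc.C (-1) * a := by rw [map_neg, map_one, neg_one_mul]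
    rw [h1] at h
    have := Polynomial.eval₂_eq_zero_of_dvd_of_eval₂_eq_zero _ _ (RatFunc.denom_mul_dvd _ a) h
    rw [Polynomial.eval₂_mul, RatFunc.denom_C, Polynomial.eval₂_one, one_mul] at this
    exact ha this

/-- The value at `q = 1`. -/
def valueAtOne : regularAtOne →+* QQt where
  toFun c := scalarAtOne c
  map_one' := by simp [scalarAtOne]
  map_zero' := by simp [scalarAtOne]
  map_mul' a b := (congrArg RatFunc.C (RatFunc.eval_mul _ _ a.2 b.2)).trans (map_mul _ _ _)
  map_add' a b := (congrArg RatFunc.C (RatFunc.eval_add _ _ a.2 b.2)).trans (map_add _ _ _)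

theorem C_mem_regularAtOne (c : RatFunc ℚ) : RatFunc.C c ∈ regularAtOne := by
  change Polynomial.eval₂ _ _ (RatFunc.denom (RatFunc.C c)) ≠ 0
  rw [RatFunc.denom_C, Polynomial.eval₂_one]
  exact one_ne_zero

theorem scalarAtOne_C (c : RatFunc ℚ) : scalarAtOne (RatFunc.C c) = RatFunc.C c := by
  simp [scalarAtOne]

theorem qVar_mem_regularAtOne : (qVar : QQt) ∈ regularAtOne := by
  change Polynomial.eval₂ _ _ (RatFunc.denom (RatFunc.X : QQt)) ≠ 0
  rw [RatFunc.denom_X, Polynomial.eval₂_one]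
  exact one_ne_zero

theorem inv_qVar_mem_regularAtOne : ((qVar⁻¹ : QQtˣ) : QQt) ∈ regularAtOne := by
  change Polynomial.eval₂ _ _ (RatFunc.denom (RatFunc.X⁻¹ : QQt)) ≠ 0
  intro h
  have := Polynomial.eval₂_eq_zero_of_dvd_of_eval₂_eq_zero _ _
    (RatFunc.denom_inv_dvd (K := RatFunc ℚ) RatFunc.X_ne_zero) h
  rw [RatFunc.num_X, Polynomial.eval₂_X] at this
  exact one_ne_zero this

theorem valueAtOne_inv_qVar : valueAtOne ⟨_, inv_qVar_mem_regularAtOne⟩ = 1 := by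
  have h1 : valueAtOne ⟨_, qVar_mem_regularAtOne⟩ = 1 := by
    change scalarAtOne RatFunc.X = 1
    simp [scalarAtOne]
  -- The value of q⁻¹ follows from that of q because specialization is a ring homomorphism.
  have h2 : (⟨_, inv_qVar_mem_regularAtOne⟩ : regularAtOne) * ⟨_, qVar_mem_regularAtOne⟩ = 1 :=
    Subtype.ext (Units.inv_mul qVar)
  have h3 := congrArg valueAtOne h2
  rwa [map_mul, map_one, h1, mul_one] at h3

theorem inv_tVar : ((tVar⁻¹ : QQtˣ) : QQt) = RatFunc.C (RatFunc.X⁻¹ : RatFunc ℚ) := by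
  rw [Units.val_inv_eq_inv_val, map_inv₀]
  rfl

theorem atQOne_map {m : ℕ} (P : MvPolynomial (Fin m) regularAtOne) :
    atQOne (map regularAtOne.subtype P) = map valueAtOne P := by
  refine MvPolynomial.ext _ _ fun d => ?_
  change scalarAtOne (coeff d (map regularAtOne.subtype P)) = _
  rw [coeff_map, coeff_map]
  rfl

theorem atQOne_toLaurent_map {m : ℕ} (P : MvPolynomial (Fin m) regularAtOne) :
    atQOne (toLaurent QQt m (map regularAtOne.subtype P)) =
      toLaurent QQt m (map valueAtOne P) := by
  refine AddMonoidAlgebra.ext (Finsupp.ext fun a => ?_)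
  -- One element c describes the coefficient under both the inclusion and the specialization.
  obtain ⟨c, hc⟩ := exists_coeff_toLaurent (K := QQt) P a
  change scalarAtOne ((toLaurent QQt m (map regularAtOne.subtype P)).coeff a) = _
  rw [hc, hc]
  rfl

/-- The sum comes from a polynomial over ℚ whose value at 1 is N + 1. -/
theorem tVar_sum_ne_zero (N : ℕ) : ∑ i ∈ Finset.range (N + 1), (tVar : QQt) ^ i ≠ 0 := by
  have h1 : ∑ i ∈ Finset.range (N + 1), (tVar : QQt) ^ i =
      RatFunc.C (∑ i ∈ Finset.range (N + 1), (RatFunc.X : RatFunc ℚ) ^ i) := by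
    rw [map_sum]
    exact Finset.sum_congr rfl fun i _ => (map_pow RatFunc.C RatFunc.X i).symm
  have h2 : ∑ i ∈ Finset.range (N + 1), (RatFunc.X : RatFunc ℚ) ^ i =
      algebraMap (Polynomial ℚ) (RatFunc ℚ)
        (∑ i ∈ Finset.range (N + 1), (Polynomial.X : Polynomial ℚ) ^ i) := by
    rw [map_sum]
    exact Finset.sum_congr rfl fun i _ => by rw [map_pow, RatFunc.algebraMap_X]
  have h3 : ∑ i ∈ Finset.range (N + 1), (Polynomial.X : Polynomial ℚ) ^ i ≠ 0 := by
    intro h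
    have := congrArg (Polynomial.eval 1) h
    rw [Polynomial.eval_finsetSum] at this
    simp only [Polynomial.eval_pow, Polynomial.eval_X, one_pow, Finset.sum_const,
      Finset.card_range, nsmul_eq_mul, mul_one, Polynomial.eval_zero] at this
    exact Nat.cast_ne_zero.2 (Nat.succ_ne_zero N) this
  rw [h1, h2]
  exact (map_ne_zero _).2 ((map_ne_zero_iff _ (RatFunc.algebraMap_injective ℚ)).2 h3)

end ValueAtOne

end QTChrom

end

/-! ### Assembly of Theorem A -/

theorem theoremA :
    ∃ N : SymmFun QQt ≃ₐ[QQt] SymmFun QQt,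
      (∀ r : ℕ, N (elemSymm QQt r) = (tVar : QQt) ^ (r * (r - 1) / 2) • elemSymm QQt r) ∧
      (∀ N' : SymmFun QQt →ₐ[QQt] SymmFun QQt,
        (∀ r : ℕ, N' (elemSymm QQt r) = (tVar : QQt) ^ (r * (r - 1) / 2) • elemSymm QQt r) →
          ∀ F, N' F = N F) ∧
      ∀ (n : ℕ) (e : ESeq n), ∃ P : (m : ℕ+) → MvPolynomial (Fin m) QQt,
        -- (i)
        (∀ m : ℕ+, toLaurent QQt m (P m) = qtChrom qVar tVar m e) ∧
        (∀ m : ℕ+, (P m).IsSymmetric ∧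
          ∀ d, (P m).coeff d ∈
            Algebra.adjoin ℤ ({(qVar : QQt)⁻¹, (tVar : QQt), (tVar : QQt)⁻¹} : Set QQt)) ∧
        -- (ii)
        (∀ m m' : ℕ+, m' < m → trunc QQt m m' (P m) = P m') ∧
        P ∈ SymmFun QQt ∧
        -- (iii)
        (∃ h : chromQuasi (tVar : QQt) (unitIntervalGraph e) ∈ SymmFun QQt,
          (fun m : ℕ+ => atQOne (P m)) =
            (N ⟨chromQuasi (tVar : QQt) (unitIntervalGraph e), h⟩ :
              (m : ℕ+) → MvPolynomial (Fin m) QQt)) ∧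
        -- the formula at q = t = 1
        (∀ m : ℕ+, atQOne (katoPoly qVar m e) =
          toLaurent QQt m (chromQuasi (1 : QQt) (unitIntervalGraph e) m)) := by
  
  have hN : ∀ r : ℕ, scaleSymm (triangularPow tVar) (elemSymm QQt r) =
      (tVar : QQt) ^ (r * (r - 1) / 2) • elemSymm QQt r := fun r => by
    rw [scaleSymm_elemSymm (by simp [triangularPow]), triangularPow, Units.val_pow_eq_pow_val,
      Nat.choose_two_right]
  refine ⟨scaleSymm (triangularPow tVar), hN, fun N' hN' F => ?_, fun n e => ?_⟩
  · have : N' = (scaleSymm (triangularPow tVar)).toAlgHom :=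
      symmFun_algHom_ext fun r => (hN' (r + 1)).trans (hN (r + 1)).symm
    rw [this]
    rfl
  have htτ : (tVar : QQt) * ((tVar⁻¹ : QQtˣ) : QQt) = 1 := tVar.mul_inv
  have hmem := qtFam_mem (p := ((qVar⁻¹ : QQtˣ) : QQt)) htτ e.valid
  refine ⟨qtFam tVar ((tVar⁻¹ : QQtˣ) : QQt) ((qVar⁻¹ : QQtˣ) : QQt) n e.toFun,
    fun m => (qtChrom_eq qVar tVar e).symm, fun m => ⟨qtFam_isSymmetric e.valid m, fun d => ?_⟩,
    fun m m' h => trunc_qtFam htτ e.valid h, hmem, ?_, fun m => ?_⟩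
  · let S := Algebra.adjoin ℤ ({(qVar : QQt)⁻¹, (tVar : QQt), (tVar : QQt)⁻¹} : Set QQt)
    have hq : ((qVar⁻¹ : QQtˣ) : QQt) ∈ S :=
      Algebra.subset_adjoin (by rw [Units.val_inv_eq_inv_val]; simp)
    have ht : (tVar : QQt) ∈ S := Algebra.subset_adjoin (by simp)
    have ht' : ((tVar⁻¹ : QQtˣ) : QQt) ∈ S :=
      Algebra.subset_adjoin (by rw [Units.val_inv_eq_inv_val]; simp)
    -- Carried out over the subring S, the construction maps to the polynomial in question, so its
    -- coefficients lie in S.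
    have := map_restr_qtPoly S.val.toRingHom (t := ⟨_, ht⟩) (τ := ⟨_, ht'⟩) (p := ⟨_, hq⟩) n m
      e.toFun
    have h2 := congrArg (MvPolynomial.coeff d) this
    rw [MvPolynomial.coeff_map] at h2
    have h3 : MvPolynomial.coeff d (qtFam (tVar : QQt) ((tVar⁻¹ : QQtˣ) : QQt)
        ((qVar⁻¹ : QQtˣ) : QQt) n e.toFun m) = _ := h2.symm
    rw [h3]
    exact Subtype.property _
  · have hfun : chromQuasi (tVar : QQt) (unitIntervalGraph e) = chromFam (tVar : QQt) n e.toFun :=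
      funext fun m => chromQuasi_unitIntervalGraph e m
    have ht : (tVar : QQt) ∈ regularAtOne := C_mem_regularAtOne _
    have ht' : ((tVar⁻¹ : QQtˣ) : QQt) ∈ regularAtOne := by
      rw [inv_tVar]; exact C_mem_regularAtOne _
    -- The polynomial lifts to the ring of elements without pole at q = 1. Specializing the lift
    -- replaces p = q⁻¹ by 1 and keeps t.
    have hval : (fun m : ℕ+ => atQOne (qtFam (tVar : QQt) ((tVar⁻¹ : QQtˣ) : QQt)
        ((qVar⁻¹ : QQtˣ) : QQt) n e.toFun m)) =
        qtFam (tVar : QQt) ((tVar⁻¹ : QQtˣ) : QQt) 1 n e.toFun := by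
      funext m
      have h1 := map_restr_qtPoly regularAtOne.subtype (t := ⟨_, ht⟩) (τ := ⟨_, ht'⟩)
        (p := ⟨_, inv_qVar_mem_regularAtOne⟩) n m e.toFun
      have h2 := map_restr_qtPoly valueAtOne (t := ⟨_, ht⟩) (τ := ⟨_, ht'⟩)
        (p := ⟨_, inv_qVar_mem_regularAtOne⟩) n m e.toFun
      have v1 : valueAtOne ⟨_, ht⟩ = tVar := scalarAtOne_C _
      have v2 : valueAtOne ⟨_, ht'⟩ = ((tVar⁻¹ : QQtˣ) : QQt) :=
        (congrArg scalarAtOne inv_tVar).trans ((scalarAtOne_C _).trans inv_tVar.symm)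
      rw [valueAtOne_inv_qVar, v1, v2] at h2
      exact (congrArg atQOne h1.symm).trans ((atQOne_map _).trans h2)
    -- A general f lets the equality be substituted together with the proof of membership.
    have key : ∀ f, f = chromFam (tVar : QQt) n e.toFun → ∃ h : f ∈ SymmFun QQt,
        (fun m : ℕ+ => atQOne (qtFam (tVar : QQt) ((tVar⁻¹ : QQtˣ) : QQt)
          ((qVar⁻¹ : QQtˣ) : QQt) n e.toFun m)) =
        (scaleSymm (triangularPow tVar) ⟨f, h⟩ : (m : ℕ+) → MvPolynomial (Fin m) QQt) := by
      rintro _ rfl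
      refine ⟨chromFam_mem tVar_sum_ne_zero e.valid, ?_⟩
      rw [hval, scaleSymm_chromFam tVar_sum_ne_zero e.valid]
    exact key _ hfun
  -- Kato's product is the case t = τ = 1 with p = q⁻¹; it specializes to p = 1 in the same way.
  · have h1 := map_restr_qtPoly regularAtOne.subtype (t := 1) (τ := 1)
      (p := ⟨_, inv_qVar_mem_regularAtOne⟩) n m e.toFun
    have h2 := map_restr_qtPoly valueAtOne (t := 1) (τ := 1)
      (p := ⟨_, inv_qVar_mem_regularAtOne⟩) n m e.toFun
    rw [valueAtOne_inv_qVar, map_one] at h2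
    rw [map_one] at h1
    rw [katoPoly_eq, chromQuasi_unitIntervalGraph]
    have h3 : restr QQt m (qtPoly 1 1 1 n m e.toFun) = chromPoly 1 n m e.toFun :=
      congrFun (qtFam_one_eq_chromFam e.valid) m
    rw [← h3, ← h2, ← atQOne_toLaurent_map, h1]
    rfl
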